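/- All manifolds, metrics and fields are smooth. A Sasakian structure on a non-empty 3-manifold $M$ is a Riemannian metric $g$ with a unit Killing field $\xi$ such that $R(X,\xi)Y=g(\xi,Y)X-g(X,Y)\xi$ for all $X,Y$, where $R(X,Y)=[\nabla_X,\nabla_Y]-\nabla_{[X,Y]}$. Its contact form is $\eta=g(\xi,\cdot)$, its scalar curvature is denoted $R$, and its Tanaka--Webster curvature is $W=\frac14(R+2)$. It is called $\eta$-Einstein if $\mathrm{Ric}=a\,g+b\,\eta\otimes\eta$ for some constants $a,b\in\mathbb R$. **Theorem.** Let $(g,\xi)$ be a Sasakian structure on a 3-manifold $M$. (1) The scalar curvature $R$ is constant if and only if $(g,\xi)$ is $\eta$-Einstein. If $\mathrm{Ric}=a\,g+b\,\eta\otimes\eta$, then $a+b=2$, $R=3a+b=2(a+1)$ and $W=\frac12(a+2)$. If $R$ is constant, then so is $W=\frac14(R+2)$. (2) Suppose that $W$ is constant. Then every point of $M$ has a neighbourhood with coordinates in which $g$ and $\eta$ are as follows. * If $W>0$: coordinates $(\rho,\theta,\phi)$ with $0<\theta<\pi$, $$g=\frac1{2W}\Big[d\theta^2+\sin^2\theta\,d\phi^2+\frac2W(d\rho+\cos\theta\,d\phi)^2\Big],\qquad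 \eta=\frac1W(d\rho+\cos\theta\,d\phi).$$ * If $W=0$: coordinates $(r,u,v)$, $$g=(dr+2v\,du)^2+du^2+dv^2,\qquad \eta=dr+2v\,du.$$ * If $W<0$: coordinates $(\rho,\theta,\phi)$ with $\theta>0$, $$g=-\frac1{2W}\Big[d\theta^2+\sinh^2\theta\,d\phi^2-\frac2W(d\rho+\cosh\theta\,d\phi)^2\Big],\qquad \eta=\frac1W(d\rho+\cosh\theta\,d\phi).$$ Moreover $g$ is Einstein if and only if $W=2$. (3) Conversely, for every $W>0$, for $W=0$ and for every $W<0$, these formulas define a Sasakian structure on $\{0<\theta<\pi\}$, on $\mathbb R^3$ and on $\{\theta>0\}$ respectively, with Killing field $W\partial_\rho$, $\partial_r$ and $W\partial_\rho$, and with constant Tanaka--Webster curvature $W$. These structures are identified as follows. * $W>0$: let $g_0$ be the round metric of the unit sphere $S^3\subset\mathbb C^2$ and $\eta_0(Z)=\langle iz,Z\rangle$ its standard contact form. There is a smooth map $\{0<\theta<\pi\}\to S^3$ that pulls $\frac2W\big(g_0+(\frac2W-1)\eta_0^2\big)$ back to $g$ and $\frac2W\eta_0$ back to $\eta$. Thus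 $W=2$ gives the standard round Sasakian structure on $S^3$, and $W\neq2$ gives a multiple of a Berger metric (the round metric rescaled along the Hopf fibres). * $W=0$: on the group $Nil$ of matrices $\begin{pmatrix}1&x&z\\0&1&y\\0&0&1\end{pmatrix}$ there is a smooth bijective parametrization $\mathbb R^3\to Nil$ that pulls $\frac14\big(dx^2+dy^2+(dz-x\,dy)^2\big)$ back to $g$ and $\frac12(dz-x\,dy)$ back to $\eta$. * $W<0$: write the Maurer--Cartan form $A^{-1}dA$ of $SL(2,\mathbb R)$ as $\omega_H\begin{pmatrix}1&0\\0&-1\end{pmatrix}+\omega_S\begin{pmatrix}0&1\\1&0\end{pmatrix}+\omega_J\begin{pmatrix}0&1\\-1&0\end{pmatrix}$. There is a smooth map $\{\theta>0\}\to SL(2,\mathbb R)$ that pulls the left-invariant metric $-\frac2W(\omega_H^2+\omega_S^2)+\frac4{W^2}\omega_J^2$ back to $g$ and $\frac2W\omega_J$ back to $\eta$. So the structure is locally the left-invariant one on $SL(2,\mathbb R)$, equivalently on its universal cover; for $W=-2$ the metric is $\omega_H^2+\omega_S^2+\omega_J^2$. -/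

import Mathlib

open scoped Manifold ContDiff Matrix

noncomputable section

namespace Sasaki

/-- The model space of 3-manifolds. -/
abbrev E3 : Type := EuclideanSpace ℝ (Fin 3)

/-- The `i`-th coordinate vector. -/
def basisVec (i : Fin 3) : E3 := EuclideanSpace.single i (1 : ℝ)

/-- The partial derivative `∂ᵢ f` of a function of three variables. -/
def pd (i : Fin 3) (f : E3 → ℝ) (x : E3) : ℝ := fderiv ℝ f x (basisVec i)

/-! ### Riemannian geometry in coordinates

`G x i j` are the components `g_ij(x)` of a metric, and a vector field or a 1-form is given by its
three components. -/

/-- Christoffel symbols of the Levi-Civita connection: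
`Γᵏᵢⱼ = ½ gᵏˡ (∂ᵢ g_jl + ∂ⱼ g_il - ∂ₗ g_ij)`. -/
def christoffel (G : E3 → Matrix (Fin 3) (Fin 3) ℝ) (k i j : Fin 3) (x : E3) : ℝ :=
  (1 / 2) * ∑ l, (G x)⁻¹ k l *
    (pd i (fun y => G y j l) x + pd j (fun y => G y i l) x - pd l (fun y => G y i j) x)

/-- Components of the Riemann curvature: `R(∂ᵢ, ∂ⱼ)∂ₖ = riem G l i j k • ∂ₗ` (summed over `l`),
where `R(X,Y)Z = ∇_X ∇_Y Z - ∇_Y ∇_X Z - ∇_[X,Y] Z`. -/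
def riem (G : E3 → Matrix (Fin 3) (Fin 3) ℝ) (l i j k : Fin 3) (x : E3) : ℝ :=
  pd i (christoffel G l j k) x - pd j (christoffel G l i k) x
    + ∑ m, (christoffel G l i m x * christoffel G m j k x
      - christoffel G l j m x * christoffel G m i k x)

/-- The vector `R(X,Y)Z` at `x`. -/
def curvature (G : E3 → Matrix (Fin 3) (Fin 3) ℝ) (x : E3) (X Y Z : Fin 3 → ℝ) : Fin 3 → ℝ :=
  fun l => ∑ i, ∑ j, ∑ k, riem G l i j k x * X i * Y j * Z k

/-- The Ricci tensor: `Ric(Y,Z)` is the trace of `X ↦ R(X,Y)Z`. -/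
def ricci (G : E3 → Matrix (Fin 3) (Fin 3) ℝ) (x : E3) : Matrix (Fin 3) (Fin 3) ℝ :=
  Matrix.of fun j k => ∑ i, riem G i i j k x

/-- The scalar curvature `R = gʲᵏ R_jk`. -/
def scalarCurvature (G : E3 → Matrix (Fin 3) (Fin 3) ℝ) (x : E3) : ℝ :=
  ∑ j, ∑ k, (G x)⁻¹ j k * ricci G x j k

/-- The Tanaka-Webster curvature `W = (R + 2) / 4` of a Sasakian structure on a 3-manifold. -/
def tanakaWebster (G : E3 → Matrix (Fin 3) (Fin 3) ℝ) (x : E3) : ℝ :=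
  (scalarCurvature G x + 2) / 4

/-- `G` is a smooth Riemannian metric on `U`. -/
structure IsRiemannianOn (U : Set E3) (G : E3 → Matrix (Fin 3) (Fin 3) ℝ) : Prop where
  smooth : ∀ i j, ContDiffOn ℝ ∞ (fun x => G x i j) U
  posDef : ∀ x ∈ U, (G x).PosDef

/-- `ξ` is a unit Killing field of `G` on `U` such that `R(X,ξ)Y = g(ξ,Y)X - g(X,Y)ξ`. -/
structure IsSasakianOn (U : Set E3) (G : E3 → Matrix (Fin 3) (Fin 3) ℝ)
    (ξ : E3 → Fin 3 → ℝ) : Prop where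
  unit : ∀ x ∈ U, ξ x ⬝ᵥ G x *ᵥ ξ x = 1
  killing : ∀ x ∈ U, ∀ i j, ∑ k, (ξ x k * pd k (fun y => G y i j) x
    + G x k j * pd i (fun y => ξ y k) x + G x i k * pd j (fun y => ξ y k) x) = 0
  curv : ∀ x ∈ U, ∀ X Y : Fin 3 → ℝ,
    curvature G x X (ξ x) Y = (ξ x ⬝ᵥ G x *ᵥ Y) • X - (X ⬝ᵥ G x *ᵥ Y) • ξ x

/-! ### Structures on a smooth 3-manifold

The components of tensors are read off in charts. The conditions below are tensorial; they are
imposed in every chart of the given atlas. -/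

section Manifold

variable {M : Type*} [TopologicalSpace M] [ChartedSpace E3 M] [IsManifold 𝓘(ℝ, E3) ∞ M]

/-- Smooth Riemannian metrics on `M`. -/
abbrev SmoothMetric (M : Type*) [TopologicalSpace M] [ChartedSpace E3 M] [IsManifold 𝓘(ℝ, E3) ∞ M] :=
  Bundle.ContMDiffRiemannianMetric 𝓘(ℝ, E3) ∞ E3 (fun p : M => TangentSpace 𝓘(ℝ, E3) p)

/-- The coordinate vector `∂ᵢ` of the chart `e`, at the point with coordinates `x`. -/
def coordVec (e : OpenPartialHomeomorph M E3) (x : E3) (i : Fin 3) :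
    TangentSpace 𝓘(ℝ, E3) (e.symm x) :=
  mfderiv 𝓘(ℝ, E3) 𝓘(ℝ, E3) e.symm x (basisVec i)

/-- The components `g_ij` of the metric in the chart `e`. -/
def metricIn (g : SmoothMetric M) (e : OpenPartialHomeomorph M E3) (x : E3) :
    Matrix (Fin 3) (Fin 3) ℝ :=
  Matrix.of fun i j => g.inner (e.symm x) (coordVec e x i) (coordVec e x j)

/-- The components `ξⁱ` of the vector field in the chart `e`. -/
def fieldIn (ξ : ∀ p : M, TangentSpace 𝓘(ℝ, E3) p) (e : OpenPartialHomeomorph M E3) (x : E3) :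
    Fin 3 → ℝ :=
  fun i => (show E3 from mfderiv 𝓘(ℝ, E3) 𝓘(ℝ, E3) e (e.symm x) (ξ (e.symm x))) i

/-- The components `ηᵢ` of the contact form `η = g(ξ, ·)` in the chart `e`. -/
def contactIn (g : SmoothMetric M) (ξ : ∀ p : M, TangentSpace 𝓘(ℝ, E3) p)
    (e : OpenPartialHomeomorph M E3) (x : E3) : Fin 3 → ℝ :=
  fun i => g.inner (e.symm x) (ξ (e.symm x)) (coordVec e x i)

/-- A Sasakian structure on a 3-manifold: a metric with a smooth unit Killing field `ξ` such that
`R(X,ξ)Y = g(ξ,Y)X - g(X,Y)ξ`. -/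
structure IsSasakian (g : SmoothMetric M) (ξ : ∀ p : M, TangentSpace 𝓘(ℝ, E3) p) : Prop where
  smooth : ContMDiff 𝓘(ℝ, E3) 𝓘(ℝ, E3).tangent ∞
    (fun p => (⟨p, ξ p⟩ : TangentBundle 𝓘(ℝ, E3) M))
  sasakian : ∀ e ∈ atlas E3 M, IsSasakianOn e.target (metricIn g e) (fieldIn ξ e)

/-- The scalar curvature of `g` is constant, equal to `c`. -/
def HasScalarCurvature (g : SmoothMetric M) (c : ℝ) : Prop :=
  ∀ e ∈ atlas E3 M, ∀ x ∈ e.target, scalarCurvature (metricIn g e) x = c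

/-- The Tanaka-Webster curvature is constant, equal to `W`. -/
def HasTanakaWebster (g : SmoothMetric M) (W : ℝ) : Prop :=
  ∀ e ∈ atlas E3 M, ∀ x ∈ e.target, tanakaWebster (metricIn g e) x = W

/-- `Ric = a g + b η ⊗ η` with the constants `a` and `b`. -/
def IsEtaEinsteinWith (g : SmoothMetric M) (ξ : ∀ p : M, TangentSpace 𝓘(ℝ, E3) p) (a b : ℝ) : Prop :=
  ∀ e ∈ atlas E3 M, ∀ x ∈ e.target,
    ricci (metricIn g e) x = a • metricIn g e x
      + b • Matrix.vecMulVec (contactIn g ξ e x) (contactIn g ξ e x)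

/-- `g` is Einstein: `Ric = c g` for a constant `c`. -/
def IsEinstein (g : SmoothMetric M) : Prop :=
  ∃ c : ℝ, ∀ e ∈ atlas E3 M, ∀ x ∈ e.target, ricci (metricIn g e) x = c • metricIn g e x

/-- Around every point of `M` there are local coordinates, with values in `U`, in which the metric
is `G` and the contact form is `α`. -/
def IsLocallyOfForm (g : SmoothMetric M) (ξ : ∀ p : M, TangentSpace 𝓘(ℝ, E3) p) (U : Set E3)
    (G : E3 → Matrix (Fin 3) (Fin 3) ℝ) (α : E3 → Fin 3 → ℝ) : Prop :=
  ∀ p : M, ∃ e ∈ IsManifold.maximalAtlas 𝓘(ℝ, E3) ∞ M, p ∈ e.source ∧ e.target ⊆ U ∧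
    ∀ x ∈ e.target, metricIn g e x = G x ∧ contactIn g ξ e x = α x

end Manifold

/-! ### The three families

The coordinates are `(x 0, x 1, x 2) = (ρ, θ, φ)` if `W ≠ 0`, and `(r, u, v)` if `W = 0`. -/

/-- The differential of the `i`-th coordinate. -/
def dx (i : Fin 3) : Fin 3 → ℝ := Pi.single i 1

/-- The square `β ⊗ β` of a covector. -/
def sq (β : Fin 3 → ℝ) : Matrix (Fin 3) (Fin 3) ℝ := Matrix.vecMulVec β β

/-- `0 < θ < π`. -/
def posDomain : Set E3 := {x | 0 < x 1 ∧ x 1 < Real.pi}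

/-- `(1/2W) [dθ² + sin²θ dφ² + (2/W) (dρ + cos θ dφ)²]`. -/
def posMetric (W : ℝ) (x : E3) : Matrix (Fin 3) (Fin 3) ℝ :=
  (1 / (2 * W)) • (sq (dx 1) + Real.sin (x 1) ^ 2 • sq (dx 2)
    + (2 / W) • sq (dx 0 + Real.cos (x 1) • dx 2))

/-- `(1/W) (dρ + cos θ dφ)`. -/
def posForm (W : ℝ) (x : E3) : Fin 3 → ℝ := (1 / W) • (dx 0 + Real.cos (x 1) • dx 2)

/-- `(dr + 2v du)² + du² + dv²`. -/
def nilMetric (x : E3) : Matrix (Fin 3) (Fin 3) ℝ :=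
  sq (dx 0 + (2 * x 2) • dx 1) + sq (dx 1) + sq (dx 2)

/-- `dr + 2v du`. -/
def nilForm (x : E3) : Fin 3 → ℝ := dx 0 + (2 * x 2) • dx 1

/-- `0 < θ`. -/
def negDomain : Set E3 := {x | 0 < x 1}

/-- `-(1/2W) [dθ² + sinh²θ dφ² - (2/W) (dρ + cosh θ dφ)²]`. -/
def negMetric (W : ℝ) (x : E3) : Matrix (Fin 3) (Fin 3) ℝ :=
  (-(1 / (2 * W))) • (sq (dx 1) + Real.sinh (x 1) ^ 2 • sq (dx 2)
    - (2 / W) • sq (dx 0 + Real.cosh (x 1) • dx 2))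

/-- `(1/W) (dρ + cosh θ dφ)`. -/
def negForm (W : ℝ) (x : E3) : Fin 3 → ℝ := (1 / W) • (dx 0 + Real.cosh (x 1) • dx 2)

/-- On `U` the metric `G` with the Killing field `ξ` is a Sasakian structure with contact form `α`
and constant Tanaka-Webster curvature `W`. -/
structure IsSasakianModel (U : Set E3) (G : E3 → Matrix (Fin 3) (Fin 3) ℝ) (ξ α : E3 → Fin 3 → ℝ)
    (W : ℝ) : Prop where
  riemannian : IsRiemannianOn U G
  field_smooth : ∀ i, ContDiffOn ℝ ∞ (fun x => ξ x i) U
  sasakian : IsSasakianOn U G ξ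
  contact : ∀ x ∈ U, α x = G x *ᵥ ξ x
  webster : ∀ x ∈ U, tanakaWebster G x = W

/-! ### The geometries `S³`, `Nil` and `SL(2,ℝ)` -/

/-- `ℂ²`, regarded as a real inner product space. -/
abbrev C2 : Type := EuclideanSpace ℂ (Fin 2)

/-- The standard contact form of `S³ ⊆ ℂ²`: the inner product of a tangent vector `Z` at `z` with
the unit tangent vector `i z` of the Hopf fibre. -/
def hopfForm (z Z : C2) : ℝ := inner ℝ (Complex.I • z) Z

/-- `Ψ : U → S³` is smooth and pulls back to `G` the metric `(2/W) (g₀ + (2/W - 1) η₀²)` and to `α`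
the form `(2/W) η₀`, where `g₀` is the round metric of the unit sphere and `η₀` its standard
contact form. For `W = 2` these are `g₀` and `η₀`; for `W ≠ 2` the metric is a multiple of a Berger
metric, that is, of the round metric rescaled along the fibres of the Hopf fibration. -/
structure IsBergerMap (U : Set E3) (G : E3 → Matrix (Fin 3) (Fin 3) ℝ) (α : E3 → Fin 3 → ℝ)
    (W : ℝ) (Ψ : E3 → C2) : Prop where
  smooth : ContDiffOn ℝ ∞ Ψ U
  mem_sphere : ∀ x ∈ U, ‖Ψ x‖ = 1
  metric : ∀ x ∈ U, ∀ v w : E3, v.ofLp ⬝ᵥ G x *ᵥ w.ofLp =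
    (2 / W) * (inner ℝ (fderiv ℝ Ψ x v) (fderiv ℝ Ψ x w) +
      (2 / W - 1) * (hopfForm (Ψ x) (fderiv ℝ Ψ x v) * hopfForm (Ψ x) (fderiv ℝ Ψ x w)))
  contact : ∀ x ∈ U, ∀ v : E3, α x ⬝ᵥ v.ofLp = (2 / W) * hopfForm (Ψ x) (fderiv ℝ Ψ x v)

/-- The pull-back `Ψ⁻¹ dΨ` of the Maurer-Cartan form under a map `Ψ` into a group of matrices. -/
def maurerCartan {n : ℕ} (Ψ : E3 → Matrix (Fin n) (Fin n) ℝ) (x v : E3) :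
    Matrix (Fin n) (Fin n) ℝ :=
  (Ψ x)⁻¹ * Matrix.of fun i j => fderiv ℝ (fun y => Ψ y i j) x v

/-- The group `Nil` of upper unitriangular real 3 × 3 matrices. -/
def nilGroup : Set (Matrix (Fin 3) (Fin 3) ℝ) :=
  {A | (∀ i, A i i = 1) ∧ ∀ i j, j < i → A i j = 0}

/-- `Ψ` is a smooth parametrization of `Nil` which pulls back to `G` one quarter of the standard
left-invariant metric `dx² + dy² + (dz - x dy)²` of the matrices `[1, x, z; 0, 1, y; 0, 0, 1]`, and
to `α` one half of the standard left-invariant contact form `dz - x dy`. -/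
structure IsNilMap (G : E3 → Matrix (Fin 3) (Fin 3) ℝ) (α : E3 → Fin 3 → ℝ)
    (Ψ : E3 → Matrix (Fin 3) (Fin 3) ℝ) : Prop where
  smooth : ∀ i j, ContDiff ℝ ∞ fun x => Ψ x i j
  bijOn : Set.BijOn Ψ Set.univ nilGroup
  metric : ∀ x v w : E3, v.ofLp ⬝ᵥ G x *ᵥ w.ofLp =
    (1 / 4) * (maurerCartan Ψ x v 0 1 * maurerCartan Ψ x w 0 1
      + maurerCartan Ψ x v 1 2 * maurerCartan Ψ x w 1 2
      + maurerCartan Ψ x v 0 2 * maurerCartan Ψ x w 0 2)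
  contact : ∀ x v : E3, α x ⬝ᵥ v.ofLp = (1 / 2) * maurerCartan Ψ x v 0 2

/-- The coordinate of `A ∈ sl(2,ℝ)` along `[1, 0; 0, -1]`, in the basis `[1, 0; 0, -1]`,
`[0, 1; 1, 0]`, `[0, 1; -1, 0]`. -/
def slH (A : Matrix (Fin 2) (Fin 2) ℝ) : ℝ := (A 0 0 - A 1 1) / 2

/-- The coordinate of `A ∈ sl(2,ℝ)` along `[0, 1; 1, 0]`. -/
def slS (A : Matrix (Fin 2) (Fin 2) ℝ) : ℝ := (A 0 1 + A 1 0) / 2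

/-- The coordinate of `A ∈ sl(2,ℝ)` along `[0, 1; -1, 0]`, which spans `so(2)`. -/
def slJ (A : Matrix (Fin 2) (Fin 2) ℝ) : ℝ := (A 0 1 - A 1 0) / 2

/-- `Ψ : U → SL(2,ℝ)` is smooth and pulls back to `G` the left-invariant metric
`-(2/W) (ω_H² + ω_S²) + (4/W²) ω_J²` and to `α` the left-invariant form `(2/W) ω_J`, where
`ω_H`, `ω_S`, `ω_J` are the components of the Maurer-Cartan form. For `W = -2` the metric is
`ω_H² + ω_S² + ω_J²`. -/
structure IsSLMap (U : Set E3) (G : E3 → Matrix (Fin 3) (Fin 3) ℝ) (α : E3 → Fin 3 → ℝ)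
    (W : ℝ) (Ψ : E3 → Matrix (Fin 2) (Fin 2) ℝ) : Prop where
  smooth : ∀ i j, ContDiffOn ℝ ∞ (fun x => Ψ x i j) U
  det_eq : ∀ x ∈ U, (Ψ x).det = 1
  metric : ∀ x ∈ U, ∀ v w : E3, v.ofLp ⬝ᵥ G x *ᵥ w.ofLp =
    (-(2 / W)) * (slH (maurerCartan Ψ x v) * slH (maurerCartan Ψ x w)
      + slS (maurerCartan Ψ x v) * slS (maurerCartan Ψ x w))
      + (4 / W ^ 2) * (slJ (maurerCartan Ψ x v) * slJ (maurerCartan Ψ x w))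
  contact : ∀ x ∈ U, ∀ v : E3, α x ⬝ᵥ v.ofLp = (2 / W) * slJ (maurerCartan Ψ x v)

end Sasaki

end

open Sasaki

/-! Cartan's moving frames reduce the theorem to structure equations with constant coefficients,
which are then integrated. Near a point choose an orthonormal coframe `(a, b, c)` with `c = η`. The
Killing equation and `|ξ| = 1` leave one unknown function `s` in `∇ξ`, and the curvature condition
forces `s² = 1`. Every plane containing `ξ` therefore has sectional curvature 1, so the only free
curvature is that of the contact plane, which is `2W - 3`. Hence `Ric = (2W - 2) g + (4 - 2W) η ⊗ η`
holds with no assumption on `W` (`ricci_and_curvForm`). As `g` and `η ⊗ η` are linearly independent,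
part (1) and the Einstein criterion follow by comparing coefficients.

With `p = ω₀₁ - s c` the equations read `da = -p ∧ b`, `db = p ∧ a`, `dc = -2s a ∧ b`, `dp = 2W a ∧
b`. The transverse metric `a² + b²` thus has Gauss curvature `2W`, and `c` is, up to sign, a
potential of twice its area form. If `W` is constant, the system `Hess f = -2W f (a² + b²)` for
transverse functions is flat, so Frobenius' theorem (`exists_parallel_of_flat`,
`exists_parallel_section`) gives a solution with any prescribed first jet
(`exists_hessian_function`). A suitable solution plays the role of `cos θ`, `cosh θ` or a flat
coordinate; its first integral makes the forms that should be `dφ` and `dρ`, or their analogues on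
`Nil`, closed, and Poincaré's lemma integrates them. The resulting functions pull the model metric
back to `g`. Since `g` is nondegenerate their Jacobian is invertible, and they form a chart
(`exists_chart_of_isPullbackOn`).

For the converse, the model metrics depend on a single coordinate, so their Christoffel symbols and
curvature are matrices of explicit functions of one variable (`curvMatrix_comp_coord`). The cases `W
> 0` and `W < 0` are one computation with a pair of profile functions (`isSasakianModel_profile`).
The maps to `S³`, `Nil` and `SL(2,ℝ)` are Euler angles of the Hopf fibration, a global matrix
parametrization, and Cartan `KAK` coordinates. -/

noncomputable section
namespace Sasaki
open Filter Topology Set Metric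

/-! ### Flat linear connections have parallel sections -/

section Frobenius

variable {E V : Type*} [NormedAddCommGroup E] [NormedSpace ℝ E]
  [NormedAddCommGroup V] [NormedSpace ℝ V]

/-- Near a point where `A` is `C²`, the first derivative is bounded and the second order Taylor
remainder is quadratic. -/
theorem exists_ball_taylor_bound {F : Type*} [NormedAddCommGroup F] [NormedSpace ℝ F]
    {A : E → F} {x₀ : E} (hA : ContDiffAt ℝ 2 A x₀) :
    ∃ r > 0, ∃ M : ℝ, 0 < M ∧ (∀ x ∈ ball x₀ r, DifferentiableAt ℝ A x) ∧
      (∀ x ∈ ball x₀ r, ‖A x‖ ≤ M) ∧ (∀ x ∈ ball x₀ r, ∀ h, ‖fderiv ℝ A x h‖ ≤ M * ‖h‖) ∧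
      (∀ x ∈ ball x₀ r, ∀ y ∈ ball x₀ r, ‖A y - A x‖ ≤ M * ‖y - x‖) ∧
      (∀ x ∈ ball x₀ r, ∀ y ∈ ball x₀ r,
        ‖A y - A x - fderiv ℝ A x (y - x)‖ ≤ M * ‖y - x‖ ^ 2) := by
  have hd : ContDiffAt ℝ 1 (fderiv ℝ A) x₀ := hA.fderiv_right (by norm_num)
  obtain ⟨K, t, ht, hK⟩ := hd.exists_lipschitzOnWith
  have h1 : ∀ᶠ x in 𝓝 x₀, DifferentiableAt ℝ A x :=
    (hA.eventually (by simp)).mono fun x hx => hx.differentiableAt (by simp)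
  have h2 : ∀ᶠ x in 𝓝 x₀, ‖A x‖ < ‖A x₀‖ + 1 :=
    hA.continuousAt.norm.eventually (gt_mem_nhds (by linarith))
  have h3 : ∀ᶠ x in 𝓝 x₀, ‖fderiv ℝ A x‖ < ‖fderiv ℝ A x₀‖ + 1 :=
    hd.continuousAt.norm.eventually (gt_mem_nhds (by linarith))
  obtain ⟨r, hr, hball⟩ := Metric.eventually_nhds_iff_ball.1 (h1.and (h2.and (h3.and ht)))
  set M : ℝ := ‖A x₀‖ + ‖fderiv ℝ A x₀‖ + K + 1 with hM
  have hMpos : 0 < M := by positivity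
  have hb : ∀ x ∈ ball x₀ r, ‖fderiv ℝ A x‖ ≤ M := fun x hx => by
    have := (hball x hx).2.2.1
    have := norm_nonneg (A x₀)
    have := K.coe_nonneg
    linarith
  refine ⟨r, hr, M, hMpos, fun x hx => (hball x hx).1, fun x hx => ?_,
    fun x hx h => ((fderiv ℝ A x).le_opNorm h).trans
      (mul_le_mul_of_nonneg_right (hb x hx) (norm_nonneg _)), fun x hx y hy => ?_,
    fun x hx y hy => ?_⟩
  · have := (hball x hx).2.1
    have := norm_nonneg (fderiv ℝ A x₀)
    have := K.coe_nonneg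
    linarith
  · exact (convex_ball x₀ r).norm_image_sub_le_of_norm_fderiv_le (fun z hz => (hball z hz).1) hb hx hy
  · have hseg : segment ℝ x y ⊆ ball x₀ r := (convex_ball x₀ r).segment_subset hx hy
    -- The mean value inequality on the segment, for `A` minus its linearization at `x`: there the
    -- derivative differs from `fderiv ℝ A x` by at most `K ‖y - x‖`, which gives the remainder `K
    -- ‖y - x‖²`.
    have := (convex_segment x y).norm_image_sub_le_of_norm_hasFDerivWithin_le'
      (f := A) (f' := fderiv ℝ A) (φ := fderiv ℝ A x) (C := K * ‖y - x‖)
      (fun z hz => ((hball z (hseg hz)).1.hasFDerivAt).hasFDerivWithinAt)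
      (fun z hz => by
        have h := hK.dist_le_mul z (hball z (hseg hz)).2.2.2 x (hball x hx).2.2.2
        rw [dist_eq_norm, dist_eq_norm] at h
        refine h.trans ?_
        gcongr
        obtain ⟨s, hs, rfl⟩ := segment_eq_image' ℝ x y ▸ hz
        rw [add_sub_cancel_left, norm_smul, Real.norm_of_nonneg hs.1]
        exact mul_le_of_le_one_left (norm_nonneg _) hs.2)
      (left_mem_segment ℝ x y) (right_mem_segment ℝ x y)
    refine this.trans ?_
    have h1 := norm_nonneg (A x₀)
    have h2 := norm_nonneg (fderiv ℝ A x₀)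
    nlinarith [sq_nonneg ‖y - x‖]

/-- The linear ODE `u' = B(t) u` with small `B` is solvable on `[0,1]`. -/
theorem exists_linear_ode_solution [CompleteSpace V] (B : ℝ → V →L[ℝ] V)
    (hB : ContinuousOn B (Icc 0 1)) (hb : ∀ t ∈ Icc (0 : ℝ) 1, ‖B t‖ ≤ 1 / 2) (v₀ : V) :
    ∃ u : ℝ → V, u 0 = v₀ ∧ ∀ t ∈ Icc (0 : ℝ) 1, HasDerivWithinAt u (B t (u t)) (Icc 0 1) t := by
  -- For any radius `a ≥ ‖v₀‖` the field is bounded by `(‖v₀‖ + a) / 2 ≤ a` on the ball of radius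
  -- `a` around `v₀`, so the solution cannot leave that ball in unit time.
  set a : NNReal := ‖v₀‖₊ + 1
  have hPL : IsPicardLindelof (fun t v => B t v) (⟨0, by simp⟩ : Icc (0 : ℝ) 1) v₀ a 0 a
      (1 / 2) := by
    refine ⟨fun t ht => ?_, fun x _ => ?_, fun t ht x hx => ?_, ?_⟩
    · refine ((B t).lipschitz.weaken ?_).lipschitzOnWith
      rw [← NNReal.coe_le_coe]
      simpa using hb t ht
    · exact hB.clm_apply continuousOn_const
    · have hx' : ‖x‖ ≤ ‖v₀‖ + a := by
        have := norm_le_of_mem_closedBall hx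
        simpa using this
      have : (a : ℝ) = ‖v₀‖ + 1 := by simp [a]
      calc ‖B t x‖ ≤ ‖B t‖ * ‖x‖ := (B t).le_opNorm x
        _ ≤ 1 / 2 * (‖v₀‖ + a) := by gcongr; exact hb t ht
        _ ≤ a := by rw [this]; linarith
    · simp
  exact hPL.exists_eq_forall_mem_Icc_hasDerivWithinAt₀

/-- The defect of the first order approximation of the radial transport. -/
theorem norm_residual_le {a b : E →L[ℝ] V →L[ℝ] V} {D : E →L[ℝ] E →L[ℝ] V →L[ℝ] V}
    {y h : E} {U : V} {t M r N : ℝ} (hM : 0 ≤ M) (ht : t ∈ Icc (0 : ℝ) 1)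
    (ha : ‖a‖ ≤ M) (hD : ∀ k, ‖D k‖ ≤ M * ‖k‖) (hyhn : ‖y + h‖ ≤ r)
    (hl : ‖b - a‖ ≤ M * ‖t • h‖) (htl : ‖b - a - D (t • h)‖ ≤ M * ‖t • h‖ ^ 2) (hut : ‖U‖ ≤ N)
    (hflt : D y h + (a h).comp (a y) = D h y + (a y).comp (a h)) :
    ‖a y U + (a h U + t • (D y h U + a h (a y U))) - b (y + h) (U + t • a h U)‖
      ≤ (M * N + M * r * N + M * (M * N) + M * r * (M * N)) * ‖h‖ ^ 2 := by
  have hN0 : 0 ≤ N := (norm_nonneg _).trans hut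
  have hr0 : 0 ≤ r := (norm_nonneg _).trans hyhn
  have hth : ‖t • h‖ ≤ ‖h‖ := by
    rw [norm_smul, Real.norm_of_nonneg ht.1]
    exact mul_le_of_le_one_left (norm_nonneg _) ht.2
  have hflt' : D y h U + a h (a y U) = D h y U + a y (a h U) := by
    have := congrArg (fun T : V →L[ℝ] V => T U) hflt
    simpa using this
  -- Here `a`, `b` are the values of the connection at the points at time `t` on the rays through
  -- `y` and `y + h`, `D` is its derivative at the former, and `U` is the transported vector.
  -- Flatness cancels all terms of first order in `h`; each of the four remaining ones is quadratic.
  have hid : a y U + (a h U + t • (D y h U + a h (a y U))) - b (y + h) (U + t • a h U)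
      = -(t • D h h U + (b - a - D (t • h)) (y + h) U + t • a h (a h U)
        + t • (b - a) (y + h) (a h U)) := by
    rw [hflt']
    simp only [map_add, map_smul, sub_apply, smul_apply,
      add_apply, smul_add, smul_sub]
    abel
  rw [hid, norm_neg]
  have e0 : ‖a h U‖ ≤ M * N * ‖h‖ := by
    calc ‖a h U‖ ≤ ‖a‖ * ‖h‖ * ‖U‖ := a.le_opNorm₂ h U
      _ ≤ M * ‖h‖ * N := by gcongr
      _ = _ := by ring
  have ht' : ∀ v : V, ‖t • v‖ ≤ ‖v‖ := fun v => by
    rw [norm_smul, Real.norm_of_nonneg ht.1]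
    exact mul_le_of_le_one_left (norm_nonneg _) ht.2
  have e1 : ‖t • D h h U‖ ≤ M * N * ‖h‖ ^ 2 := by
    calc ‖t • D h h U‖ ≤ ‖D h h U‖ := ht' _
      _ ≤ ‖D h‖ * ‖h‖ * ‖U‖ := (D h).le_opNorm₂ h U
      _ ≤ (M * ‖h‖) * ‖h‖ * N := by
        gcongr
        exact hD h
      _ = _ := by ring
  have e2 : ‖(b - a - D (t • h)) (y + h) U‖ ≤ M * r * N * ‖h‖ ^ 2 := by
    calc _ ≤ ‖b - a - D (t • h)‖ * ‖y + h‖ * ‖U‖ := ContinuousLinearMap.le_opNorm₂ _ _ _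
      _ ≤ (M * ‖h‖ ^ 2) * r * N := by
        gcongr
        exact htl.trans (by gcongr)
      _ = _ := by ring
  have e3 : ‖t • a h (a h U)‖ ≤ M * (M * N) * ‖h‖ ^ 2 := by
    calc _ ≤ ‖a h (a h U)‖ := ht' _
      _ ≤ ‖a‖ * ‖h‖ * ‖a h U‖ := a.le_opNorm₂ _ _
      _ ≤ M * ‖h‖ * (M * N * ‖h‖) := by gcongr
      _ = _ := by ring
  have e4 : ‖t • (b - a) (y + h) (a h U)‖ ≤ M * r * (M * N) * ‖h‖ ^ 2 := by
    calc _ ≤ ‖(b - a) (y + h) (a h U)‖ := ht' _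
      _ ≤ ‖b - a‖ * ‖y + h‖ * ‖a h U‖ := ContinuousLinearMap.le_opNorm₂ _ _ _
      _ ≤ (M * ‖h‖) * r * (M * N * ‖h‖) := by
        gcongr
        exact hl.trans (by gcongr)
      _ = _ := by ring
  calc _ ≤ ‖t • D h h U‖ + ‖(b - a - D (t • h)) (y + h) U‖ + ‖t • a h (a h U)‖
        + ‖t • (b - a) (y + h) (a h U)‖ := by
        refine (norm_add_le _ _).trans ?_
        gcongr
        exact norm_add₃_le
    _ ≤ M * N * ‖h‖ ^ 2 + M * r * N * ‖h‖ ^ 2 + M * (M * N) * ‖h‖ ^ 2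
        + M * r * (M * N) * ‖h‖ ^ 2 := by gcongr
    _ = _ := by ring

/-- The radial transport of a flat linear connection is parallel: the heart of Frobenius' theorem
for linear total differential equations. -/
theorem exists_parallel_of_flat [CompleteSpace V] {A : E → E →L[ℝ] V →L[ℝ] V} {x₀ : E}
    (hA : ContDiffAt ℝ 2 A x₀)
    (hflat : ∀ᶠ x in 𝓝 x₀, ∀ h k : E,
      fderiv ℝ A x h k + (A x k).comp (A x h) = fderiv ℝ A x k h + (A x h).comp (A x k)) (v₀ : V) :
    ∃ F : E → V, F x₀ = v₀ ∧ ∀ᶠ x in 𝓝 x₀, HasFDerivAt F ((A x).flip (F x)) x := by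
  obtain ⟨r₁, hr₁, M, hM, hdiff, hAM, hDM, hLip, hTay⟩ := exists_ball_taylor_bound hA
  obtain ⟨r₂, hr₂, hfl⟩ := Metric.eventually_nhds_iff_ball.1 hflat
  -- The bound `M r ≤ 1/2` makes the radial equations solvable on the whole of `[0,1]`.
  set r : ℝ := min (min r₁ r₂) (1 / (2 * M)) with hr
  have hr0 : 0 < r := by positivity
  have hrM : M * r ≤ 1 / 2 := by
    calc M * r ≤ M * (1 / (2 * M)) := by gcongr; exact min_le_right _ _
      _ = 1 / 2 := by field_simp
  have hr1 : r ≤ r₁ := (min_le_left _ _).trans (min_le_left _ _)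
  have hr2 : r ≤ r₂ := (min_le_left _ _).trans (min_le_right _ _)
  have hmem : ∀ y ∈ ball (0 : E) r, ∀ t ∈ Icc (0 : ℝ) 1, x₀ + t • y ∈ ball x₀ r := by
    intro y hy t ht
    rw [mem_ball_zero_iff] at hy
    rw [mem_ball_iff_norm, add_sub_cancel_left, norm_smul, Real.norm_of_nonneg ht.1]
    exact (mul_le_of_le_one_left (norm_nonneg _) ht.2).trans_lt hy
  have hpath : ∀ (y : E) (t : ℝ), HasDerivAt (fun t : ℝ => x₀ + t • y) y t := fun y t => by
    simpa using ((hasDerivAt_id t).smul_const y).const_add x₀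
  have hBd : ∀ y ∈ ball (0 : E) r, ∀ t ∈ Icc (0 : ℝ) 1, ‖A (x₀ + t • y) y‖ ≤ 1 / 2 := by
    intro y hy t ht
    have h1 := hAM _ (ball_subset_ball hr1 (hmem y hy t ht))
    rw [mem_ball_zero_iff] at hy
    exact ((A (x₀ + t • y)).le_opNorm y).trans ((by gcongr : _ ≤ M * r).trans hrM)
  have hsol : ∀ y ∈ ball (0 : E) r, ∃ u : ℝ → V, u 0 = v₀ ∧ ∀ t ∈ Icc (0 : ℝ) 1,
      HasDerivWithinAt u (A (x₀ + t • y) y (u t)) (Icc 0 1) t := by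
    intro y hy
    refine exists_linear_ode_solution (fun t => A (x₀ + t • y) y) (fun t ht => ?_) (hBd y hy) v₀
    have h1 := (hdiff _ (ball_subset_ball hr1 (hmem y hy t ht))).continuousAt
    have h2 : ContinuousAt (fun t : ℝ => A (x₀ + t • y)) t :=
      ContinuousAt.comp (f := fun t : ℝ => x₀ + t • y) h1 (hpath y t).continuousAt
    exact (h2.clm_apply continuousAt_const).continuousWithinAt
  choose! u hu0 hu using hsol
  -- On the constant ray the equation is `u' = 0`.
  have hzero : u 0 1 = v₀ := by
    have h0 : (0 : E) ∈ ball (0 : E) r := mem_ball_self hr0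
    have hc := constant_of_has_deriv_right_zero (f := u 0) (a := 0) (b := 1)
      (fun t ht => (hu 0 h0 t ht).continuousWithinAt)
      (fun t ht => by
        have := (hu 0 h0 t (Ico_subset_Icc_self ht)).mono_of_mem_nhdsWithin
          (Icc_mem_nhdsGE_of_mem ht)
        simpa using this)
    rw [hc 1 (by simp), hu0 0 h0]
  refine ⟨fun x => u (x - x₀) 1, by simpa using hzero, ?_⟩
  filter_upwards [ball_mem_nhds x₀ hr0] with x hx
  set y := x - x₀ with hy
  have hyr : y ∈ ball (0 : E) r := mem_ball_zero_iff.2 (mem_ball_iff_norm.1 hx)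
  have hyn : ‖y‖ < r := by simpa using hyr
  obtain ⟨N, hN⟩ := isCompact_Icc.exists_bound_of_continuousOn
    (fun t ht => (hu y hyr t ht).continuousWithinAt : ContinuousOn (u y) (Icc 0 1))
  have hN0 : 0 ≤ N := (norm_nonneg _).trans (hN 0 (by simp))
  set C : ℝ := M * N + M * r * N + M * (M * N) + M * r * (M * N) with hC
  have key : ∀ h : E, y + h ∈ ball (0 : E) r →
      ‖u (y + h) 1 - (u y 1 + A x h (u y 1))‖ ≤ C * (Real.exp 1 - 1) * ‖h‖ ^ 2 := by
    intro h hyh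
    have hyhn : ‖y + h‖ ≤ r := by simpa using (mem_ball_zero_iff.1 hyh).le
    -- The expected first variation: if the transported section is parallel, moving the ray from `y`
    -- to `y + h` changes its value at time `t` by `t A(h) u` to first order. Flatness makes `w`
    -- solve the equation of the ray `y + h` up to `O(‖h‖²)`, and Gronwall compares it with the true
    -- solution at `t = 1`.
    set w : ℝ → V := fun t => u y t + t • A (x₀ + t • y) h (u y t) with hw
    set w' : ℝ → V := fun t => A (x₀ + t • y) y (u y t) + (A (x₀ + t • y) h (u y t) +
      t • (fderiv ℝ A (x₀ + t • y) y h (u y t)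
        + A (x₀ + t • y) h (A (x₀ + t • y) y (u y t)))) with hw'
    have hwd : ∀ t ∈ Icc (0 : ℝ) 1, HasDerivWithinAt w (w' t) (Icc 0 1) t := by
      intro t ht
      have h1 := hu y hyr t ht
      have h2 : HasDerivAt (fun t : ℝ => A (x₀ + t • y)) (fderiv ℝ A (x₀ + t • y) y) t :=
        HasFDerivAt.comp_hasDerivAt (f := fun t : ℝ => x₀ + t • y) t
          (hdiff _ (ball_subset_ball hr1 (hmem y hyr t ht))).hasFDerivAt (hpath y t)
      have h3 : HasDerivAt (fun t : ℝ => A (x₀ + t • y) h) (fderiv ℝ A (x₀ + t • y) y h) t := by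
        simpa using h2.clm_apply (hasDerivAt_const t h)
      have h4 := (hasDerivWithinAt_id t (Icc (0 : ℝ) 1)).smul (h3.hasDerivWithinAt.clm_apply h1)
      have h5 := h1.add h4
      refine h5.congr_deriv ?_
      simp only [hw', id, one_smul]
      abel
    have hres : ∀ t ∈ Icc (0 : ℝ) 1,
        ‖w' t - A (x₀ + t • (y + h)) (y + h) (w t)‖ ≤ C * ‖h‖ ^ 2 := by
      intro t ht
      have hz := ball_subset_ball hr1 (hmem y hyr t ht)
      have hz' := ball_subset_ball hr1 (hmem (y + h) hyh t ht)
      have hflt := hfl _ (ball_subset_ball hr2 (hmem y hyr t ht)) y h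
      have ha := hAM _ hz
      have hD := hDM _ hz
      have hl := hLip _ hz _ hz'
      have htl := hTay _ hz _ hz'
      have hsub : x₀ + t • (y + h) - (x₀ + t • y) = t • h := by rw [smul_add]; abel
      rw [hsub] at hl htl
      exact (norm_residual_le hM.le ht ha hD hyhn hl htl (hN t ht) hflt).trans_eq (by rw [hC])
    have right : ∀ {f f' : ℝ → V}, (∀ t ∈ Icc (0 : ℝ) 1, HasDerivWithinAt f (f' t) (Icc 0 1) t) →
        ∀ t ∈ Ico (0 : ℝ) 1, HasDerivWithinAt f (f' t) (Ici t) t := fun hf t ht =>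
      (hf t (Ico_subset_Icc_self ht)).mono_of_mem_nhdsWithin (Icc_mem_nhdsGE_of_mem ht)
    -- The Lipschitz constant `1/2` is relaxed to `1`, whence the factor `exp 1 - 1`.
    have G := dist_le_of_approx_trajectories_ODE_of_mem (K := 1) (a := 0) (b := 1)
      (v := fun t v => A (x₀ + t • (y + h)) (y + h) v) (s := fun _ => univ)
      (f := u (y + h)) (g := w) (εf := 0) (εg := C * ‖h‖ ^ 2) (δ := 0)
      (fun t ht => by
        refine ((A (x₀ + t • (y + h)) (y + h)).lipschitz.weaken ?_).lipschitzOnWith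
        rw [← NNReal.coe_le_coe]
        have := hBd (y + h) hyh t (Ico_subset_Icc_self ht)
        simp only [coe_nnnorm, NNReal.coe_one]
        linarith)
      (fun t ht => (hu _ hyh t ht).continuousWithinAt)
      (right (hu _ hyh)) (fun t _ => by simp) (fun _ _ => mem_univ _)
      (fun t ht => (hwd t ht).continuousWithinAt) (right hwd)
      (fun t ht => by rw [dist_eq_norm]; exact hres t (Ico_subset_Icc_self ht))
      (fun _ _ => mem_univ _) (by simp [hw, hu0 _ hyh, hu0 _ hyr]) 1 (by simp)
    have hx1 : x₀ + y = x := by rw [hy]; abel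
    rw [NNReal.coe_one, gronwallBound_of_K_ne_0 one_ne_zero, dist_eq_norm] at G
    simp only [hw, one_smul, hx1] at G
    refine G.trans (le_of_eq ?_)
    norm_num
    ring
  have hO : (fun z => (fun x => u (x - x₀) 1) z - u y 1 - (A x).flip (u y 1) (z - x))
      =O[𝓝 x] fun z => ‖z - x‖ ^ 2 := by
    refine Asymptotics.IsBigO.of_bound (C * (Real.exp 1 - 1)) ?_
    filter_upwards [isOpen_ball.mem_nhds hx] with z hz
    have hz1 : z - x₀ = y + (z - x) := by rw [hy]; abel
    have := key (z - x) (by rw [← hz1]; exact mem_ball_zero_iff.2 (mem_ball_iff_norm.1 hz))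
    rw [← hz1] at this
    rw [Real.norm_of_nonneg (by positivity), ContinuousLinearMap.flip_apply, sub_sub]
    exact this
  rw [hasFDerivAt_iff_isLittleO]
  refine hO.trans_isLittleO ?_
  have : (fun z : E => ‖z - x‖ ^ 2) =o[𝓝 x] fun z => ‖z - x‖ ^ 1 := by
    refine (Asymptotics.isLittleO_pow_pow one_lt_two).comp_tendsto ?_
    have : Tendsto (fun z => ‖z - x‖) (𝓝 x) (𝓝 ‖x - x‖) :=
      ((continuous_id.sub continuous_const).norm).tendsto x
    simpa using this
  exact this.trans_isBigO (by simpa using (Asymptotics.isBigO_refl (fun z => z - x) (𝓝 x)).norm_left)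

end Frobenius

end Sasaki
end

noncomputable section
namespace Sasaki
open Filter Topology Set Metric

/-! ### Partial derivatives of functions and of matrix-valued functions -/

section Calculus

variable {f g : E3 → ℝ} {x : E3}

theorem pd_congr (i : Fin 3) (h : f =ᶠ[𝓝 x] g) : pd i f x = pd i g x := by
  rw [pd, pd, h.fderiv_eq]

theorem pd_const (i : Fin 3) (c : ℝ) (x : E3) : pd i (fun _ => c) x = 0 := by simp [pd]

theorem pd_add (i : Fin 3) (hf : DifferentiableAt ℝ f x) (hg : DifferentiableAt ℝ g x) :
    pd i (fun y => f y + g y) x = pd i f x + pd i g x := by simp [pd, fderiv_fun_add hf hg]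

theorem pd_sub (i : Fin 3) (hf : DifferentiableAt ℝ f x) (hg : DifferentiableAt ℝ g x) :
    pd i (fun y => f y - g y) x = pd i f x - pd i g x := by simp [pd, fderiv_fun_sub hf hg]

theorem pd_neg (i : Fin 3) : pd i (fun y => -f y) x = -pd i f x := by simp [pd, fderiv_fun_neg]

theorem pd_mul (i : Fin 3) (hf : DifferentiableAt ℝ f x) (hg : DifferentiableAt ℝ g x) :
    pd i (fun y => f y * g y) x = pd i f x * g x + f x * pd i g x := by
  simp [pd, fderiv_fun_mul hf hg]; ring

theorem pd_const_mul (i : Fin 3) (c : ℝ) (hf : DifferentiableAt ℝ f x) :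
    pd i (fun y => c * f y) x = c * pd i f x := by
  simp [pd, fderiv_const_mul hf c]

theorem pd_sum {ι : Type*} (s : Finset ι) (i : Fin 3) {F : ι → E3 → ℝ}
    (hF : ∀ a ∈ s, DifferentiableAt ℝ (F a) x) :
    pd i (fun y => ∑ a ∈ s, F a y) x = ∑ a ∈ s, pd i (F a) x := by
  simp [pd, fderiv_fun_sum hF]

theorem pd_comp (i : Fin 3) {φ : ℝ → ℝ} {c : ℝ} (hφ : HasDerivAt φ c (f x))
    (hf : DifferentiableAt ℝ f x) : pd i (fun y => φ (f y)) x = c * pd i f x := by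
  have := (hφ.comp_hasFDerivAt x hf.hasFDerivAt).fderiv
  rw [pd, show (fun y => φ (f y)) = φ ∘ f from rfl, this]
  simp [pd]

theorem _root_.ContDiffAt.pd (i : Fin 3) (hf : ContDiffAt ℝ ∞ f x) :
    ContDiffAt ℝ ∞ (pd i f) x :=
  (hf.fderiv_right (m := ∞) (by simp)).clm_apply contDiffAt_const

theorem _root_.ContDiffAt.diff (hf : ContDiffAt ℝ ∞ f x) : DifferentiableAt ℝ f x :=
  hf.differentiableAt (by simp)

theorem pd_comm (i j : Fin 3) (hf : ContDiffAt ℝ ∞ f x) : pd i (pd j f) x = pd j (pd i f) x := by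
  have h := hf.isSymmSndFDerivAt (by simpa using ENat.LEInfty.out)
  have hd : DifferentiableAt ℝ (fderiv ℝ f) x :=
    (hf.fderiv_right (m := ∞) (by simp)).differentiableAt (by simp)
  have e : ∀ i j : Fin 3, pd i (pd j f) x = fderiv ℝ (fderiv ℝ f) x (basisVec i) (basisVec j) := by
    intro i j
    change fderiv ℝ (fun y => fderiv ℝ f y (basisVec j)) x (basisVec i) = _
    rw [fderiv_clm_apply hd (differentiableAt_const _)]
    simp
  rw [e, e, h]

theorem eq_sum_basisVec (v : E3) : v = ∑ i, v i • basisVec i := by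
  ext j
  simp [basisVec, Fin.sum_univ_three]
  fin_cases j <;> simp

theorem fderiv_eq_sum_pd (f : E3 → ℝ) (x v : E3) : fderiv ℝ f x v = ∑ i, v i * pd i f x := by
  conv_lhs => rw [eq_sum_basisVec v]
  simp [map_sum, pd]

/-- The derivative of a function with values in a normed space, along a coordinate vector. -/
theorem pd_apply_eq {f : E3 → ℝ} {f' : E3 →L[ℝ] ℝ} (h : HasFDerivAt f f' x) (i : Fin 3) :
    pd i f x = f' (basisVec i) := by rw [pd, h.fderiv]

@[simp] theorem basisVec_apply (i j : Fin 3) : basisVec i j = if j = i then 1 else 0 := by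
  simp [basisVec]

/-- The partial derivative of a matrix-valued function. -/
def mpd {m n : ℕ} (i : Fin 3) (A : E3 → Matrix (Fin m) (Fin n) ℝ) (x : E3) :
    Matrix (Fin m) (Fin n) ℝ := Matrix.of fun a b => pd i (fun y => A y a b) x

/-- Smoothness of a matrix-valued function at a point. -/
def SmoothM {m n : ℕ} (A : E3 → Matrix (Fin m) (Fin n) ℝ) (x : E3) : Prop :=
  ∀ a b, ContDiffAt ℝ ∞ (fun y => A y a b) x

section MatrixCalculus

variable {l m n : ℕ} {A : E3 → Matrix (Fin l) (Fin m) ℝ} {B : E3 → Matrix (Fin m) (Fin n) ℝ}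
  {A' : E3 → Matrix (Fin l) (Fin m) ℝ}

theorem SmoothM.mul (hA : SmoothM A x) (hB : SmoothM B x) : SmoothM (fun y => A y * B y) x := by
  intro a b
  simp only [Matrix.mul_apply]
  exact ContDiffAt.sum fun c _ => (hA a c).mul (hB c b)

theorem SmoothM.add (hA : SmoothM A x) (hB : SmoothM A' x) : SmoothM (fun y => A y + A' y) x :=
  fun a b => (hA a b).add (hB a b)

theorem SmoothM.transpose (hA : SmoothM A x) : SmoothM (fun y => (A y)ᵀ) x := fun a b => hA b a

theorem SmoothM.mpd (i : Fin 3) (hA : SmoothM A x) : SmoothM (mpd i A) x := fun a b => (hA a b).pd i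

theorem mpd_congr (i : Fin 3) (h : A =ᶠ[𝓝 x] A') : mpd i A x = mpd i A' x := by
  ext a b
  exact pd_congr i (h.mono fun y hy => by simp [hy])

theorem mpd_const (i : Fin 3) (C : Matrix (Fin l) (Fin m) ℝ) (x : E3) :
    mpd i (fun _ => C) x = 0 := by
  ext a b
  exact pd_const i _ x

theorem mpd_mul (i : Fin 3) (hA : SmoothM A x) (hB : SmoothM B x) :
    mpd i (fun y => A y * B y) x = mpd i A x * B x + A x * mpd i B x := by
  ext a b
  simp only [mpd, Matrix.of_apply, Matrix.mul_apply, Matrix.add_apply]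
  rw [pd_sum _ _ fun c _ => ((hA a c).diff.fun_mul (hB c b).diff), ← Finset.sum_add_distrib]
  exact Finset.sum_congr rfl fun c _ => pd_mul i (hA a c).diff (hB c b).diff

theorem mpd_sub (i : Fin 3) (hA : SmoothM A x) (hB : SmoothM A' x) :
    mpd i (fun y => A y - A' y) x = mpd i A x - mpd i A' x := by
  ext a b
  exact pd_sub i (hA a b).diff (hB a b).diff

theorem mpd_transpose (i : Fin 3) (A : E3 → Matrix (Fin l) (Fin m) ℝ) (x : E3) :
    mpd i (fun y => (A y)ᵀ) x = (mpd i A x)ᵀ := rfl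

theorem mpd_comm (i j : Fin 3) (hA : SmoothM A x) : mpd i (mpd j A) x = mpd j (mpd i A) x := by
  ext a b
  exact pd_comm i j (hA a b)

end MatrixCalculus

end Calculus

/-! ### Poincaré's lemma and Frobenius' theorem in coordinates -/

section Integration

variable {x₀ : E3} {r : ℝ}

/-- A combination of constant vectors with smooth coefficients. -/
theorem contDiffAt_sum_smul {ι E F : Type*} [Fintype ι] [NormedAddCommGroup E] [NormedSpace ℝ E]
    [NormedAddCommGroup F] [NormedSpace ℝ F] {c : ι → E → ℝ} (T : ι → F) {x : E}
    (hc : ∀ k, ContDiffAt ℝ ∞ (c k) x) :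
    ContDiffAt ℝ ∞ (fun y => ∑ k, c k y • T k) x ∧
      ∀ h, fderiv ℝ (fun y => ∑ k, c k y • T k) x h = ∑ k, fderiv ℝ (c k) x h • T k := by
  refine ⟨ContDiffAt.sum fun k _ => (hc k).smul contDiffAt_const, fun h => ?_⟩
  have : HasFDerivAt (fun y => ∑ k, c k y • T k) (∑ k, (fderiv ℝ (c k) x).smulRight (T k)) x :=
    HasFDerivAt.fun_sum fun k _ =>
      ((hc k).differentiableAt (by simp)).hasFDerivAt.smul_const _
  rw [this.fderiv]
  simp

/-- **Poincaré's lemma** for smooth 1-forms on a ball, in components. -/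
theorem exists_potential {α : Fin 3 → E3 → ℝ}
    (hα : ∀ i, ∀ x ∈ ball x₀ r, ContDiffAt ℝ ∞ (α i) x)
    (hcl : ∀ i j, ∀ x ∈ ball x₀ r, pd i (α j) x = pd j (α i) x) :
    ∃ f : E3 → ℝ, ∀ x ∈ ball x₀ r, ContDiffAt ℝ ∞ f x ∧ ∀ i, pd i f x = α i x := by
  set β : E3 → E3 →L[ℝ] ℝ := fun x => ∑ i, α i x • EuclideanSpace.proj i with hβ
  have hβs : ∀ x ∈ ball x₀ r, ContDiffAt ℝ ∞ β x := fun x hx =>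
    (contDiffAt_sum_smul _ fun i => hα i x hx).1
  have hder : ∀ x ∈ ball x₀ r, ∀ h k : E3, fderiv ℝ β x h k = ∑ i, fderiv ℝ (α i) x h * k i := by
    intro x hx h k
    have := (contDiffAt_sum_smul (fun i => (EuclideanSpace.proj i : E3 →L[ℝ] ℝ))
      fun i => hα i x hx).2 h
    rw [show fderiv ℝ β x h = _ from this]
    simp [Fin.sum_univ_three]
  obtain ⟨f, hf⟩ := (convex_ball x₀ r).exists_forall_hasFDerivAt_of_fderiv_symmetric isOpen_ball
    (fun x hx => ((hβs x hx).differentiableAt (by simp)).differentiableWithinAt)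
    (fun x hx h k => by
      simp only [hder x hx, fderiv_eq_sum_pd, Finset.sum_mul]
      rw [Finset.sum_comm]
      refine Finset.sum_congr rfl fun i _ => Finset.sum_congr rfl fun j _ => ?_
      rw [hcl i j x hx]
      ring)
  refine ⟨f, fun x hx => ⟨?_, fun i => ?_⟩⟩
  · have : ContDiffOn ℝ ∞ f (ball x₀ r) := by
      rw [contDiffOn_infty_iff_fderiv_of_isOpen isOpen_ball]
      refine ⟨fun y hy => (hf y hy).differentiableAt.differentiableWithinAt, ?_⟩
      have h : ContDiffOn ℝ ∞ β (ball x₀ r) := fun y hy => (hβs y hy).contDiffWithinAt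
      exact h.congr fun y hy => (hf y hy).fderiv
    exact this.contDiffAt (isOpen_ball.mem_nhds hx)
  · rw [pd_apply_eq (hf x hx)]
    simp [hβ]

/-- Smoothness of the solutions of a total differential equation with smooth coefficients. -/
theorem contDiffOn_of_hasFDerivAt_linear {E V : Type*} [NormedAddCommGroup E] [NormedSpace ℝ E]
    [NormedAddCommGroup V] [NormedSpace ℝ V] {A : E → E →L[ℝ] V →L[ℝ] V} {F : E → V} {U : Set E}
    (hU : IsOpen U) (hA : ContDiffOn ℝ ∞ A U)
    (hF : ∀ x ∈ U, HasFDerivAt F ((A x).flip (F x)) x) : ContDiffOn ℝ ∞ F U := by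
  rw [contDiffOn_infty]
  intro n
  -- Bootstrapping: the derivative `(A x).flip (F x)` is as smooth as `F` itself, so each step gains
  -- one derivative.
  induction n with
  | zero =>
    rw [Nat.cast_zero, contDiffOn_zero]
    exact fun x hx => (hF x hx).continuousAt.continuousWithinAt
  | succ n ih =>
    rw [Nat.cast_add, Nat.cast_one, contDiffOn_succ_iff_fderiv_of_isOpen hU]
    refine ⟨fun y hy => (hF y hy).differentiableAt.differentiableWithinAt, by simp, ?_⟩
    have hev : ContDiffOn ℝ n (fun x => ContinuousLinearMap.apply ℝ V (F x)) U :=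
      contDiffOn_const.clm_apply ih
    exact (hev.clm_comp (hA.of_le ENat.LEInfty.out)).congr fun y hy => by
      rw [(hF y hy).fderiv]
      ext
      simp

/-- **Frobenius' theorem** for linear total differential equations `∂ᵢ v = Aᵢ v`. -/
theorem exists_parallel_section {n : ℕ} {A : Fin 3 → E3 → Matrix (Fin n) (Fin n) ℝ} (hr : 0 < r)
    (hA : ∀ i, ∀ x ∈ ball x₀ r, SmoothM (A i) x)
    (hflat : ∀ i j, ∀ x ∈ ball x₀ r,
      mpd i (A j) x + A j x * A i x = mpd j (A i) x + A i x * A j x) (v₀ : Fin n → ℝ) :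
    ∃ v : E3 → Fin n → ℝ, v x₀ = v₀ ∧ ∃ r' > 0, r' ≤ r ∧ ∀ x ∈ ball x₀ r',
      (∀ a, ContDiffAt ℝ ∞ (fun y => v y a) x) ∧
      ∀ i a, pd i (fun y => v y a) x = (A i x *ᵥ v x) a := by
  -- `T (i, a, b)` is `h ↦ hᵢ E_ab` with `E_ab` an elementary matrix, so `S x h` is the operator `∑
  -- hᵢ Aᵢ(x)`.
  let T : Fin 3 × Fin n × Fin n → E3 →L[ℝ] (Fin n → ℝ) →L[ℝ] (Fin n → ℝ) := fun k =>
    (EuclideanSpace.proj k.1 : E3 →L[ℝ] ℝ).smulRight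
      ((ContinuousLinearMap.proj k.2.2 : (Fin n → ℝ) →L[ℝ] ℝ).smulRight (Pi.single k.2.1 (1 : ℝ)))
  set S : E3 → E3 →L[ℝ] (Fin n → ℝ) →L[ℝ] (Fin n → ℝ) :=
    fun x => ∑ k, A k.1 x k.2.1 k.2.2 • T k with hS
  have hT : ∀ k (h : E3) (w : Fin n → ℝ), T k h w = h k.1 • w k.2.2 • Pi.single k.2.1 (1 : ℝ) :=
    fun k h w => by simp [T]
  have hmat : ∀ (C : Fin 3 → Matrix (Fin n) (Fin n) ℝ) (h : E3) (w : Fin n → ℝ),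
      (∑ k, C k.1 k.2.1 k.2.2 • T k) h w = ∑ i, h i • (C i *ᵥ w) := by
    intro C h w
    ext c
    simp only [sum_apply, smul_apply, hT, Finset.sum_apply, Fintype.sum_prod_type,
      Pi.smul_apply, Pi.single_apply, smul_eq_mul, Matrix.mulVec, dotProduct, Finset.mul_sum]
    refine Finset.sum_congr rfl fun i _ => ?_
    rw [Finset.sum_eq_single c]
    · simp only [if_true, mul_one]
      exact Finset.sum_congr rfl fun b _ => by ring
    · intro a _ hac
      simp [hac.symm]
    · simp
  have hSs : ∀ x ∈ ball x₀ r, ContDiffAt ℝ ∞ S x := fun x hx =>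
    (contDiffAt_sum_smul T fun k => hA k.1 x hx k.2.1 k.2.2).1
  have hder : ∀ x ∈ ball x₀ r, ∀ (h k : E3) (w : Fin n → ℝ),
      fderiv ℝ S x h k w = ∑ i, ∑ j, h i • k j • (mpd i (A j) x *ᵥ w) := by
    intro x hx h k w
    have e : fderiv ℝ S x h = ∑ q, (∑ i, h i • mpd i (A q.1) x) q.2.1 q.2.2 • T q := by
      rw [hS, (contDiffAt_sum_smul T fun k => hA k.1 x hx k.2.1 k.2.2).2]
      simp only [fderiv_eq_sum_pd, Matrix.sum_apply, Matrix.smul_apply, mpd, Matrix.of_apply,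
        smul_eq_mul]
    rw [e, hmat (fun j => ∑ i, h i • mpd i (A j) x), Finset.sum_comm]
    refine Finset.sum_congr rfl fun j _ => ?_
    rw [Matrix.sum_mulVec, Finset.smul_sum]
    refine Finset.sum_congr rfl fun i _ => ?_
    rw [Matrix.smul_mulVec, smul_comm]
  have hSapp : ∀ x (h : E3) (w : Fin n → ℝ), S x h w = ∑ i, h i • (A i x *ᵥ w) := fun x h w =>
    hmat (fun i => A i x) h w
  obtain ⟨F, hF0, hF⟩ := exists_parallel_of_flat (A := S) (x₀ := x₀) (V := Fin n → ℝ)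
    ((hSs x₀ (mem_ball_self hr)).of_le ENat.LEInfty.out)
    (by
      filter_upwards [isOpen_ball.mem_nhds (mem_ball_self hr)] with x hx h k
      ext1 w
      simp only [add_apply, ContinuousLinearMap.comp_apply, hder x hx, hSapp, Matrix.mulVec_sum,
        Matrix.mulVec_smul, Matrix.mulVec_mulVec, Finset.smul_sum]
      have e1 : ∀ h k : E3, ∑ i, ∑ j, h i • k j • (mpd i (A j) x *ᵥ w)
          + ∑ j, ∑ i, k j • h i • ((A j x * A i x) *ᵥ w)
          = ∑ i, ∑ j, (h i * k j) • ((mpd i (A j) x + A j x * A i x) *ᵥ w) := by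
        intro h k
        rw [Finset.sum_comm (γ := Fin 3) (f := fun j i => k j • h i • ((A j x * A i x) *ᵥ w)),
          ← Finset.sum_add_distrib]
        refine Finset.sum_congr rfl fun i _ => ?_
        rw [← Finset.sum_add_distrib]
        refine Finset.sum_congr rfl fun j _ => ?_
        rw [Matrix.add_mulVec, smul_add, smul_smul, smul_smul, mul_comm (k j)]
      rw [e1 h k, e1 k h, Finset.sum_comm]
      refine Finset.sum_congr rfl fun i _ => Finset.sum_congr rfl fun j _ => ?_
      rw [hflat j i x hx, mul_comm]) v₀
  obtain ⟨ε, hε, hball⟩ := Metric.eventually_nhds_iff_ball.1 hF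
  refine ⟨F, hF0, min r ε, lt_min hr hε, min_le_left _ _, fun x hx => ?_⟩
  have hsm : ContDiffOn ℝ ∞ F (ball x₀ (min r ε)) :=
    contDiffOn_of_hasFDerivAt_linear isOpen_ball
      (fun y hy => (hSs y (ball_subset_ball (min_le_left _ _) hy)).contDiffWithinAt)
      (fun y hy => hball y (ball_subset_ball (min_le_right _ _) hy))
  refine ⟨fun a => ?_, fun i a => ?_⟩
  · exact contDiffAt_pi.1 (hsm.contDiffAt (isOpen_ball.mem_nhds hx)) a
  · have h1 := hasFDerivAt_pi'.1 (hball x (ball_subset_ball (min_le_right _ _) hx)) a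
    rw [pd_apply_eq h1]
    simp [hSapp]

end Integration

end Sasaki
end

noncomputable section
namespace Sasaki
open Filter Topology Set Metric

/-! ### The Levi-Civita connection in matrix form -/

section LeviCivita

variable {G : E3 → Matrix (Fin 3) (Fin 3) ℝ} {U : Set E3} {x : E3}

/-- The connection matrices `(Γᵢ)ᵏⱼ` of the Levi-Civita connection. -/
def connMatrix (G : E3 → Matrix (Fin 3) (Fin 3) ℝ) (i : Fin 3) (x : E3) :
    Matrix (Fin 3) (Fin 3) ℝ := Matrix.of fun k j => christoffel G k i j x

/-- The curvature matrices `(R_ij)ˡₖ`. -/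
def curvMatrix (G : E3 → Matrix (Fin 3) (Fin 3) ℝ) (i j : Fin 3) (x : E3) :
    Matrix (Fin 3) (Fin 3) ℝ := Matrix.of fun l k => riem G l i j k x

/-- Cramer's rule: the entries of the adjugate and the determinant are polynomials in the entries of
the matrix. -/
theorem SmoothM.inv {A : E3 → Matrix (Fin 3) (Fin 3) ℝ} (hA : SmoothM A x)
    (hdet : (A x).det ≠ 0) : SmoothM (fun y => (A y)⁻¹) x := by
  have hd : ContDiffAt ℝ ∞ (fun y => (A y).det) x := by
    have h := hA
    simp only [Matrix.det_fin_three]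
    unfold SmoothM at h
    fun_prop
  have hadj : ∀ a b, ContDiffAt ℝ ∞ (fun y => (A y).adjugate a b) x := by
    intro a b
    have h := hA
    unfold SmoothM at h
    simp only [Matrix.adjugate_fin_three]
    fin_cases a <;> fin_cases b <;> simp <;> fun_prop
  intro a b
  have : (fun y => (A y)⁻¹ a b) = fun y => ((A y).det)⁻¹ * (A y).adjugate a b := by
    ext y
    rw [Matrix.inv_def, Matrix.smul_apply, Ring.inverse_eq_inv', smul_eq_mul]
  rw [this]
  exact (hd.inv hdet).mul (hadj a b)

namespace IsRiemannianOn

variable (hG : IsRiemannianOn U G)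
include hG

theorem smoothM (hU : IsOpen U) (hx : x ∈ U) : SmoothM G x := fun i j =>
  (hG.smooth i j).contDiffAt (hU.mem_nhds hx)

theorem transpose_eq (hx : x ∈ U) : (G x)ᵀ = G x := by
  have := (hG.posDef x hx).isHermitian
  rwa [Matrix.IsHermitian, Matrix.conjTranspose_eq_transpose_of_trivial] at this

theorem symm_apply (hx : x ∈ U) (i j : Fin 3) : G x i j = G x j i := by
  conv_lhs => rw [← hG.transpose_eq hx]
  rfl

theorem det_ne_zero (hx : x ∈ U) : (G x).det ≠ 0 := (hG.posDef x hx).det_pos.ne'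

theorem pd_symm (hU : IsOpen U) (hx : x ∈ U) (m i j : Fin 3) :
    pd m (fun y => G y i j) x = pd m (fun y => G y j i) x :=
  pd_congr m (by filter_upwards [hU.mem_nhds hx] with y hy using hG.symm_apply hy i j)

theorem christoffel_symm (hU : IsOpen U) (hx : x ∈ U) (k i j : Fin 3) :
    christoffel G k i j x = christoffel G k j i x := by
  unfold christoffel
  congr 1
  refine Finset.sum_congr rfl fun l _ => ?_
  rw [hG.pd_symm hU hx l i j]
  ring

/-- Lowering the upper index cancels the inverse metric and leaves the Christoffel symbols of the
first kind, in which metricity and the Killing equation are linear identities. -/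
theorem lower_christoffel (hx : x ∈ U) (i m j : Fin 3) :
    (G x * connMatrix G m x) i j = (1 / 2) * (pd m (fun y => G y j i) x
      + pd j (fun y => G y m i) x - pd i (fun y => G y m j) x) := by
  set c : Fin 3 → ℝ := fun l => (1 / 2) * (pd m (fun y => G y j l) x
      + pd j (fun y => G y m l) x - pd l (fun y => G y m j) x) with hc
  have h1 : ∀ k, connMatrix G m x k j = ((G x)⁻¹ *ᵥ c) k := by
    intro k
    simp only [connMatrix, Matrix.of_apply, christoffel, Matrix.mulVec, dotProduct, hc,
      Finset.mul_sum]
    exact Finset.sum_congr rfl fun l _ => by ring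
  have h2 : (G x * connMatrix G m x) i j = (G x *ᵥ ((G x)⁻¹ *ᵥ c)) i := by
    simp only [Matrix.mul_apply, h1]
    rfl
  rw [h2, Matrix.mulVec_mulVec, Matrix.mul_nonsing_inv _ (hG.det_ne_zero hx).isUnit,
    Matrix.one_mulVec]

/-- The Levi-Civita connection is metric. -/
theorem mpd_metric (hU : IsOpen U) (hx : x ∈ U) (m : Fin 3) :
    mpd m G x = (connMatrix G m x)ᵀ * G x + G x * connMatrix G m x := by
  have ht : (connMatrix G m x)ᵀ * G x = (G x * connMatrix G m x)ᵀ := by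
    rw [Matrix.transpose_mul, hG.transpose_eq hx]
  ext i j
  rw [ht, Matrix.add_apply, Matrix.transpose_apply, hG.lower_christoffel hx,
    hG.lower_christoffel hx, hG.pd_symm hU hx m j i, hG.pd_symm hU hx i m j,
    hG.pd_symm hU hx j m i, hG.pd_symm hU hx i j m, hG.pd_symm hU hx j i m]
  simp only [mpd, Matrix.of_apply]
  ring

theorem smoothM_connMatrix (hU : IsOpen U) (hx : x ∈ U) (i : Fin 3) :
    SmoothM (connMatrix G i) x := by
  intro k j
  have h1 := (hG.smoothM hU hx).inv (hG.det_ne_zero hx)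
  have h2 := hG.smoothM hU hx
  refine contDiffAt_const.mul (ContDiffAt.sum fun l _ => (h1 k l).mul ?_)
  exact (((h2 j l).pd i).add ((h2 i l).pd j)).sub ((h2 i j).pd l)

end IsRiemannianOn

theorem curvMatrix_eq (G : E3 → Matrix (Fin 3) (Fin 3) ℝ) (i j : Fin 3) (x : E3) :
    curvMatrix G i j x = mpd i (connMatrix G j) x - mpd j (connMatrix G i) x
      + (connMatrix G i x * connMatrix G j x - connMatrix G j x * connMatrix G i x) := by
  ext l k
  simp only [curvMatrix, riem, Matrix.of_apply, Matrix.add_apply, Matrix.sub_apply, mpd,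
    connMatrix, Matrix.mul_apply, Finset.sum_sub_distrib]

end LeviCivita

/-! ### Cartan's structure equations of an orthonormal frame -/

section Frame

variable {G E : E3 → Matrix (Fin 3) (Fin 3) ℝ} {U : Set E3} {x : E3}

/-- The columns of `E` are a smooth orthonormal frame of `G` on `U`. -/
structure IsFrameOn (U : Set E3) (G E : E3 → Matrix (Fin 3) (Fin 3) ℝ) : Prop where
  isOpen : IsOpen U
  metric : IsRiemannianOn U G
  smooth : ∀ x ∈ U, SmoothM E x
  orth : ∀ x ∈ U, (E x)ᵀ * G x * E x = 1

/-- The dual coframe. -/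
def coframe (G E : E3 → Matrix (Fin 3) (Fin 3) ℝ) (x : E3) : Matrix (Fin 3) (Fin 3) ℝ :=
  (E x)ᵀ * G x

/-- The connection forms of an orthonormal frame. -/
def connForm (G E : E3 → Matrix (Fin 3) (Fin 3) ℝ) (i : Fin 3) (x : E3) :
    Matrix (Fin 3) (Fin 3) ℝ := coframe G E x * (mpd i E x + connMatrix G i x * E x)

/-- The curvature forms of an orthonormal frame. -/
def curvForm (G E : E3 → Matrix (Fin 3) (Fin 3) ℝ) (i j : Fin 3) (x : E3) :
    Matrix (Fin 3) (Fin 3) ℝ :=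
  mpd i (connForm G E j) x - mpd j (connForm G E i) x
    + (connForm G E i x * connForm G E j x - connForm G E j x * connForm G E i x)

namespace IsFrameOn

variable (hE : IsFrameOn U G E)
include hE

theorem coframe_mul (hx : x ∈ U) : coframe G E x * E x = 1 := hE.orth x hx

theorem mul_coframe (hx : x ∈ U) : E x * coframe G E x = 1 :=
  mul_eq_one_comm.1 (hE.coframe_mul hx)

theorem metric_eq (hx : x ∈ U) : (coframe G E x)ᵀ * coframe G E x = G x := by
  rw [coframe, Matrix.transpose_mul, Matrix.transpose_transpose, hE.metric.transpose_eq hx,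
    Matrix.mul_assoc]
  change G x * (E x * coframe G E x) = _
  rw [hE.mul_coframe hx, Matrix.mul_one]

theorem inv_metric (hx : x ∈ U) : (G x)⁻¹ = E x * (E x)ᵀ := by
  refine Matrix.inv_eq_left_inv ?_
  rw [Matrix.mul_assoc]
  exact hE.mul_coframe hx

theorem smoothM_coframe (hx : x ∈ U) : SmoothM (coframe G E) x :=
  (hE.smooth x hx).transpose.mul (hE.metric.smoothM hE.isOpen hx)

theorem smoothM_connForm (hx : x ∈ U) (i : Fin 3) : SmoothM (connForm G E i) x :=
  (hE.smoothM_coframe hx).mul (((hE.smooth x hx).mpd i).add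
    ((hE.metric.smoothM_connMatrix hE.isOpen hx i).mul (hE.smooth x hx)))

theorem mpd_frame (hx : x ∈ U) (i : Fin 3) :
    mpd i E x = E x * connForm G E i x - connMatrix G i x * E x := by
  rw [connForm, ← Matrix.mul_assoc, hE.mul_coframe hx, Matrix.one_mul]
  abel

/-- Differentiate `Eᵀ G E = 1` and replace the derivative of `G` by Christoffel terms: what remains
is `ωᵀ + ω = 0`. -/
theorem connForm_skew (hx : x ∈ U) (i : Fin 3) :
    (connForm G E i x)ᵀ = -connForm G E i x := by
  have hs := hE.smooth x hx
  have hGs := hE.metric.smoothM hE.isOpen hx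
  have h0 : mpd i (fun y => (E y)ᵀ * G y * E y) x = 0 := by
    rw [mpd_congr i (A' := fun _ => (1 : Matrix (Fin 3) (Fin 3) ℝ))
      (by filter_upwards [hE.isOpen.mem_nhds hx] with y hy using hE.orth y hy), mpd_const]
  rw [mpd_mul i (hs.transpose.mul hGs) hs, mpd_mul i hs.transpose hGs, mpd_transpose,
    hE.metric.mpd_metric hE.isOpen hx] at h0
  rw [eq_neg_iff_add_eq_zero, ← h0, connForm, coframe]
  simp only [Matrix.transpose_mul, Matrix.transpose_add, Matrix.transpose_transpose,
    hE.metric.transpose_eq hx, Matrix.mul_add, Matrix.add_mul, Matrix.mul_assoc]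
  abel

theorem connForm_skew_apply (hx : x ∈ U) (i a b : Fin 3) :
    connForm G E i x a b = -connForm G E i x b a := by
  have := congrFun (congrFun (hE.connForm_skew hx i) b) a
  simpa using this

/-- The first structure equation, in covariant form. -/
theorem mpd_coframe (hx : x ∈ U) (i : Fin 3) : mpd i (coframe G E) x
    = -(connForm G E i x * coframe G E x) + coframe G E x * connMatrix G i x := by
  have h0 : mpd i (fun y => coframe G E y * E y) x = 0 := by
    rw [mpd_congr i (A' := fun _ => (1 : Matrix (Fin 3) (Fin 3) ℝ))
      (by filter_upwards [hE.isOpen.mem_nhds hx] with y hy using hE.coframe_mul hy), mpd_const]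
  rw [mpd_mul i (hE.smoothM_coframe hx) (hE.smooth x hx), hE.mpd_frame hx] at h0
  have h1 := congrArg (fun A => A * coframe G E x) h0
  simp only [Matrix.add_mul, Matrix.mul_assoc, Matrix.mul_sub, Matrix.sub_mul,
    hE.mul_coframe hx, Matrix.mul_one, Matrix.zero_mul] at h1
  rw [← Matrix.mul_assoc (coframe G E x) (E x), hE.coframe_mul hx, Matrix.one_mul] at h1
  rw [eq_comm, ← sub_eq_zero, ← neg_eq_zero, ← h1]
  abel

/-- The first structure equation `dθ = -ω ∧ θ`. -/
theorem d_coframe (hx : x ∈ U) (i j a : Fin 3) :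
    pd i (fun y => coframe G E y a j) x - pd j (fun y => coframe G E y a i) x
      = -∑ c, (connForm G E i x a c * coframe G E x c j
        - connForm G E j x a c * coframe G E x c i) := by
  have h1 := congrFun (congrFun (hE.mpd_coframe hx i) a) j
  have h2 := congrFun (congrFun (hE.mpd_coframe hx j) a) i
  simp only [mpd, Matrix.of_apply, Matrix.add_apply, Matrix.neg_apply, Matrix.mul_apply] at h1 h2
  -- Torsion-freeness: the Christoffel terms of the covariant equation drop out after
  -- antisymmetrization.
  have h3 : ∀ c, connMatrix G i x c j = connMatrix G j x c i := fun c =>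
    hE.metric.christoffel_symm hE.isOpen hx c i j
  rw [h1, h2]
  simp only [h3, Finset.sum_sub_distrib]
  ring

/-- The second structure equation `dω + ω ∧ ω = Ω`. -/
theorem curvForm_eq (hx : x ∈ U) (i j : Fin 3) :
    curvForm G E i j x = coframe G E x * curvMatrix G i j x * E x := by
  have hs := hE.smooth x hx
  have key : ∀ i j, mpd i (mpd j E) x = E x * connForm G E i x * connForm G E j x
      - connMatrix G i x * E x * connForm G E j x + E x * mpd i (connForm G E j) x
      - mpd i (connMatrix G j) x * E x - connMatrix G j x * E x * connForm G E i x
      + connMatrix G j x * connMatrix G i x * E x := by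
    intro i j
    rw [mpd_congr i (A' := fun y => E y * connForm G E j y - connMatrix G j y * E y)
      (by filter_upwards [hE.isOpen.mem_nhds hx] with y hy using hE.mpd_frame hy j),
      mpd_sub i (hs.mul (hE.smoothM_connForm hx j))
        ((hE.metric.smoothM_connMatrix hE.isOpen hx j).mul hs),
      mpd_mul i hs (hE.smoothM_connForm hx j),
      mpd_mul i (hE.metric.smoothM_connMatrix hE.isOpen hx j) hs, hE.mpd_frame hx]
    simp only [Matrix.mul_sub, Matrix.sub_mul, Matrix.mul_assoc]
    abel
  -- Symmetry of the second derivatives of the frame is the integrability condition of `∂ᵢE = E ωᵢ -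
  -- Γᵢ E`, and it amounts to `E Ω = R E`.
  have h0 := mpd_comm i j hs
  rw [key i j, key j i, ← sub_eq_zero] at h0
  have h1 : E x * curvForm G E i j x = curvMatrix G i j x * E x := by
    rw [curvMatrix_eq, curvForm, ← sub_eq_zero, ← h0]
    simp only [Matrix.mul_sub, Matrix.mul_add, Matrix.add_mul, Matrix.sub_mul, Matrix.mul_assoc]
    abel
  rw [Matrix.mul_assoc, ← h1, ← Matrix.mul_assoc, hE.coframe_mul hx, Matrix.one_mul]

theorem curvMatrix_eq_frame (hx : x ∈ U) (i j : Fin 3) :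
    curvMatrix G i j x = E x * curvForm G E i j x * coframe G E x := by
  rw [hE.curvForm_eq hx]
  simp only [Matrix.mul_assoc, hE.mul_coframe hx, Matrix.mul_one]
  rw [← Matrix.mul_assoc, hE.mul_coframe hx, Matrix.one_mul]

theorem sum_coframe_mul_frame (hx : x ∈ U) (a b : Fin 3) :
    ∑ i, coframe G E x a i * E x i b = if a = b then 1 else 0 := by
  rw [← Matrix.mul_apply, hE.coframe_mul hx, Matrix.one_apply]

theorem sum_frame_mul_coframe (hx : x ∈ U) (i j : Fin 3) :
    ∑ a, E x i a * coframe G E x a j = if i = j then 1 else 0 := by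
  rw [← Matrix.mul_apply, hE.mul_coframe hx, Matrix.one_apply]

end IsFrameOn

end Frame

end Sasaki
end

noncomputable section
namespace Sasaki
open Filter Topology Set Metric

/-! ### Structure equations and Ricci tensor of a Sasakian 3-manifold -/

section SasakianFrame

variable {G E : E3 → Matrix (Fin 3) (Fin 3) ℝ} {U : Set E3} {x : E3} {ξ : E3 → Fin 3 → ℝ}

/-- `E` is an orthonormal frame of the Sasakian structure `(G, ξ)` whose last vector is `ξ`. -/
structure IsSasakianFrameOn (U : Set E3) (G E : E3 → Matrix (Fin 3) (Fin 3) ℝ)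
    (ξ : E3 → Fin 3 → ℝ) : Prop extends IsFrameOn U G E where
  sasakian : IsSasakianOn U G ξ
  last : ∀ x ∈ U, ∀ k, E x k 2 = ξ x k

/-- The function `s = ± 1` with `∇ξ = s J` on the contact distribution. -/
def orientationSign (G E : E3 → Matrix (Fin 3) (Fin 3) ℝ) (x : E3) : ℝ :=
  ∑ i, E x i 1 * connForm G E i x 0 2

namespace IsSasakianFrameOn

variable (hE : IsSasakianFrameOn U G E ξ)
include hE

/-- The entry `j 2` of `θᵀ ωᵢ` is `g(∇ᵢ ξ, ∂ⱼ)`, so this is the covariant form of the Killing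
equation. It follows from the coordinate form once `∂ₖ g` is written through Christoffel symbols. -/
theorem killing_skew (hx : x ∈ U) (i j : Fin 3) :
    ((coframe G E x)ᵀ * connForm G E i x) j 2 = -((coframe G E x)ᵀ * connForm G E j x) i 2 := by
  have hexp : ∀ i j, ((coframe G E x)ᵀ * connForm G E i x) j 2
      = ∑ k, G x j k * pd i (fun y => ξ y k) x + ∑ m, (G x * connMatrix G i x) j m * ξ x m := by
    intro i j
    have hcol : ∀ k, mpd i E x k 2 = pd i (fun y => ξ y k) x := fun k =>
      pd_congr i (by filter_upwards [hE.isOpen.mem_nhds hx] with y hy using hE.last y hy k)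
    rw [connForm, ← Matrix.mul_assoc, hE.metric_eq hx, Matrix.mul_add, ← Matrix.mul_assoc,
      Matrix.add_apply, Matrix.mul_apply, Matrix.mul_apply]
    simp only [hcol, hE.last x hx]
  have hK := hE.sasakian.killing x hx i j
  have hm : ∀ k, pd k (fun y => G y i j) x
      = (G x * connMatrix G i x) j k + (G x * connMatrix G j x) i k := by
    intro k
    rw [hE.metric.lower_christoffel hx, hE.metric.lower_christoffel hx,
      hE.metric.pd_symm hE.isOpen hx i k j, hE.metric.pd_symm hE.isOpen hx j k i,
      hE.metric.pd_symm hE.isOpen hx k j i]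
    ring
  rw [hexp, hexp, eq_neg_iff_add_eq_zero, ← hK]
  simp only [hm, hE.metric.symm_apply hx _ j, Fin.sum_univ_three]
  rw [hE.metric.symm_apply hx i 0, hE.metric.symm_apply hx i 1, hE.metric.symm_apply hx i 2,
    hE.metric.symm_apply hx j 0, hE.metric.symm_apply hx j 1, hE.metric.symm_apply hx j 2]
  ring

/-- The components of `∇ξ` in the frame. -/
theorem frame_killing_skew (hx : x ∈ U) (c a : Fin 3) :
    ∑ i, E x i c * connForm G E i x a 2 = -∑ i, E x i a * connForm G E i x c 2 := by
  have hexp : ∀ c a, ∑ i, E x i c * connForm G E i x a 2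
      = ∑ i, ∑ j, E x i c * E x j a * ((coframe G E x)ᵀ * connForm G E i x) j 2 := by
    intro c a
    refine Finset.sum_congr rfl fun i _ => ?_
    have h1 : connForm G E i x a 2
        = ((E x)ᵀ * ((coframe G E x)ᵀ * connForm G E i x)) a 2 := by
      rw [← Matrix.mul_assoc, ← Matrix.transpose_mul, hE.coframe_mul hx, Matrix.transpose_one,
        Matrix.one_mul]
    rw [h1, Matrix.mul_apply, Finset.mul_sum]
    exact Finset.sum_congr rfl fun j _ => by rw [Matrix.transpose_apply]; ring
  rw [hexp, hexp, Finset.sum_comm, ← Finset.sum_neg_distrib]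
  refine Finset.sum_congr rfl fun i _ => ?_
  rw [← Finset.sum_neg_distrib]
  refine Finset.sum_congr rfl fun j _ => ?_
  rw [hE.killing_skew hx j i]
  ring

/-- A 1-form is the sum of its values on the frame times the coframe, because `E θ = 1`. -/
theorem connForm_last (hx : x ∈ U) (i a : Fin 3) : connForm G E i x a 2
    = ∑ c, coframe G E x c i * ∑ k, E x k c * connForm G E k x a 2 := by
  have h1 : ∑ c, coframe G E x c i * ∑ k, E x k c * connForm G E k x a 2
      = ∑ k, (∑ c, E x k c * coframe G E x c i) * connForm G E k x a 2 := by
    simp only [Finset.mul_sum, Finset.sum_mul]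
    rw [Finset.sum_comm]
    exact Finset.sum_congr rfl fun k _ => Finset.sum_congr rfl fun c _ => by ring
  rw [h1]
  simp only [hE.sum_frame_mul_coframe hx]
  simp

theorem connForm_diag (hx : x ∈ U) (i a : Fin 3) : connForm G E i x a a = 0 := by
  have := hE.connForm_skew_apply hx i a a
  linarith

/-- The numbers `g(∇_{e_c} ξ, e_a)` are skew in `c`, `a` and vanish for `a = 2` since `ξ` has
constant length. Hence they vanish for `c = 2` too, and only the pair `(e₁, e₀)` contributes. The
same holds for `ω₁₂`, with the opposite sign. -/
theorem connForm_zero_two (hx : x ∈ U) (i : Fin 3) :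
    connForm G E i x 0 2 = orientationSign G E x * coframe G E x 1 i := by
  have h00 := hE.frame_killing_skew hx 0 0
  have h20 := hE.frame_killing_skew hx 2 0
  simp only [hE.connForm_diag hx, mul_zero, Finset.sum_const_zero, neg_zero] at h20
  have h0 : ∑ i, E x i 0 * connForm G E i x 0 2 = 0 := by linarith
  rw [hE.connForm_last hx, Fin.sum_univ_three, h0, h20, orientationSign]
  ring

theorem connForm_one_two (hx : x ∈ U) (i : Fin 3) :
    connForm G E i x 1 2 = -(orientationSign G E x * coframe G E x 0 i) := by
  have h11 := hE.frame_killing_skew hx 1 1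
  have h21 := hE.frame_killing_skew hx 2 1
  have h01 := hE.frame_killing_skew hx 0 1
  simp only [hE.connForm_diag hx, mul_zero, Finset.sum_const_zero, neg_zero] at h21
  have h1 : ∑ i, E x i 1 * connForm G E i x 1 2 = 0 := by linarith
  rw [hE.connForm_last hx, Fin.sum_univ_three, h1, h21, h01, orientationSign]
  ring

theorem coframe_last (hx : x ∈ U) (i : Fin 3) : coframe G E x 2 i = (G x *ᵥ ξ x) i := by
  rw [coframe, Matrix.mul_apply]
  simp only [Matrix.transpose_apply, hE.last x hx, Matrix.mulVec, dotProduct]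
  refine Finset.sum_congr rfl fun k _ => ?_
  rw [hE.metric.symm_apply hx i k, mul_comm]

/-- The Sasakian curvature condition in the frame. -/
theorem curvForm_last (hx : x ∈ U) (i a b : Fin 3) :
    ∑ j, curvForm G E i j x a b * E x j 2
      = coframe G E x a i * (if b = 2 then 1 else 0) - (if a = 2 then 1 else 0) * coframe G E x b i := by
  have hR : ∀ l k, ∑ j, curvMatrix G i j x l k * E x j 2
      = coframe G E x 2 k * (if l = i then 1 else 0) - G x i k * E x l 2 := by
    intro l k
    have h := congrFun (hE.sasakian.curv x hx (Pi.single i 1) (Pi.single k 1)) l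
    simp only [curvature, Pi.sub_apply, Pi.smul_apply, smul_eq_mul] at h
    rw [hE.last x hx l, hE.coframe_last hx]
    have e1 : ∑ i', ∑ j, ∑ k', riem G l i' j k' x * (Pi.single i 1 : Fin 3 → ℝ) i' * ξ x j
        * (Pi.single k 1 : Fin 3 → ℝ) k' = ∑ j, curvMatrix G i j x l k * E x j 2 := by
      rw [Finset.sum_eq_single i]
      · refine Finset.sum_congr rfl fun j _ => ?_
        rw [Finset.sum_eq_single k]
        · simp [curvMatrix, hE.last x hx]
        · intro b _ hb; simp [hb]
        · simp
      · intro b _ hb; simp [hb]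
      · simp
    rw [e1] at h
    rw [h]
    congr 1
    · congr 1
      · rw [Matrix.mulVec_single_one]
        simp only [dotProduct, Matrix.col_apply, Matrix.mulVec]
        exact Finset.sum_congr rfl fun m _ => by rw [hE.metric.symm_apply hx m k]; ring
      · simp [Pi.single_apply]
    · simp [Matrix.col_apply]
  have h1 : ∑ j, curvForm G E i j x a b * E x j 2
      = ∑ l, ∑ k, coframe G E x a l * (∑ j, curvMatrix G i j x l k * E x j 2) * E x k b := by
    simp only [hE.curvForm_eq hx, Matrix.mul_apply, Finset.mul_sum, Finset.sum_mul]
    simp only [Fin.sum_univ_three]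
    ring
  rw [h1]
  simp only [hR]
  have h2 : ∀ l k, coframe G E x a l * (coframe G E x 2 k * (if l = i then 1 else 0)
      - G x i k * E x l 2) * E x k b
      = (coframe G E x a l * (if l = i then 1 else 0)) * (coframe G E x 2 k * E x k b)
        - (coframe G E x a l * E x l 2) * (G x i k * E x k b) := fun l k => by ring
  have h3 : ∑ k, G x i k * E x k b = coframe G E x b i := by
    rw [coframe, Matrix.mul_apply]
    refine Finset.sum_congr rfl fun k _ => ?_
    rw [hE.metric.symm_apply hx i k, Matrix.transpose_apply, mul_comm]
  simp only [h2, Finset.sum_sub_distrib, ← Finset.mul_sum, ← Finset.sum_mul, h3,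
    hE.sum_coframe_mul_frame hx]
  rw [show (∑ l, coframe G E x a l * (if l = i then (1 : ℝ) else 0)) = coframe G E x a i by simp]
  congr 2
  simp only [eq_comm]

/-- With `ω₀₂ = s θ¹` and `ω₁₂ = -s θ⁰` the term in `θ²` merges with `ω₀₁` into `p = ω₀₁ - s θ²`,
the connection form of the transverse metric: `dθ⁰ = -p ∧ θ¹`. In the same way the next two lemmas
amount to `dθ¹ = p ∧ θ⁰` and `dη = -2s θ⁰ ∧ θ¹`. -/
theorem d_coframe_zero (hx : x ∈ U) (i j : Fin 3) :
    pd i (fun y => coframe G E y 0 j) x - pd j (fun y => coframe G E y 0 i) x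
      = -((connForm G E i x 0 1 - orientationSign G E x * coframe G E x 2 i) * coframe G E x 1 j
        - (connForm G E j x 0 1 - orientationSign G E x * coframe G E x 2 j)
          * coframe G E x 1 i) := by
  rw [hE.d_coframe hx, Fin.sum_univ_three]
  simp only [hE.connForm_diag hx, hE.connForm_zero_two hx]
  ring

theorem d_coframe_one (hx : x ∈ U) (i j : Fin 3) :
    pd i (fun y => coframe G E y 1 j) x - pd j (fun y => coframe G E y 1 i) x
      = (connForm G E i x 0 1 - orientationSign G E x * coframe G E x 2 i) * coframe G E x 0 j
        - (connForm G E j x 0 1 - orientationSign G E x * coframe G E x 2 j)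
          * coframe G E x 0 i := by
  rw [hE.d_coframe hx, Fin.sum_univ_three]
  simp only [hE.connForm_diag hx, hE.connForm_one_two hx, hE.connForm_skew_apply hx _ 1 0]
  ring

theorem d_coframe_two (hx : x ∈ U) (i j : Fin 3) :
    pd i (fun y => coframe G E y 2 j) x - pd j (fun y => coframe G E y 2 i) x
      = -2 * orientationSign G E x * (coframe G E x 0 i * coframe G E x 1 j
        - coframe G E x 0 j * coframe G E x 1 i) := by
  rw [hE.d_coframe hx, Fin.sum_univ_three]
  simp only [hE.connForm_diag hx, hE.connForm_skew_apply hx _ 2 0,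
    hE.connForm_skew_apply hx _ 2 1, hE.connForm_one_two hx, hE.connForm_zero_two hx]
  ring

theorem smooth_orientationSign (hx : x ∈ U) : ContDiffAt ℝ ∞ (orientationSign G E) x :=
  ContDiffAt.sum fun i _ => (hE.smooth x hx i 1).mul (hE.smoothM_connForm hx i 0 2)

/-- From `Ω₀₂ = d(s θ¹) + ω₀₁ ∧ ω₁₂`: the terms in `ω₀₁` cancel. The terms in `ds` are kept, because
`s` becomes constant only as a consequence of this formula. -/
theorem curvForm_zero_two_expand (hx : x ∈ U) (i j : Fin 3) : curvForm G E i j x 0 2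
    = pd i (orientationSign G E) x * coframe G E x 1 j
      - pd j (orientationSign G E) x * coframe G E x 1 i
      + orientationSign G E x ^ 2 * (coframe G E x 0 i * coframe G E x 2 j
        - coframe G E x 0 j * coframe G E x 2 i) := by
  have hd : ∀ i j, mpd i (connForm G E j) x 0 2 = pd i (orientationSign G E) x * coframe G E x 1 j
      + orientationSign G E x * pd i (fun y => coframe G E y 1 j) x := by
    intro i j
    rw [← pd_mul i (hE.smooth_orientationSign hx).diff (hE.smoothM_coframe hx 1 j).diff]
    exact pd_congr i (by
      filter_upwards [hE.isOpen.mem_nhds hx] with y hy using hE.connForm_zero_two hy j)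
  have h1 := hE.d_coframe_one hx i j
  simp only [curvForm, Matrix.add_apply, Matrix.sub_apply, Matrix.mul_apply, Fin.sum_univ_three,
    hd, hE.connForm_diag hx, hE.connForm_one_two hx]
  linear_combination orientationSign G E x * h1

theorem curvForm_one_two_expand (hx : x ∈ U) (i j : Fin 3) : curvForm G E i j x 1 2
    = -(pd i (orientationSign G E) x * coframe G E x 0 j
      - pd j (orientationSign G E) x * coframe G E x 0 i)
      + orientationSign G E x ^ 2 * (coframe G E x 1 i * coframe G E x 2 j
        - coframe G E x 1 j * coframe G E x 2 i) := by
  have hd : ∀ i j, mpd i (connForm G E j) x 1 2 = -(pd i (orientationSign G E) x * coframe G E x 0 j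
      + orientationSign G E x * pd i (fun y => coframe G E y 0 j) x) := by
    intro i j
    rw [← pd_mul i (hE.smooth_orientationSign hx).diff (hE.smoothM_coframe hx 0 j).diff, ← pd_neg]
    exact pd_congr i (by
      filter_upwards [hE.isOpen.mem_nhds hx] with y hy using hE.connForm_one_two hy j)
  have h1 := hE.d_coframe_zero hx i j
  simp only [curvForm, Matrix.add_apply, Matrix.sub_apply, Matrix.mul_apply, Fin.sum_univ_three,
    hd, hE.connForm_diag hx, hE.connForm_zero_two hx, hE.connForm_skew_apply hx _ 1 0]
  linear_combination -orientationSign G E x * h1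

/-- Contract `Ω₀₂` with `ξ` in two ways: the Sasakian condition gives `θ⁰`, the expansion gives `s²
θ⁰ - ds(ξ) θ¹`. Evaluation on `e₀` isolates `s² = 1`. -/
theorem orientationSign_sq (hx : x ∈ U) : orientationSign G E x ^ 2 = 1 := by
  have h1 : ∀ i, ∑ j, curvForm G E i j x 0 2 * E x j 2 = coframe G E x 0 i := fun i => by
    rw [hE.curvForm_last hx]; simp
  have h2 : ∀ i, -(∑ j, pd j (orientationSign G E) x * E x j 2) * coframe G E x 1 i
      + orientationSign G E x ^ 2 * coframe G E x 0 i = coframe G E x 0 i := by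
    intro i
    have h02 := hE.sum_coframe_mul_frame hx 0 2
    have h12 := hE.sum_coframe_mul_frame hx 1 2
    have h22 := hE.sum_coframe_mul_frame hx 2 2
    have h1i := h1 i
    simp only [hE.curvForm_zero_two_expand hx, Fin.sum_univ_three] at h02 h12 h22 h1i ⊢
    simp only [Fin.isValue, Fin.reduceEq, if_false, if_true] at h02 h12 h22
    linear_combination h1i - pd i (orientationSign G E) x * h12
      + orientationSign G E x ^ 2 * coframe G E x 2 i * h02
      - orientationSign G E x ^ 2 * coframe G E x 0 i * h22
  have h00 := hE.sum_coframe_mul_frame hx 0 0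
  have h10 := hE.sum_coframe_mul_frame hx 1 0
  simp only [Fin.sum_univ_three] at h00 h10
  simp only [Fin.isValue, Fin.reduceEq, if_false, if_true] at h00 h10
  have a0 := h2 0
  have a1 := h2 1
  have a2 := h2 2
  set D := ∑ j, pd j (orientationSign G E) x * E x j 2
  linear_combination E x 0 0 * a0 + E x 1 0 * a1 + E x 2 0 * a2 + D * h10
    + (1 - orientationSign G E x ^ 2) * h00

/-- Differentiating `s² = 1` gives `s ds = 0`, and `s` is invertible. -/
theorem pd_orientationSign (hx : x ∈ U) (i : Fin 3) : pd i (orientationSign G E) x = 0 := by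
  have hs := (hE.smooth_orientationSign hx).diff
  have h : pd i (fun y => orientationSign G E y * orientationSign G E y) x = 0 := by
    rw [← pd_const i 1 x]
    exact pd_congr i (by
      filter_upwards [hE.isOpen.mem_nhds hx] with y hy
      rw [← pow_two]
      exact hE.orientationSign_sq hy)
  rw [pd_mul i hs hs] at h
  have h2 := hE.orientationSign_sq hx
  linear_combination (1 / 2) * orientationSign G E x * h - pd i (orientationSign G E) x * h2

/-- The sectional curvature of the contact plane. -/
theorem exists_curvForm_zero_one (hx : x ∈ U) : ∃ κ : ℝ, ∀ i j, curvForm G E i j x 0 1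
    = κ * (coframe G E x 0 i * coframe G E x 1 j - coframe G E x 0 j * coframe G E x 1 i) := by
  have hlast : ∀ i, ∑ j, curvForm G E i j x 0 1 * E x j 2 = 0 := fun i => by
    rw [hE.curvForm_last hx]; simp
  set O : Matrix (Fin 3) (Fin 3) ℝ := Matrix.of fun i j => curvForm G E i j x 0 1 with hO
  have hOs : ∀ i j, O i j = -O j i := fun i j => by
    simp only [hO, Matrix.of_apply, curvForm, Matrix.add_apply, Matrix.sub_apply]; ring
  -- The components of `Ω₀₁` in the frame. A skew 3 × 3 matrix that annihilates the last vector has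
  -- one free entry.
  set N : Matrix (Fin 3) (Fin 3) ℝ := (E x)ᵀ * O * E x with hN
  have hNs : ∀ a b, N a b = -N b a := by
    intro a b
    have : Oᵀ = -O := by
      ext i j
      rw [Matrix.transpose_apply, hOs]
      rfl
    have hT : Nᵀ = -N := by
      rw [hN, Matrix.transpose_mul, Matrix.transpose_mul, Matrix.transpose_transpose, this]
      simp [Matrix.mul_assoc]
    have := congrFun (congrFun hT b) a
    simpa using this
  have hN2 : ∀ a, N a 2 = 0 := by
    intro a
    rw [hN, Matrix.mul_assoc, Matrix.mul_apply]
    refine Finset.sum_eq_zero fun i _ => ?_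
    rw [Matrix.mul_apply]
    have := hlast i
    simp only [hO, Matrix.of_apply]
    rw [this, mul_zero]
  have hback : O = (coframe G E x)ᵀ * N * coframe G E x := by
    rw [hN]
    simp only [Matrix.mul_assoc, hE.mul_coframe hx, Matrix.mul_one]
    rw [← Matrix.mul_assoc, ← Matrix.transpose_mul, hE.mul_coframe hx, Matrix.transpose_one,
      Matrix.one_mul]
  refine ⟨N 0 1, fun i j => ?_⟩
  have h := congrFun (congrFun hback i) j
  simp only [hO, Matrix.of_apply, Matrix.mul_apply, Fin.sum_univ_three,
    Matrix.transpose_apply, hN2] at h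
  rw [h, hNs 2 0, hNs 2 1, hN2, hN2, hNs 1 0]
  have h00 := hNs 0 0
  have h11 := hNs 1 1
  rw [show N 0 0 = 0 by linarith, show N 1 1 = 0 by linarith]
  ring

/-- The Ricci tensor and the curvature of the contact plane in terms of the Tanaka-Webster
curvature. -/
theorem ricci_and_curvForm (hx : x ∈ U) :
    (∀ i j, curvForm G E i j x 0 1 = (2 * tanakaWebster G x - 3) *
      (coframe G E x 0 i * coframe G E x 1 j - coframe G E x 0 j * coframe G E x 1 i)) ∧
    ∀ j k, ricci G x j k = (2 * tanakaWebster G x - 2) * G x j k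
      + (4 - 2 * tanakaWebster G x) * (coframe G E x 2 j * coframe G E x 2 k) := by
  obtain ⟨κ, hκ⟩ := hE.exists_curvForm_zero_one hx
  have hs := hE.orientationSign_sq hx
  have hds := hE.pd_orientationSign hx
  have h02 := hE.curvForm_zero_two_expand hx
  have h12 := hE.curvForm_one_two_expand hx
  -- Now `Ω₀₂ = θ⁰ ∧ θ²` and `Ω₁₂ = θ¹ ∧ θ²`: planes containing `ξ` have curvature 1.
  simp only [hs, hds, zero_mul, sub_zero, neg_zero, zero_add, one_mul] at h02 h12
  have hskew : ∀ i j a b, curvForm G E i j x a b = -curvForm G E i j x b a := by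
    intro i j a b
    have hd : ∀ i j, mpd i (connForm G E j) x a b = -mpd i (connForm G E j) x b a := by
      intro i j
      simp only [mpd, Matrix.of_apply]
      rw [← pd_neg]
      exact pd_congr i (by
        filter_upwards [hE.isOpen.mem_nhds hx] with y hy using hE.connForm_skew_apply hy j a b)
    simp only [curvForm, Matrix.add_apply, Matrix.sub_apply, Matrix.mul_apply, Fin.sum_univ_three,
      hd i j, hd j i, hE.connForm_skew_apply hx _ a, hE.connForm_skew_apply hx _ _ b]
    ring
  have hdiag : ∀ i j a, curvForm G E i j x a a = 0 := fun i j a => by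
    have := hskew i j a a
    linarith
  have hG : ∀ j k, G x j k = coframe G E x 0 j * coframe G E x 0 k
      + coframe G E x 1 j * coframe G E x 1 k + coframe G E x 2 j * coframe G E x 2 k := by
    intro j k
    conv_lhs => rw [← hE.metric_eq hx]
    simp [Matrix.mul_apply, Fin.sum_univ_three]
  -- The Ricci tensor with its second argument in the frame: the contact plane gets one curvature
  -- `κ` and one curvature 1, the direction `ξ` two curvatures 1.
  have hcontr : ∀ j b, ∑ i, ∑ a, E x i a * curvForm G E i j x a b
      = if b = 2 then 2 * coframe G E x 2 j else (κ + 1) * coframe G E x b j := by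
    intro j b
    have d := hE.sum_coframe_mul_frame hx
    have d00 := d 0 0
    have d01 := d 0 1
    have d02 := d 0 2
    have d10 := d 1 0
    have d11 := d 1 1
    have d12 := d 1 2
    have d20 := d 2 0
    have d21 := d 2 1
    have d22 := d 2 2
    simp only [Fin.sum_univ_three] at d00 d01 d02 d10 d11 d12 d20 d21 d22 ⊢
    simp only [Fin.isValue, Fin.reduceEq, if_false, if_true] at d00 d01 d02 d10 d11 d12 d20 d21 d22
    fin_cases b
    · simp only [Fin.zero_eta, hdiag, hskew _ _ 1 0, hskew _ _ 2 0, hκ, h02, mul_zero, zero_add,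
        Fin.isValue, Fin.reduceEq, if_false]
      linear_combination -κ * coframe G E x 1 j * d01 + κ * coframe G E x 0 j * d11
        - coframe G E x 2 j * d02 + coframe G E x 0 j * d22
    · simp only [Fin.mk_one, hdiag, hskew _ _ 2 1, hκ, h12, mul_zero, add_zero,
        Fin.isValue, Fin.reduceEq, if_false]
      linear_combination κ * coframe G E x 1 j * d00 - κ * coframe G E x 0 j * d10
        - coframe G E x 2 j * d12 + coframe G E x 1 j * d22
    · simp only [Fin.reduceFinMk, hdiag, h02, h12, mul_zero, add_zero,
        Fin.isValue, if_true]
      linear_combination coframe G E x 2 j * d00 - coframe G E x 0 j * d20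
        + coframe G E x 2 j * d11 - coframe G E x 1 j * d21
  have hric : ∀ j k, ricci G x j k = (κ + 1) * G x j k
      + (1 - κ) * (coframe G E x 2 j * coframe G E x 2 k) := by
    intro j k
    have h1 : ricci G x j k
        = ∑ b, (∑ i, ∑ a, E x i a * curvForm G E i j x a b) * coframe G E x b k := by
      have : ∀ i, riem G i i j k x = (E x * curvForm G E i j x * coframe G E x) i k := fun i => by
        rw [← hE.curvMatrix_eq_frame hx]; rfl
      simp only [ricci, Matrix.of_apply, this, Matrix.mul_apply, Fin.sum_univ_three]
      ring
    rw [h1]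
    simp only [hcontr]
    rw [Fin.sum_univ_three, hG]
    simp only [Fin.isValue, Fin.reduceEq, if_false, if_true]
    ring
  have hscal : scalarCurvature G x = 2 * κ + 4 := by
    have htr : ∀ a b, ∑ j, ∑ k, (G x)⁻¹ j k * (coframe G E x a j * coframe G E x b k)
        = if a = b then 1 else 0 := by
      intro a b
      have h1 : ∑ j, ∑ k, (G x)⁻¹ j k * (coframe G E x a j * coframe G E x b k)
          = ((coframe G E x * E x) * (coframe G E x * E x)ᵀ) a b := by
        rw [hE.inv_metric hx]
        simp only [Matrix.mul_apply, Matrix.transpose_apply, Fin.sum_univ_three]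
        ring
      rw [h1, hE.coframe_mul hx, Matrix.transpose_one, Matrix.mul_one, Matrix.one_apply]
    have h0 := htr 0 0
    have h1 := htr 1 1
    have h2 := htr 2 2
    simp only [if_true] at h0 h1 h2
    have : scalarCurvature G x
        = (κ + 1) * (∑ j, ∑ k, (G x)⁻¹ j k * (coframe G E x 0 j * coframe G E x 0 k))
        + (κ + 1) * (∑ j, ∑ k, (G x)⁻¹ j k * (coframe G E x 1 j * coframe G E x 1 k))
        + 2 * (∑ j, ∑ k, (G x)⁻¹ j k * (coframe G E x 2 j * coframe G E x 2 k)) := by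
      simp only [scalarCurvature, hric, hG, Finset.mul_sum, ← Finset.sum_add_distrib]
      exact Finset.sum_congr rfl fun j _ => Finset.sum_congr rfl fun k _ => by ring
    rw [this, h0, h1, h2]
    ring
  -- The trace is `R = 2(κ + 1) + 2`, hence `W = (κ + 3) / 2`.
  have hW : κ = 2 * tanakaWebster G x - 3 := by
    rw [tanakaWebster, hscal]
    ring
  refine ⟨fun i j => by rw [hκ, hW], fun j k => ?_⟩
  rw [hric, hW]
  ring

/-- The connection form of the contact plane. -/
theorem d_connForm (hx : x ∈ U) (i j : Fin 3) :
    pd i (fun y => connForm G E j y 0 1 - orientationSign G E y * coframe G E y 2 j) x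
      - pd j (fun y => connForm G E i y 0 1 - orientationSign G E y * coframe G E y 2 i) x
      = 2 * tanakaWebster G x * (coframe G E x 0 i * coframe G E x 1 j
        - coframe G E x 0 j * coframe G E x 1 i) := by
  have hs := hE.smooth_orientationSign hx
  have hd : ∀ i j, pd i (fun y => connForm G E j y 0 1 - orientationSign G E y * coframe G E y 2 j) x
      = mpd i (connForm G E j) x 0 1
        - orientationSign G E x * pd i (fun y => coframe G E y 2 j) x := by
    intro i j
    rw [pd_sub i (hE.smoothM_connForm hx j 0 1).diff
      (hs.mul (hE.smoothM_coframe hx 2 j)).diff, pd_mul i hs.diff (hE.smoothM_coframe hx 2 j).diff,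
      hE.pd_orientationSign hx]
    simp [mpd]
  have h1 := (hE.ricci_and_curvForm hx).1 i j
  simp only [curvForm, Matrix.add_apply, Matrix.sub_apply, Matrix.mul_apply, Fin.sum_univ_three,
    hE.connForm_diag hx, hE.connForm_zero_two hx, hE.connForm_skew_apply hx _ 2 1,
    hE.connForm_one_two hx] at h1
  have h2 := hE.d_coframe_two hx i j
  have h3 := hE.orientationSign_sq hx
  rw [hd, hd]
  -- Here `dω₀₁` contributes `κ + s²` and `-s dη` contributes `2 s²`; since `s² = 1` and `κ = 2W -
  -- 3`, the sum is `2W`.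
  linear_combination h1 - orientationSign G E x * h2
    + 3 * (coframe G E x 0 i * coframe G E x 1 j - coframe G E x 0 j * coframe G E x 1 i) * h3

end IsSasakianFrameOn

end SasakianFrame

end Sasaki
end

noncomputable section
namespace Sasaki
open Filter Topology Set Metric

/-! ### Local orthonormal frames containing the Killing field -/

section GramSchmidt

variable {G : E3 → Matrix (Fin 3) (Fin 3) ℝ} {U : Set E3} {x₀ : E3} {ξ : E3 → Fin 3 → ℝ}

theorem dotProduct_mulVec_symm {A : Matrix (Fin 3) (Fin 3) ℝ} (hA : Aᵀ = A) (u v : Fin 3 → ℝ) :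
    u ⬝ᵥ A *ᵥ v = v ⬝ᵥ A *ᵥ u := by
  rw [dotProduct_comm, ← Matrix.vecMul_transpose, hA, Matrix.dotProduct_mulVec]

theorem contDiffAt_metric_apply {y : E3} (hG : SmoothM G y) {u v : E3 → Fin 3 → ℝ}
    (hu : ∀ k, ContDiffAt ℝ ∞ (fun z => u z k) y) (hv : ∀ k, ContDiffAt ℝ ∞ (fun z => v z k) y) :
    ContDiffAt ℝ ∞ (fun z => u z ⬝ᵥ G z *ᵥ v z) y := by
  simp only [dotProduct, Matrix.mulVec]
  exact ContDiffAt.sum fun i _ => (hu i).mul (ContDiffAt.sum fun j _ => (hG i j).mul (hv j))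

/-- One step of the Gram-Schmidt process for vector fields. -/
theorem exists_orthonormal_extension (hU : IsOpen U) (hG : IsRiemannianOn U G) (hx₀ : x₀ ∈ U)
    {m : ℕ} (hm : m < 3) (X : Fin m → E3 → Fin 3 → ℝ)
    (hX : ∀ᶠ y in 𝓝 x₀, ∀ a k, ContDiffAt ℝ ∞ (fun z => X a z k) y)
    (horth : ∀ᶠ y in 𝓝 x₀, ∀ a b, X a y ⬝ᵥ G y *ᵥ X b y = if a = b then 1 else 0) :
    ∃ Y : E3 → Fin 3 → ℝ, ∀ᶠ y in 𝓝 x₀, (∀ k, ContDiffAt ℝ ∞ (fun z => Y z k) y) ∧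
      Y y ⬝ᵥ G y *ᵥ Y y = 1 ∧ ∀ a, X a y ⬝ᵥ G y *ᵥ Y y = 0 := by
  -- Fewer than three vectors do not span `ℝ³`. A vector outside their span at `x₀` has a nonzero
  -- orthogonal part there, hence also nearby, and that part is then normalized.
  obtain ⟨v, hv⟩ : ∃ v : Fin 3 → ℝ, v ∉ Submodule.span ℝ (range fun a => X a x₀) := by
    by_contra! h
    have htop : Submodule.span ℝ (range fun a => X a x₀) = ⊤ := Submodule.eq_top_iff'.2 h
    have h1 : (range fun a => X a x₀).finrank ℝ ≤ Fintype.card (Fin m) := finrank_range_le_card _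
    rw [Set.finrank, htop, finrank_top] at h1
    simp at h1
    omega
  set Z : E3 → Fin 3 → ℝ := fun y => v - ∑ a, (X a y ⬝ᵥ G y *ᵥ v) • X a y with hZ
  set n : E3 → ℝ := fun y => Z y ⬝ᵥ G y *ᵥ Z y with hn
  have hUe : ∀ᶠ y in 𝓝 x₀, y ∈ U := hU.mem_nhds hx₀
  have hZs : ∀ᶠ y in 𝓝 x₀, ∀ k, ContDiffAt ℝ ∞ (fun z => Z z k) y := by
    filter_upwards [hX, hUe] with y hy hyU k
    simp only [hZ, Pi.sub_apply, Finset.sum_apply, Pi.smul_apply, smul_eq_mul]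
    have h1 : ∀ a, ContDiffAt ℝ ∞ (fun z => X a z ⬝ᵥ G z *ᵥ v) y := fun a =>
      contDiffAt_metric_apply (u := X a) (v := fun _ => v) (hG.smoothM hU hyU) (hy a)
        fun k => contDiffAt_const
    exact contDiffAt_const.sub (ContDiffAt.sum fun a _ => (h1 a).mul (hy a k))
  have hns : ∀ᶠ y in 𝓝 x₀, ContDiffAt ℝ ∞ n y := by
    filter_upwards [hZs, hUe] with y hy hyU
    exact contDiffAt_metric_apply (u := Z) (v := Z) (hG.smoothM hU hyU) hy hy
  have hn0 : 0 < n x₀ := by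
    have hne : Z x₀ ≠ 0 := by
      intro h0
      refine hv ?_
      rw [sub_eq_zero.1 h0]
      exact Submodule.sum_mem _ fun a _ =>
        Submodule.smul_mem _ _ (Submodule.subset_span (mem_range_self a))
    simpa using (hG.posDef x₀ hx₀).dotProduct_mulVec_pos hne
  have hnpos : ∀ᶠ y in 𝓝 x₀, 0 < n y := hns.self_of_nhds.continuousAt.eventually (lt_mem_nhds hn0)
  refine ⟨fun y => (√(n y))⁻¹ • Z y, ?_⟩
  filter_upwards [hZs, hns, hnpos, horth, hUe] with y hy hny hpos ho hyU
  refine ⟨fun k => ?_, ?_, fun a => ?_⟩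
  · simp only [Pi.smul_apply, smul_eq_mul]
    exact ((hny.sqrt hpos.ne').inv (Real.sqrt_pos.2 hpos).ne').mul (hy k)
  · rw [Matrix.mulVec_smul, smul_dotProduct, dotProduct_smul, smul_eq_mul, smul_eq_mul]
    change (√(n y))⁻¹ * ((√(n y))⁻¹ * n y) = 1
    have h1 := Real.mul_self_sqrt hpos.le
    have h2 := (Real.sqrt_pos.2 hpos).ne'
    field_simp
    nlinarith
  · rw [Matrix.mulVec_smul, dotProduct_smul]
    have : X a y ⬝ᵥ G y *ᵥ Z y = 0 := by
      simp only [hZ]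
      rw [Matrix.mulVec_sub, dotProduct_sub, Matrix.mulVec_sum, dotProduct_sum]
      simp only [Matrix.mulVec_smul, dotProduct_smul, ho, smul_eq_mul]
      simp
    rw [this, smul_zero]

/-- Every point has a neighbourhood with an orthonormal frame extending the Killing field. -/
theorem exists_sasakianFrame (hU : IsOpen U) (hG : IsRiemannianOn U G)
    (hξ : ∀ k, ∀ x ∈ U, ContDiffAt ℝ ∞ (fun z => ξ z k) x) (hS : IsSasakianOn U G ξ)
    (hx₀ : x₀ ∈ U) :
    ∃ r > 0, ball x₀ r ⊆ U ∧ ∃ E, IsSasakianFrameOn (ball x₀ r) G E ξ := by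
  have hUe : ∀ᶠ y in 𝓝 x₀, y ∈ U := hU.mem_nhds hx₀
  obtain ⟨Y, hY⟩ := exists_orthonormal_extension hU hG hx₀ (m := 1) (by norm_num) (fun _ => ξ)
    (by filter_upwards [hUe] with y hy a k using hξ k y hy)
    (by
      filter_upwards [hUe] with y hy a b
      rw [hS.unit y hy, if_pos (Subsingleton.elim _ _)])
  obtain ⟨Y', hY'⟩ := exists_orthonormal_extension hU hG hx₀ (m := 2) (by norm_num) ![ξ, Y]
    (by
      filter_upwards [hUe, hY] with y hy hy' a k
      fin_cases a
      · exact hξ k y hy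
      · exact hy'.1 k)
    (by
      filter_upwards [hUe, hY] with y hy hy' a b
      have h1 := hS.unit y hy
      have h2 := hy'.2.2 0
      have h3 := dotProduct_mulVec_symm (hG.transpose_eq hy) (Y y) (ξ y)
      fin_cases a <;> fin_cases b <;> simp [h1, hy'.2.1, h2, h3])
  obtain ⟨r, hr, hball⟩ := Metric.eventually_nhds_iff_ball.1 (hUe.and (hY.and hY'))
  refine ⟨r, hr, fun y hy => (hball y hy).1, fun y => Matrix.of fun k a => ![Y' y, Y y, ξ y] a k,
    ⟨⟨isOpen_ball, ⟨fun i j => (hG.smooth i j).mono fun y hy => (hball y hy).1,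
      fun y hy => hG.posDef y (hball y hy).1⟩, fun y hy k a => ?_, fun y hy => ?_⟩,
      ⟨fun y hy => hS.unit y (hball y hy).1, fun y hy => hS.killing y (hball y hy).1,
        fun y hy => hS.curv y (hball y hy).1⟩, fun y _ k => rfl⟩⟩
  · obtain ⟨hyU, h1, h2⟩ := hball y hy
    fin_cases a
    · exact h2.1 k
    · exact h1.1 k
    · exact hξ k y hyU
  · obtain ⟨hyU, h1, h2⟩ := hball y hy
    have hsym := dotProduct_mulVec_symm (hG.transpose_eq hyU)
    have e1 := hS.unit y hyU
    have e2 := h1.2.1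
    have e3 := h1.2.2 0
    have e4 := h2.2.1
    have e5 : ξ y ⬝ᵥ G y *ᵥ Y' y = 0 := h2.2.2 0
    have e6 : Y y ⬝ᵥ G y *ᵥ Y' y = 0 := h2.2.2 1
    have e7 := hsym (Y y) (ξ y)
    have e8 := hsym (Y' y) (ξ y)
    have e9 := hsym (Y' y) (Y y)
    rw [e3] at e7
    rw [e5] at e8
    rw [e6] at e9
    have hent : ∀ a b, ((Matrix.of fun k a => ![Y' y, Y y, ξ y] a k)ᵀ * G y
        * (Matrix.of fun k a => ![Y' y, Y y, ξ y] a k)) a b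
        = ![Y' y, Y y, ξ y] a ⬝ᵥ G y *ᵥ ![Y' y, Y y, ξ y] b := by
      intro a b
      rw [Matrix.mul_assoc, Matrix.mul_apply]
      rfl
    ext a b
    rw [hent]
    fin_cases a <;> fin_cases b <;> simp [e1, e2, e3, e4, e5, e6, e7, e8, e9]

end GramSchmidt

/-! ### The structure equations for constant curvature -/

section AdaptedCoframe

variable {G : E3 → Matrix (Fin 3) (Fin 3) ℝ} {U : Set E3} {x₀ : E3} {ξ : E3 → Fin 3 → ℝ}

/-- The Ricci tensor of a Sasakian structure on a 3-manifold. -/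
theorem ricci_eq_of_isSasakianOn (hU : IsOpen U) (hG : IsRiemannianOn U G)
    (hξ : ∀ k, ∀ x ∈ U, ContDiffAt ℝ ∞ (fun z => ξ z k) x) (hS : IsSasakianOn U G ξ)
    {x : E3} (hx : x ∈ U) : ricci G x = (2 * tanakaWebster G x - 2) • G x
      + (4 - 2 * tanakaWebster G x) • Matrix.vecMulVec (G x *ᵥ ξ x) (G x *ᵥ ξ x) := by
  obtain ⟨r, hr, -, E, hE⟩ := exists_sasakianFrame hU hG hξ hS hx
  have hx' : x ∈ ball x r := mem_ball_self hr
  ext j k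
  rw [(hE.ricci_and_curvForm hx').2 j k, hE.coframe_last hx', hE.coframe_last hx']
  simp [Matrix.vecMulVec_apply]

/-- The structure equations of an adapted coframe `(a, b, c)` of a Sasakian structure, where `c` is
the contact form and `p` the connection form of the contact plane. -/
structure IsAdaptedCoframe (B : Set E3) (G : E3 → Matrix (Fin 3) (Fin 3) ℝ) (ξ : E3 → Fin 3 → ℝ)
    (W s : ℝ) (a b c p : Fin 3 → E3 → ℝ) : Prop where
  smooth_a : ∀ i, ∀ x ∈ B, ContDiffAt ℝ ∞ (a i) x
  smooth_b : ∀ i, ∀ x ∈ B, ContDiffAt ℝ ∞ (b i) x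
  smooth_c : ∀ i, ∀ x ∈ B, ContDiffAt ℝ ∞ (c i) x
  smooth_p : ∀ i, ∀ x ∈ B, ContDiffAt ℝ ∞ (p i) x
  sign : s * s = 1
  det_ne_zero : ∀ x ∈ B, (G x).det ≠ 0
  metric : ∀ x ∈ B, ∀ i j, G x i j = a i x * a j x + b i x * b j x + c i x * c j x
  contact : ∀ x ∈ B, ∀ i, c i x = (G x *ᵥ ξ x) i
  d_a : ∀ x ∈ B, ∀ i j, pd i (a j) x - pd j (a i) x = -(p i x * b j x - p j x * b i x)
  d_b : ∀ x ∈ B, ∀ i j, pd i (b j) x - pd j (b i) x = p i x * a j x - p j x * a i x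
  d_c : ∀ x ∈ B, ∀ i j, pd i (c j) x - pd j (c i) x = -2 * s * (a i x * b j x - a j x * b i x)
  d_p : ∀ x ∈ B, ∀ i j, pd i (p j) x - pd j (p i) x = 2 * W * (a i x * b j x - a j x * b i x)

theorem IsAdaptedCoframe.mono {B B' : Set E3} {W s : ℝ} {a b c p : Fin 3 → E3 → ℝ}
    (h : IsAdaptedCoframe B G ξ W s a b c p) (hB : B' ⊆ B) :
    IsAdaptedCoframe B' G ξ W s a b c p :=
  ⟨fun i x hx => h.smooth_a i x (hB hx), fun i x hx => h.smooth_b i x (hB hx),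
    fun i x hx => h.smooth_c i x (hB hx), fun i x hx => h.smooth_p i x (hB hx), h.sign,
    fun x hx => h.det_ne_zero x (hB hx), fun x hx => h.metric x (hB hx),
    fun x hx => h.contact x (hB hx), fun x hx => h.d_a x (hB hx), fun x hx => h.d_b x (hB hx),
    fun x hx => h.d_c x (hB hx), fun x hx => h.d_p x (hB hx)⟩

theorem eq_of_pd_eq_zero {f : E3 → ℝ} {r : ℝ} (hf : ∀ x ∈ ball x₀ r, DifferentiableAt ℝ f x)
    (h : ∀ x ∈ ball x₀ r, ∀ i, pd i f x = 0) {x : E3} (hx : x ∈ ball x₀ r) : f x = f x₀ := by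
  have hr : 0 < r := pos_of_mem_ball hx
  refine isOpen_ball.is_const_of_fderiv_eq_zero (convex_ball x₀ r).isPreconnected
    (fun y hy => (hf y hy).differentiableWithinAt) (fun y hy => ?_) hx (mem_ball_self hr)
  ext v
  simp [fderiv_eq_sum_pd, h y hy]

/-- The coframe of a Sasakian frame with `p = ω₀₁ - s η`. On a ball `s` is constant, so for constant
`W` all structure equations have constant coefficients; the later integration uses nothing else
about the structure. -/
theorem exists_adaptedCoframe (hU : IsOpen U) (hG : IsRiemannianOn U G)
    (hξ : ∀ k, ∀ x ∈ U, ContDiffAt ℝ ∞ (fun z => ξ z k) x) (hS : IsSasakianOn U G ξ)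
    (hx₀ : x₀ ∈ U) {W : ℝ} (hW : ∀ x ∈ U, tanakaWebster G x = W) :
    ∃ r > 0, ball x₀ r ⊆ U ∧ ∃ s a b c p, IsAdaptedCoframe (ball x₀ r) G ξ W s a b c p := by
  obtain ⟨r, hr, hrU, E, hE⟩ := exists_sasakianFrame hU hG hξ hS hx₀
  have hs : ∀ x ∈ ball x₀ r, orientationSign G E x = orientationSign G E x₀ := fun x hx =>
    eq_of_pd_eq_zero (fun y hy => (hE.smooth_orientationSign hy).diff)
      (fun y hy => hE.pd_orientationSign hy) hx
  refine ⟨r, hr, hrU, orientationSign G E x₀, fun i x => coframe G E x 0 i,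
    fun i x => coframe G E x 1 i, fun i x => coframe G E x 2 i,
    fun i x => connForm G E i x 0 1 - orientationSign G E x * coframe G E x 2 i,
    fun i x hx => hE.smoothM_coframe hx 0 i, fun i x hx => hE.smoothM_coframe hx 1 i,
    fun i x hx => hE.smoothM_coframe hx 2 i, fun i x hx => (hE.smoothM_connForm hx i 0 1).sub
      ((hE.smooth_orientationSign hx).mul (hE.smoothM_coframe hx 2 i)), ?_,
    fun x hx => hE.metric.det_ne_zero hx, fun x hx i j => ?_, fun x hx i => hE.coframe_last hx i,
    fun x hx => hE.d_coframe_zero hx, fun x hx => hE.d_coframe_one hx, fun x hx i j => ?_,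
    fun x hx i j => ?_⟩
  · rw [← pow_two]
    exact hE.orientationSign_sq (mem_ball_self hr)
  · conv_lhs => rw [← hE.metric_eq hx]
    simp [Matrix.mul_apply, Fin.sum_univ_three]
  · rw [← hs x hx]
    exact hE.d_coframe_two hx i j
  · rw [← hW x (hrU hx)]
    exact hE.d_connForm hx i j

end AdaptedCoframe

end Sasaki
end

noncomputable section
namespace Sasaki
open Filter Topology Set Metric

/-! ### Integration of the structure equations to normal forms -/

section Coordinates

variable {G : E3 → Matrix (Fin 3) (Fin 3) ℝ} {x₀ : E3} {ξ : E3 → Fin 3 → ℝ} {W s r : ℝ}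
  {a b c p : Fin 3 → E3 → ℝ}

/-- The Jacobian matrix of three functions. -/
def jacobian (y : Fin 3 → E3 → ℝ) (x : E3) : Matrix (Fin 3) (Fin 3) ℝ :=
  Matrix.of fun k i => pd i (y k) x

/-- The functions `y` take values in `U` and pull the metric `Gm` and the form `αm` back to `G` and
to the form dual to `ξ`. -/
structure IsPullbackOn (B : Set E3) (G : E3 → Matrix (Fin 3) (Fin 3) ℝ) (ξ : E3 → Fin 3 → ℝ)
    (U : Set E3) (Gm : E3 → Matrix (Fin 3) (Fin 3) ℝ) (αm : E3 → Fin 3 → ℝ)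
    (y : Fin 3 → E3 → ℝ) : Prop where
  smooth : ∀ k, ∀ x ∈ B, ContDiffAt ℝ ∞ (y k) x
  mapsTo : ∀ x ∈ B, WithLp.toLp 2 (fun k => y k x) ∈ U
  metric : ∀ x ∈ B,
    G x = (jacobian y x)ᵀ * Gm (WithLp.toLp 2 (fun k => y k x)) * jacobian y x
  contact : ∀ x ∈ B, G x *ᵥ ξ x = (jacobian y x)ᵀ *ᵥ αm (WithLp.toLp 2 (fun k => y k x))

theorem transpose_mul_sq_mul (J : Matrix (Fin 3) (Fin 3) ℝ) (β : Fin 3 → ℝ) :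
    Jᵀ * sq β * J = sq (Jᵀ *ᵥ β) := by
  rw [sq, sq, Matrix.mul_vecMulVec, Matrix.vecMulVec_mul, ← Matrix.mulVec_transpose]

theorem jacobian_transpose_mulVec_dx (y : Fin 3 → E3 → ℝ) (x : E3) (k : Fin 3) :
    (jacobian y x)ᵀ *ᵥ dx k = fun i => pd i (y k) x := by
  ext i
  simp [dx, jacobian]

theorem sq_apply (β : Fin 3 → ℝ) (i j : Fin 3) : sq β i j = β i * β j := rfl

/-- Functions on a Sasakian 3-manifold of constant curvature whose transverse Hessian is a multiple
of the transverse metric, with prescribed first jet. -/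
theorem IsAdaptedCoframe.exists_hessian_function (hr : 0 < r)
    (h : IsAdaptedCoframe (ball x₀ r) G ξ W s a b c p) (f₀ u₀ v₀ : ℝ) :
    ∃ f u v : E3 → ℝ, f x₀ = f₀ ∧ ∃ r' > 0, r' ≤ r ∧
      (∀ x ∈ ball x₀ r', ContDiffAt ℝ ∞ f x ∧ ContDiffAt ℝ ∞ u x ∧ ContDiffAt ℝ ∞ v x) ∧
      (∀ x ∈ ball x₀ r', ∀ i, pd i f x = u x * a i x + v x * b i x) ∧
      (∀ x ∈ ball x₀ r', ∀ i, pd i u x = -2 * W * f x * a i x - v x * p i x) ∧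
      (∀ x ∈ ball x₀ r', ∀ i, pd i v x = -2 * W * f x * b i x + u x * p i x) ∧
      ∀ x ∈ ball x₀ r', u x ^ 2 + v x ^ 2 + 2 * W * f x ^ 2
        = u₀ ^ 2 + v₀ ^ 2 + 2 * W * f₀ ^ 2 := by
  -- The equation `Hess f = -2W f (a² + b²)` as a first order system for `(f, u, v)`, where `df = u
  -- a + v b`. It is flat because the transverse curvature `2W` in `dp` matches the factor `-2W` in
  -- the Hessian.
  obtain ⟨w, hw0, r', hr', hrr, hw⟩ := exists_parallel_section
    (A := fun i x => !![0, a i x, b i x; -2 * W * a i x, 0, -p i x; -2 * W * b i x, p i x, 0]) hr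
    (by
      intro i x hx k l
      have ha := h.smooth_a i x hx
      have hb := h.smooth_b i x hx
      have hp := h.smooth_p i x hx
      fin_cases k <;> fin_cases l <;> simp <;> fun_prop)
    (by
      intro i j x hx
      have ha := h.d_a x hx i j
      have hb := h.d_b x hx i j
      have hp := h.d_p x hx i j
      have e1 := fun i j => pd_const_mul (x := x) i (-2 * W) (h.smooth_a j x hx).diff
      have e2 := fun i j => pd_const_mul (x := x) i (-2 * W) (h.smooth_b j x hx).diff
      have e3 := fun i j => pd_neg (f := p j) (x := x) i
      have e0 := fun i => pd_const i 0 x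
      ext k l
      rw [Matrix.add_apply, Matrix.add_apply, Matrix.mul_apply, Matrix.mul_apply]
      simp only [mpd, Matrix.of_apply, Fin.sum_univ_three]
      fin_cases k <;> fin_cases l <;> simp [e0, e3] <;> (try simp only [← neg_mul, e1, e2]) <;>
        first
          | ring1
          | linear_combination ha
          | linear_combination hb
          | linear_combination hp
          | linear_combination -hp
          | linear_combination (-2 * W) * ha
          | linear_combination (-2 * W) * hb)
    ![f₀, u₀, v₀]
  have hs := fun x hx => (hw x hx).1
  have hf : ∀ x ∈ ball x₀ r', ∀ i, pd i (fun y => w y 0) x = w x 1 * a i x + w x 2 * b i x := by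
    intro x hx i
    rw [(hw x hx).2 i 0]
    simp [Matrix.mulVec, dotProduct, Fin.sum_univ_three]
    ring
  have hu : ∀ x ∈ ball x₀ r', ∀ i, pd i (fun y => w y 1) x
      = -2 * W * w x 0 * a i x - w x 2 * p i x := by
    intro x hx i
    rw [(hw x hx).2 i 1]
    simp [Matrix.mulVec, dotProduct, Fin.sum_univ_three]
    ring
  have hv : ∀ x ∈ ball x₀ r', ∀ i, pd i (fun y => w y 2) x
      = -2 * W * w x 0 * b i x + w x 1 * p i x := by
    intro x hx i
    rw [(hw x hx).2 i 2]
    simp [Matrix.mulVec, dotProduct, Fin.sum_univ_three]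
    ring
  refine ⟨fun x => w x 0, fun x => w x 1, fun x => w x 2, by simp [hw0], r', hr', hrr,
    fun x hx => ⟨hs x hx 0, hs x hx 1, hs x hx 2⟩, hf, hu, hv, fun x hx => ?_⟩
  -- The first integral `|df|² + 2W f²`.
  have hQ : ∀ y ∈ ball x₀ r', ContDiffAt ℝ ∞
      (fun y => w y 1 * w y 1 + w y 2 * w y 2 + 2 * W * (w y 0 * w y 0)) y := fun y hy =>
    (((hs y hy 1).mul (hs y hy 1)).add ((hs y hy 2).mul (hs y hy 2))).add
      (contDiffAt_const.mul ((hs y hy 0).mul (hs y hy 0)))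
  have hconst := eq_of_pd_eq_zero (fun y hy => (hQ y hy).diff) (fun y hy i => by
    have d0 := (hs y hy 0).diff
    have d1 := (hs y hy 1).diff
    have d2 := (hs y hy 2).diff
    rw [pd_add i ((d1.fun_mul d1).fun_add (d2.fun_mul d2)) ((d0.fun_mul d0).const_mul _),
      pd_add i (d1.fun_mul d1) (d2.fun_mul d2), pd_const_mul i _ (d0.fun_mul d0), pd_mul i d0 d0,
      pd_mul i d1 d1, pd_mul i d2 d2, hf y hy, hu y hy, hv y hy]
    ring) hx
  simp only [hw0] at hconst
  simp at hconst
  linear_combination hconst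

/-- The differential of the rotated gradient of a function with umbilic transverse Hessian. -/
theorem IsAdaptedCoframe.d_star {B : Set E3} (h : IsAdaptedCoframe B G ξ W s a b c p)
    {f u v : E3 → ℝ} {x : E3} (hx : x ∈ B) (hus : ContDiffAt ℝ ∞ u x) (hvs : ContDiffAt ℝ ∞ v x)
    (hu : ∀ i, pd i u x = -2 * W * f x * a i x - v x * p i x)
    (hv : ∀ i, pd i v x = -2 * W * f x * b i x + u x * p i x) (i j : Fin 3) :
    pd i (fun y => u y * b j y - v y * a j y) x - pd j (fun y => u y * b i y - v y * a i y) x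
      = -4 * W * f x * (a i x * b j x - a j x * b i x) := by
  have e : ∀ i j, pd i (fun y => u y * b j y - v y * a j y) x
      = pd i u x * b j x + u x * pd i (b j) x - (pd i v x * a j x + v x * pd i (a j) x) := by
    intro i j
    rw [pd_sub i (hus.diff.fun_mul (h.smooth_b j x hx).diff)
      (hvs.diff.fun_mul (h.smooth_a j x hx).diff), pd_mul i hus.diff (h.smooth_b j x hx).diff,
      pd_mul i hvs.diff (h.smooth_a j x hx).diff]
  rw [e, e, hu, hu, hv, hv]
  linear_combination u x * h.d_b x hx i j - v x * h.d_a x hx i j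

/-- Angular coordinates around the axis given by a function `f` with `W (1 - f²) > 0`. -/
theorem IsAdaptedCoframe.exists_angles (h : IsAdaptedCoframe (ball x₀ r) G ξ W s a b c p)
    {f u v : E3 → ℝ}
    (hs : ∀ x ∈ ball x₀ r, ContDiffAt ℝ ∞ f x ∧ ContDiffAt ℝ ∞ u x ∧ ContDiffAt ℝ ∞ v x)
    (hf : ∀ x ∈ ball x₀ r, ∀ i, pd i f x = u x * a i x + v x * b i x)
    (hu : ∀ x ∈ ball x₀ r, ∀ i, pd i u x = -2 * W * f x * a i x - v x * p i x)
    (hv : ∀ x ∈ ball x₀ r, ∀ i, pd i v x = -2 * W * f x * b i x + u x * p i x)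
    (hQ : ∀ x ∈ ball x₀ r, u x ^ 2 + v x ^ 2 = 2 * W * (1 - f x ^ 2))
    (hD : ∀ x ∈ ball x₀ r, 1 - f x ^ 2 ≠ 0) :
    ∃ ρ φ : E3 → ℝ, ∀ x ∈ ball x₀ r, ContDiffAt ℝ ∞ ρ x ∧ ContDiffAt ℝ ∞ φ x ∧
      (∀ i, pd i φ x = -s * (u x * b i x - v x * a i x) * (1 - f x ^ 2)⁻¹) ∧
      ∀ i, pd i ρ x + f x * pd i φ x = W * c i x := by
  have hN : ∀ i, ∀ x ∈ ball x₀ r, ContDiffAt ℝ ∞ (fun y => -s * (u y * b i y - v y * a i y)) x :=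
    fun i x hx => contDiffAt_const.mul (((hs x hx).2.1.mul (h.smooth_b i x hx)).sub
      ((hs x hx).2.2.mul (h.smooth_a i x hx)))
  have hg : ∀ x ∈ ball x₀ r, ContDiffAt ℝ ∞ (fun y => (1 - f y ^ 2)⁻¹) x := fun x hx =>
    (contDiffAt_const.sub ((hs x hx).1.pow 2)).inv (hD x hx)
  have hdg : ∀ x ∈ ball x₀ r, ∀ i, pd i (fun y => (1 - f y ^ 2)⁻¹) x
      = 2 * f x * ((1 - f x ^ 2)⁻¹) ^ 2 * pd i f x := by
    intro x hx i
    have h1 : HasDerivAt (fun t : ℝ => (1 - t ^ 2)⁻¹) (2 * f x * ((1 - f x ^ 2)⁻¹) ^ 2) (f x) := by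
      have := (((hasDerivAt_id (f x)).pow 2).const_sub 1).fun_inv (hD x hx)
      refine this.congr_deriv ?_
      simp
      field_simp
    exact pd_comp (φ := fun t : ℝ => (1 - t ^ 2)⁻¹) i h1 (hs x hx).1.diff
  -- Write `*df = u b - v a` and `g = (1 - f²)⁻¹`. The form `g *df` is closed: `d(*df) = -4W f a ∧
  -- b`, while `dg ∧ *df = 2 f g² |df|² a ∧ b = 4W f g a ∧ b` by the first integral.
  obtain ⟨φ, hφ⟩ := exists_potential
    (α := fun i x => -s * (u x * b i x - v x * a i x) * (1 - f x ^ 2)⁻¹)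
    (fun i x hx => (hN i x hx).mul (hg x hx)) (fun i j x hx => by
      have hsm := hs x hx
      rw [pd_mul i (hN j x hx).diff (hg x hx).diff, pd_mul j (hN i x hx).diff (hg x hx).diff,
        hdg x hx, hdg x hx, pd_const_mul i _
          (((hsm.2.1.mul (h.smooth_b j x hx)).sub (hsm.2.2.mul (h.smooth_a j x hx))).diff),
        pd_const_mul j _
          (((hsm.2.1.mul (h.smooth_b i x hx)).sub (hsm.2.2.mul (h.smooth_a i x hx))).diff),
        hf x hx, hf x hx]
      have h1 := h.d_star hx hsm.2.1 hsm.2.2 (hu x hx) (hv x hx) i j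
      have h2 : (1 - f x ^ 2) * (1 - f x ^ 2)⁻¹ = 1 := mul_inv_cancel₀ (hD x hx)
      have h3 := hQ x hx
      set g := (1 - f x ^ 2)⁻¹
      linear_combination (-s * g) * h1
        - s * (2 * f x * g ^ 2) * (a i x * b j x - a j x * b i x) * h3
        - s * 4 * W * f x * g * (a i x * b j x - a j x * b i x) * h2)
  -- The form `W c - f dφ` is closed: both `W dc` and `df ∧ dφ = -s g |df|² a ∧ b` equal `-2sW a ∧
  -- b`.
  obtain ⟨ρ, hρ⟩ := exists_potential (x₀ := x₀) (r := r)
    (α := fun i x => W * c i x - f x * (-s * (u x * b i x - v x * a i x) * (1 - f x ^ 2)⁻¹))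
    (fun i x hx => (contDiffAt_const.mul (h.smooth_c i x hx)).sub
      ((hs x hx).1.mul ((hN i x hx).mul (hg x hx)))) (fun i j x hx => by
      have hsm := hs x hx
      have hβ := fun i => (hN i x hx).mul (hg x hx)
      have hex : ∀ i j, pd i (fun x => W * c j x
          - f x * (-s * (u x * b j x - v x * a j x) * (1 - f x ^ 2)⁻¹)) x
          = W * pd i (c j) x - (pd i f x * (-s * (u x * b j x - v x * a j x) * (1 - f x ^ 2)⁻¹)
            + f x * pd i (pd j φ) x) := by
        intro i j
        rw [pd_sub i ((h.smooth_c j x hx).diff.const_mul W) (hsm.1.mul (hβ j)).diff,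
          pd_const_mul i W (h.smooth_c j x hx).diff, pd_mul i hsm.1.diff (hβ j).diff]
        congr 3
        exact pd_congr i (by
          filter_upwards [isOpen_ball.mem_nhds hx] with y hy using ((hφ y hy).2 j).symm)
      rw [hex, hex, pd_comm i j (hφ x hx).1, hf x hx, hf x hx]
      have h1 := h.d_c x hx i j
      have h2 : (1 - f x ^ 2) * (1 - f x ^ 2)⁻¹ = 1 := mul_inv_cancel₀ (hD x hx)
      have h3 := hQ x hx
      set g := (1 - f x ^ 2)⁻¹
      linear_combination W * h1 + s * g * (a i x * b j x - a j x * b i x) * h3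
        + 2 * W * s * (a i x * b j x - a j x * b i x) * h2)
  refine ⟨ρ, φ, fun x hx => ⟨(hρ x hx).1, (hφ x hx).1, (hφ x hx).2, fun i => ?_⟩⟩
  rw [(hρ x hx).2, (hφ x hx).2]
  ring

/-- Pulling back a metric of the form `A (dθ² + T dφ²) + C (dρ + f dφ)²`. -/
theorem IsAdaptedCoframe.metric_pullback {B : Set E3} (h : IsAdaptedCoframe B G ξ W s a b c p)
    {x : E3} (hx : x ∈ B) (hW : W ≠ 0) {f u v S e ε : ℝ} (hS : S ≠ 0) (hε : ε ^ 2 = 1)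
    (he : e ^ 2 = 1) (hS2 : S ^ 2 = ε * (1 - f ^ 2)) (hQ : u ^ 2 + v ^ 2 = 2 * W * (1 - f ^ 2))
    {dρ dθ dφ : Fin 3 → ℝ} (hθ : ∀ i, dθ i = e * S⁻¹ * (u * a i x + v * b i x))
    (hφ : ∀ i, dφ i = -s * (u * b i x - v * a i x) * (1 - f ^ 2)⁻¹)
    (hρ : ∀ i, dρ i + f * dφ i = W * c i x) (i j : Fin 3) :
    G x i j = ε * (1 / (2 * W)) * (dθ i * dθ j + S ^ 2 * (dφ i * dφ j)
      + ε * (2 / W) * ((dρ i + f * dφ i) * (dρ j + f * dφ j))) := by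
  -- The two signs cover both cases: `S` is `sin θ` with `ε = 1`, or `sinh θ` with `ε = -1`. In `dθ
  -- = e S⁻¹ df` the sign is `e = -1` for `θ = arccos f` and `e = 1` for `θ = arcosh f`.
  have hε0 : ε ≠ 0 := by rintro rfl; norm_num at hε
  have hD : 1 - f ^ 2 ≠ 0 := by
    intro h0
    rw [h0, mul_zero] at hS2
    exact hS (pow_eq_zero_iff (two_ne_zero) |>.1 hS2)
  have hs := h.sign
  rw [h.metric x hx, hρ, hρ, hθ, hθ, hφ, hφ]
  have h1 : (e * S⁻¹ * (u * a i x + v * b i x)) * (e * S⁻¹ * (u * a j x + v * b j x))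
      = ε * ((u * a i x + v * b i x) * (u * a j x + v * b j x)) * (1 - f ^ 2)⁻¹ := by
    have : S⁻¹ ^ 2 = ε * (1 - f ^ 2)⁻¹ := by
      rw [inv_pow, hS2]
      field_simp
      exact hε.symm
    linear_combination ((u * a i x + v * b i x) * (u * a j x + v * b j x)) * (e ^ 2 * this
      + ε * (1 - f ^ 2)⁻¹ * he)
  have h2 : S ^ 2 * ((-s * (u * b i x - v * a i x) * (1 - f ^ 2)⁻¹)
      * (-s * (u * b j x - v * a j x) * (1 - f ^ 2)⁻¹))
      = ε * ((u * b i x - v * a i x) * (u * b j x - v * a j x)) * (1 - f ^ 2)⁻¹ := by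
    rw [hS2]
    field_simp
    linear_combination (u * b i x - v * a i x) * (u * b j x - v * a j x) * hs
  rw [h1, h2]
  -- Since `df² + (*df)² = |df|² (a² + b²)` and `|df|² = 2W (1 - f²)`, the denominator cancels.
  have h3 : ε * ((u * a i x + v * b i x) * (u * a j x + v * b j x)) * (1 - f ^ 2)⁻¹
      + ε * ((u * b i x - v * a i x) * (u * b j x - v * a j x)) * (1 - f ^ 2)⁻¹
      = ε * (2 * W) * (a i x * a j x + b i x * b j x) := by
    have h4 : (1 - f ^ 2) * (1 - f ^ 2)⁻¹ = 1 := mul_inv_cancel₀ hD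
    linear_combination ε * (a i x * a j x + b i x * b j x) * (1 - f ^ 2)⁻¹ * hQ
      + ε * (2 * W) * (a i x * a j x + b i x * b j x) * h4
  rw [h3]
  field_simp
  linear_combination -(a i x * a j x + b i x * b j x + c i x * c j x) * hε

/-- The function `f` is to be `cos θ`. The jet `f = 0`, `|df|² = 2W` at the centre fixes the first
integral at `2W`, so `|df|² = 2W (1 - f²)`, and `|f| < 1` persists nearby. -/
theorem IsAdaptedCoframe.exists_pullback_pos (hr : 0 < r) (hW : 0 < W)
    (h : IsAdaptedCoframe (ball x₀ r) G ξ W s a b c p) :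
    ∃ r' > 0, r' ≤ r ∧ ∃ y,
      IsPullbackOn (ball x₀ r') G ξ posDomain (posMetric W) (posForm W) y := by
  obtain ⟨f, u, v, hf0, r₁, hr₁, hrr, hs, hf, hu, hv, hQ⟩ :=
    h.exists_hessian_function hr 0 (√(2 * W)) 0
  have hnear : ∀ᶠ x in 𝓝 x₀, f x ∈ Ioo (-1 : ℝ) 1 :=
    (hs x₀ (mem_ball_self hr₁)).1.continuousAt.eventually
      (isOpen_Ioo.mem_nhds (by rw [hf0]; norm_num))
  obtain ⟨r₂, hr₂, hball⟩ := Metric.eventually_nhds_iff_ball.1 hnear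
  have hsub1 : ball x₀ (min r₁ r₂) ⊆ ball x₀ r₁ := ball_subset_ball (min_le_left _ _)
  have hD : ∀ x ∈ ball x₀ (min r₁ r₂), 0 < 1 - f x ^ 2 := fun x hx => by
    have := hball x (ball_subset_ball (min_le_right _ _) hx)
    nlinarith [this.1, this.2]
  have hQ' : ∀ x ∈ ball x₀ (min r₁ r₂), u x ^ 2 + v x ^ 2 = 2 * W * (1 - f x ^ 2) := fun x hx => by
    have := hQ x (hsub1 hx)
    rw [Real.sq_sqrt (by positivity)] at this
    linear_combination this
  have h' := h.mono ((ball_subset_ball ((min_le_left _ _).trans hrr)) :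
    ball x₀ (min r₁ r₂) ⊆ ball x₀ r)
  obtain ⟨ρ, φ, hang⟩ := h'.exists_angles (fun x hx => hs x (hsub1 hx))
    (fun x hx => hf x (hsub1 hx)) (fun x hx => hu x (hsub1 hx)) (fun x hx => hv x (hsub1 hx)) hQ'
    (fun x hx => (hD x hx).ne')
  refine ⟨min r₁ r₂, lt_min hr₁ hr₂, (min_le_left _ _).trans hrr,
    ![ρ, fun x => Real.arccos (f x), φ], ⟨fun k x hx => ?_, fun x hx => ?_, fun x hx => ?_,
      fun x hx => ?_⟩⟩
  all_goals
    have hI := hball x (ball_subset_ball (min_le_right _ _) hx)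
    obtain ⟨h1, h2, h3, h4⟩ := hang x hx
  · fin_cases k
    · exact h1
    · exact (Real.contDiffAt_arccos hI.1.ne' hI.2.ne).comp x (hs x (hsub1 hx)).1
    · exact h2
  · exact ⟨by simpa using Real.arccos_pos.2 hI.2, by
      simpa using lt_of_le_of_ne (Real.arccos_le_pi _) fun h0 =>
        absurd (Real.arccos_eq_pi.1 h0) (by linarith [hI.1])⟩
  · have hθ : ∀ i, pd i (fun x => Real.arccos (f x)) x
        = (-1) * (√(1 - f x ^ 2))⁻¹ * (u x * a i x + v x * b i x) := by
      intro i
      rw [pd_comp i (Real.hasDerivAt_arccos hI.1.ne' hI.2.ne) (hs x (hsub1 hx)).1.diff,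
        hf x (hsub1 hx)]
      ring
    ext i j
    have := h'.metric_pullback hx hW.ne' (f := f x) (u := u x) (v := v x) (S := √(1 - f x ^ 2))
      (e := -1) (ε := 1) (Real.sqrt_pos.2 (hD x hx)).ne' (by norm_num) (by norm_num)
      (by rw [Real.sq_sqrt (hD x hx).le, one_mul]) (hQ' x hx) hθ h3 h4 i j
    rw [this]
    simp only [posMetric, Matrix.mul_smul, Matrix.smul_mul, Matrix.mul_add, Matrix.add_mul,
      transpose_mul_sq_mul, Matrix.mulVec_add, Matrix.mulVec_smul, jacobian_transpose_mulVec_dx,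
      Matrix.smul_apply, Matrix.add_apply, sq_apply, Pi.add_apply, Pi.smul_apply, smul_eq_mul]
    simp [Real.cos_arccos hI.1.le hI.2.le, Real.sin_arccos]
  · ext i
    rw [← h'.contact x hx]
    simp only [posForm, Matrix.mulVec_smul, Matrix.mulVec_add, jacobian_transpose_mulVec_dx,
      Pi.add_apply, Pi.smul_apply, smul_eq_mul]
    have h4' := h4 i
    simp [Real.cos_arccos hI.1.le hI.2.le]
    rw [h4']
    field_simp

/-- The function `f` is to be `cosh θ > 1`. With `f² = 2` and `|df|² = -2W` at the centre the first
integral is `-2W + 4W = 2W`, again `|df|² = 2W (1 - f²)`. -/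
theorem IsAdaptedCoframe.exists_pullback_neg (hr : 0 < r) (hW : W < 0)
    (h : IsAdaptedCoframe (ball x₀ r) G ξ W s a b c p) :
    ∃ r' > 0, r' ≤ r ∧ ∃ y,
      IsPullbackOn (ball x₀ r') G ξ negDomain (negMetric W) (negForm W) y := by
  obtain ⟨f, u, v, hf0, r₁, hr₁, hrr, hs, hf, hu, hv, hQ⟩ :=
    h.exists_hessian_function hr (√2) (√(-(2 * W))) 0
  have hnear : ∀ᶠ x in 𝓝 x₀, f x ∈ Ioi (1 : ℝ) :=
    (hs x₀ (mem_ball_self hr₁)).1.continuousAt.eventually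
      (isOpen_Ioi.mem_nhds (by rw [hf0, mem_Ioi, Real.lt_sqrt] <;> norm_num))
  obtain ⟨r₂, hr₂, hball⟩ := Metric.eventually_nhds_iff_ball.1 hnear
  have hsub1 : ball x₀ (min r₁ r₂) ⊆ ball x₀ r₁ := ball_subset_ball (min_le_left _ _)
  have hD : ∀ x ∈ ball x₀ (min r₁ r₂), 0 < f x ^ 2 - 1 := fun x hx => by
    have : 1 < f x := hball x (ball_subset_ball (min_le_right _ _) hx)
    nlinarith
  have hQ' : ∀ x ∈ ball x₀ (min r₁ r₂), u x ^ 2 + v x ^ 2 = 2 * W * (1 - f x ^ 2) := fun x hx => by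
    have := hQ x (hsub1 hx)
    rw [Real.sq_sqrt (by linarith), Real.sq_sqrt (by norm_num)] at this
    linear_combination this
  have h' := h.mono ((ball_subset_ball ((min_le_left _ _).trans hrr)) :
    ball x₀ (min r₁ r₂) ⊆ ball x₀ r)
  obtain ⟨ρ, φ, hang⟩ := h'.exists_angles (fun x hx => hs x (hsub1 hx))
    (fun x hx => hf x (hsub1 hx)) (fun x hx => hu x (hsub1 hx)) (fun x hx => hv x (hsub1 hx)) hQ'
    (fun x hx => by linarith [hD x hx] |> fun (h0 : 1 - f x ^ 2 < 0) => h0.ne)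
  refine ⟨min r₁ r₂, lt_min hr₁ hr₂, (min_le_left _ _).trans hrr,
    ![ρ, fun x => Real.arcosh (f x), φ], ⟨fun k x hx => ?_, fun x hx => ?_, fun x hx => ?_,
      fun x hx => ?_⟩⟩
  all_goals
    have hI : f x ∈ Ioi (1 : ℝ) := hball x (ball_subset_ball (min_le_right _ _) hx)
    have hI1 : 1 ≤ f x := le_of_lt hI
    obtain ⟨h1, h2, h3, h4⟩ := hang x hx
  · fin_cases k
    · exact h1
    · exact (Real.contDiffAt_arcosh hI).comp x (hs x (hsub1 hx)).1
    · exact h2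
  · simpa [negDomain] using Real.arcosh_pos hI
  · have hθ : ∀ i, pd i (fun x => Real.arcosh (f x)) x
        = 1 * (√(f x ^ 2 - 1))⁻¹ * (u x * a i x + v x * b i x) := by
      intro i
      rw [pd_comp i (Real.hasDerivAt_arcosh hI) (hs x (hsub1 hx)).1.diff, hf x (hsub1 hx)]
      ring
    ext i j
    have := h'.metric_pullback hx hW.ne (f := f x) (u := u x) (v := v x) (S := √(f x ^ 2 - 1))
      (e := 1) (ε := -1) (Real.sqrt_pos.2 (hD x hx)).ne' (by norm_num) (by norm_num)
      (by rw [Real.sq_sqrt (hD x hx).le]; ring) (hQ' x hx) hθ h3 h4 i j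
    rw [this]
    simp only [negMetric, Matrix.mul_smul, Matrix.smul_mul, Matrix.mul_add, Matrix.add_mul,
      Matrix.mul_sub, Matrix.sub_mul, Matrix.sub_apply,
      transpose_mul_sq_mul, Matrix.mulVec_add, Matrix.mulVec_smul, jacobian_transpose_mulVec_dx,
      Matrix.smul_apply, Matrix.add_apply, sq_apply, Pi.add_apply, Pi.smul_apply, smul_eq_mul]
    simp [Real.cosh_arcosh hI1, Real.sinh_arcosh hI1]
    left
    ring
  · ext i
    rw [← h'.contact x hx]
    simp only [negForm, Matrix.mulVec_smul, Matrix.mulVec_add, jacobian_transpose_mulVec_dx,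
      Pi.add_apply, Pi.smul_apply, smul_eq_mul]
    have h4' := h4 i
    simp [Real.cosh_arcosh hI1]
    rw [h4']
    field_simp [hW.ne]

/-- For `W = 0` the transverse metric is flat and `df` is parallel of length 1. Then `dq = s *df` is
closed, so `f` and `q` are Euclidean coordinates. The form `c - 2 q df` is closed because `dc` and
`2 dq ∧ df` both equal `-2s a ∧ b`; its potential is the coordinate `r`. -/
theorem IsAdaptedCoframe.exists_pullback_nil (hr : 0 < r)
    (h : IsAdaptedCoframe (ball x₀ r) G ξ 0 s a b c p) :
    ∃ r' > 0, r' ≤ r ∧ ∃ y, IsPullbackOn (ball x₀ r') G ξ univ nilMetric nilForm y := by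
  obtain ⟨f, u, v, hf0, r₁, hr₁, hrr, hs, hf, hu, hv, hQ⟩ := h.exists_hessian_function hr 0 1 0
  have hQ' : ∀ x ∈ ball x₀ r₁, u x ^ 2 + v x ^ 2 = 1 := fun x hx => by
    have := hQ x hx
    linear_combination this
  have h' := h.mono (ball_subset_ball hrr : ball x₀ r₁ ⊆ ball x₀ r)
  have hN : ∀ i, ∀ x ∈ ball x₀ r₁, ContDiffAt ℝ ∞ (fun y => u y * b i y - v y * a i y) x :=
    fun i x hx => ((hs x hx).2.1.mul (h'.smooth_b i x hx)).sub
      ((hs x hx).2.2.mul (h'.smooth_a i x hx))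
  obtain ⟨q, hq⟩ := exists_potential (x₀ := x₀) (r := r₁)
    (α := fun i x => s * (u x * b i x - v x * a i x))
    (fun i x hx => contDiffAt_const.mul (hN i x hx)) (fun i j x hx => by
      rw [pd_const_mul i _ (hN j x hx).diff, pd_const_mul j _ (hN i x hx).diff]
      have h1 := h'.d_star hx (hs x hx).2.1 (hs x hx).2.2 (hu x hx) (hv x hx) i j
      linear_combination s * h1)
  obtain ⟨ρ, hρ⟩ := exists_potential (x₀ := x₀) (r := r₁)
    (α := fun i x => c i x - 2 * (q x * pd i f x))
    (fun i x hx => (h'.smooth_c i x hx).sub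
      (contDiffAt_const.mul ((hq x hx).1.mul ((hs x hx).1.pd i)))) (fun i j x hx => by
      have hex : ∀ i j, pd i (fun x => c j x - 2 * (q x * pd j f x)) x
          = pd i (c j) x - 2 * (pd i q x * pd j f x + q x * pd i (pd j f) x) := by
        intro i j
        have hm := ((hq x hx).1.mul ((hs x hx).1.pd j)).diff
        rw [pd_sub i (h'.smooth_c j x hx).diff (hm.const_mul 2), pd_const_mul i 2 hm,
          pd_mul i (hq x hx).1.diff ((hs x hx).1.pd j).diff]
      rw [hex, hex, pd_comm i j (hs x hx).1, (hq x hx).2, (hq x hx).2, hf x hx, hf x hx]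
      have h1 := h'.d_c x hx i j
      have h3 := hQ' x hx
      linear_combination h1 + 2 * s * (a i x * b j x - a j x * b i x) * h3)
  refine ⟨r₁, hr₁, hrr, ![ρ, f, q], ⟨fun k x hx => ?_, fun x hx => mem_univ _, fun x hx => ?_,
      fun x hx => ?_⟩⟩
  · fin_cases k
    · exact (hρ x hx).1
    · exact (hs x hx).1
    · exact (hq x hx).1
  · ext i j
    simp only [nilMetric, Matrix.mul_add, Matrix.add_mul,
      transpose_mul_sq_mul, Matrix.mulVec_add, Matrix.mulVec_smul, jacobian_transpose_mulVec_dx,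
      Matrix.add_apply, sq_apply, Pi.add_apply, Pi.smul_apply, smul_eq_mul]
    simp [(hρ x hx).2, (hq x hx).2, hf x hx, h'.metric x hx]
    have h3 := hQ' x hx
    have h4 := h'.sign
    linear_combination -(a i x * a j x + b i x * b j x) * h3
      - (u x * b i x - v x * a i x) * (u x * b j x - v x * a j x) * h4
  · ext i
    rw [← h'.contact x hx]
    simp only [nilForm, Matrix.mulVec_smul, Matrix.mulVec_add, jacobian_transpose_mulVec_dx,
      Pi.add_apply, Pi.smul_apply, smul_eq_mul]
    simp [(hρ x hx).2, hf x hx]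
    ring

end Coordinates

end Sasaki
end

noncomputable section
namespace Sasaki
open Filter Topology Set Metric Bundle

/-! ### Tensors of the manifold in a chart -/

section Charts

set_option linter.unusedSectionVars false

variable {M : Type*} [TopologicalSpace M] [ChartedSpace E3 M] [IsManifold 𝓘(ℝ, E3) ∞ M]
  {g : SmoothMetric M} {ξ : ∀ p : M, TangentSpace 𝓘(ℝ, E3) p} {e : OpenPartialHomeomorph M E3}
  {x : E3}

theorem mdifferentiable_of_mem_maximalAtlas (he : e ∈ IsManifold.maximalAtlas 𝓘(ℝ, E3) ∞ M) :
    e.MDifferentiable 𝓘(ℝ, E3) 𝓘(ℝ, E3) :=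
  ⟨(contMDiffOn_of_mem_maximalAtlas he).mdifferentiableOn (by simp),
    (contMDiffOn_symm_of_mem_maximalAtlas he).mdifferentiableOn (by simp)⟩

/-- The coordinate vector fields are smooth. -/
theorem contMDiffAt_coordVec (he : e ∈ IsManifold.maximalAtlas 𝓘(ℝ, E3) ∞ M) (hx : x ∈ e.target)
    (i : Fin 3) : ContMDiffAt 𝓘(ℝ, E3) 𝓘(ℝ, E3).tangent ∞
      (fun y => (⟨e.symm y, coordVec e y i⟩ : TangentBundle 𝓘(ℝ, E3) M)) x := by
  have : IsManifold 𝓘(ℝ, E3) 1 M := IsManifold.of_le (n := ∞) (by simp)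
  have h1 := (contMDiffOn_symm_of_mem_maximalAtlas he).contMDiffOn_tangentMapWithin (m := ∞)
    (by simp) e.open_target.uniqueMDiffOn
  have h2 : ContMDiffAt 𝓘(ℝ, E3) 𝓘(ℝ, E3).tangent ∞
      (fun y => (⟨y, basisVec i⟩ : TangentBundle 𝓘(ℝ, E3) E3)) x :=
    contMDiffAt_vectorSpace_iff_contDiffAt.2 contDiffAt_const
  have h3 := ((h1 ⟨x, basisVec i⟩ hx).contMDiffAt
    ((e.open_target.preimage (FiberBundle.continuous_proj E3 _)).mem_nhds hx)).comp x h2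
  refine h3.congr_of_eventuallyEq ?_
  filter_upwards [e.open_target.mem_nhds hx] with y hy
  simp only [Function.comp, tangentMapWithin, coordVec,
    mfderivWithin_of_isOpen e.open_target hy]

/-- The scalar product of smooth vector fields along a smooth map is smooth. -/
theorem contDiffAt_inner {b : E3 → M} {v w : ∀ y, TangentSpace 𝓘(ℝ, E3) (b y)}
    (hb : ContMDiffAt 𝓘(ℝ, E3) 𝓘(ℝ, E3) ∞ b x)
    (hv : ContMDiffAt 𝓘(ℝ, E3) 𝓘(ℝ, E3).tangent ∞
      (fun y => (⟨b y, v y⟩ : TangentBundle 𝓘(ℝ, E3) M)) x)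
    (hw : ContMDiffAt 𝓘(ℝ, E3) 𝓘(ℝ, E3).tangent ∞
      (fun y => (⟨b y, w y⟩ : TangentBundle 𝓘(ℝ, E3) M)) x) :
    ContDiffAt ℝ ∞ (fun y => g.inner (b y) (v y) (w y)) x := by
  have : ContMDiffAt 𝓘(ℝ, E3) (𝓘(ℝ, E3).prod 𝓘(ℝ)) ∞
      (fun y ↦ TotalSpace.mk' ℝ (E := Bundle.Trivial M ℝ) (b y) (g.inner (b y) (v y) (w y))) x := by
    apply ContMDiffAt.clm_bundle_apply₂ (F₁ := E3) (F₂ := E3)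
    · exact g.contMDiff.contMDiffAt.comp x hb
    · exact hv
    · exact hw
  simp only [contMDiffAt_totalSpace] at this
  exact this.2.contDiffAt

theorem contDiffAt_metricIn (he : e ∈ IsManifold.maximalAtlas 𝓘(ℝ, E3) ∞ M) (hx : x ∈ e.target)
    (i j : Fin 3) : ContDiffAt ℝ ∞ (fun y => metricIn g e y i j) x :=
  contDiffAt_inner
    ((contMDiffOn_symm_of_mem_maximalAtlas he).contMDiffAt (e.open_target.mem_nhds hx))
    (contMDiffAt_coordVec he hx i) (contMDiffAt_coordVec he hx j)

theorem contDiffAt_contactIn (he : e ∈ IsManifold.maximalAtlas 𝓘(ℝ, E3) ∞ M) (hx : x ∈ e.target)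
    (hξ : ContMDiff 𝓘(ℝ, E3) 𝓘(ℝ, E3).tangent ∞
      (fun p => (⟨p, ξ p⟩ : TangentBundle 𝓘(ℝ, E3) M)))
    (i : Fin 3) : ContDiffAt ℝ ∞ (fun y => contactIn g ξ e y i) x := by
  have hb := (contMDiffOn_symm_of_mem_maximalAtlas he).contMDiffAt (e.open_target.mem_nhds hx)
  exact contDiffAt_inner hb (hξ.contMDiffAt.comp x hb) (contMDiffAt_coordVec he hx i)

theorem mfderiv_symm_eq_sum (e : OpenPartialHomeomorph M E3) (x : E3) (v : Fin 3 → ℝ) :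
    mfderiv 𝓘(ℝ, E3) 𝓘(ℝ, E3) e.symm x (WithLp.toLp 2 v : E3) = ∑ i, v i • coordVec e x i := by
  have h : (WithLp.toLp 2 v : E3) = ∑ i, v i • basisVec i := eq_sum_basisVec _
  rw [h]
  erw [map_sum]
  refine Finset.sum_congr rfl fun i _ => ?_
  erw [map_smul]
  rfl

theorem mfderiv_symm_injective (he : e ∈ IsManifold.maximalAtlas 𝓘(ℝ, E3) ∞ M)
    (hx : x ∈ e.target) : Function.Injective (mfderiv 𝓘(ℝ, E3) 𝓘(ℝ, E3) e.symm x) :=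
  (mdifferentiable_of_mem_maximalAtlas he).symm.mfderiv_injective hx

theorem dotProduct_metricIn_mulVec (g : SmoothMetric M) (e : OpenPartialHomeomorph M E3) (x : E3)
    (v w : Fin 3 → ℝ) : v ⬝ᵥ metricIn g e x *ᵥ w =
      g.inner (e.symm x) (∑ i, v i • coordVec e x i) (∑ i, w i • coordVec e x i) := by
  simp only [map_sum, map_smul, sum_apply, smul_apply, dotProduct, Matrix.mulVec, metricIn,
    Matrix.of_apply, smul_eq_mul, Finset.mul_sum]
  rw [Finset.sum_comm]
  exact Finset.sum_congr rfl fun i _ => Finset.sum_congr rfl fun j _ => by ring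

/-- Positivity passes to the components because the derivative of an inverse chart is injective, so
the coordinate vectors are linearly independent. -/
theorem isRiemannianOn_metricIn (g : SmoothMetric M)
    (he : e ∈ IsManifold.maximalAtlas 𝓘(ℝ, E3) ∞ M) : IsRiemannianOn e.target (metricIn g e) where
  smooth i j x hx := (contDiffAt_metricIn he hx i j).contDiffWithinAt
  posDef x hx := by
    refine Matrix.PosDef.of_dotProduct_mulVec_pos ?_ fun v hv => ?_
    · ext i j
      exact g.symm _ _ _
    · simp only [star_trivial]
      rw [dotProduct_metricIn_mulVec]
      refine g.pos _ _ fun h0 => hv ?_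
      rw [← mfderiv_symm_eq_sum] at h0
      have : (WithLp.toLp 2 v : E3) = 0 :=
        mfderiv_symm_injective he hx (h0.trans (map_zero _).symm)
      exact congrArg WithLp.ofLp this

theorem sum_fieldIn_smul_coordVec (he : e ∈ IsManifold.maximalAtlas 𝓘(ℝ, E3) ∞ M)
    (hx : x ∈ e.target) : ∑ i, fieldIn ξ e x i • coordVec e x i = ξ (e.symm x) := by
  rw [← mfderiv_symm_eq_sum]
  have h := DFunLike.congr_fun ((mdifferentiable_of_mem_maximalAtlas he).symm_comp_deriv
    (e.map_target hx)) (ξ (e.symm x))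
  rw [e.right_inv hx] at h
  exact h

theorem contactIn_eq (he : e ∈ IsManifold.maximalAtlas 𝓘(ℝ, E3) ∞ M) (hx : x ∈ e.target) :
    contactIn g ξ e x = metricIn g e x *ᵥ fieldIn ξ e x := by
  ext i
  rw [contactIn, ← sum_fieldIn_smul_coordVec (ξ := ξ) he hx, g.symm]
  simp only [map_sum, map_smul, Matrix.mulVec, dotProduct, metricIn, Matrix.of_apply, smul_eq_mul]
  exact Finset.sum_congr rfl fun j _ => mul_comm _ _

/-- The components are obtained as `G⁻¹ η`: the components of `η` are inner products of smooth
fields, and inversion preserves smoothness. -/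
theorem contDiffAt_fieldIn (g : SmoothMetric M) (he : e ∈ IsManifold.maximalAtlas 𝓘(ℝ, E3) ∞ M)
    (hx : x ∈ e.target) (hξ : ContMDiff 𝓘(ℝ, E3) 𝓘(ℝ, E3).tangent ∞
      (fun p => (⟨p, ξ p⟩ : TangentBundle 𝓘(ℝ, E3) M)))
    (i : Fin 3) : ContDiffAt ℝ ∞ (fun y => fieldIn ξ e y i) x := by
  have hG := isRiemannianOn_metricIn g he
  have h1 := (hG.smoothM e.open_target hx).inv (hG.det_ne_zero hx)
  have h2 : ContDiffAt ℝ ∞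
      (fun y => ∑ j, (metricIn g e y)⁻¹ i j * contactIn g ξ e y j) x :=
    ContDiffAt.sum fun j _ => (h1 i j).mul (contDiffAt_contactIn he hx hξ j)
  refine h2.congr_of_eventuallyEq ?_
  filter_upwards [e.open_target.mem_nhds hx] with y hy
  have : fieldIn ξ e y = (metricIn g e y)⁻¹ *ᵥ contactIn g ξ e y := by
    rw [contactIn_eq he hy, Matrix.mulVec_mulVec,
      Matrix.nonsing_inv_mul _ (hG.det_ne_zero hy).isUnit, Matrix.one_mulVec]
  rw [this]
  rfl

end Charts

/-! ### Pullback functions are local coordinates -/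

section ChangeOfCoordinates

variable {B U : Set E3} {G Gm : E3 → Matrix (Fin 3) (Fin 3) ℝ} {ξ αm : E3 → Fin 3 → ℝ}
  {y : Fin 3 → E3 → ℝ} {x : E3}

theorem contDiffAt_toLp (hy : ∀ k, ContDiffAt ℝ ∞ (y k) x) :
    ContDiffAt ℝ ∞ (fun x => (WithLp.toLp 2 fun k => y k x : E3)) x :=
  contDiffAt_euclidean.2 hy

theorem fderiv_toLp (hy : ∀ k, ContDiffAt ℝ ∞ (y k) x) (v : E3) :
    (fderiv ℝ (fun x => (WithLp.toLp 2 fun k => y k x : E3)) x v).ofLp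
      = jacobian y x *ᵥ v.ofLp := by
  ext k
  have h := ((contDiffAt_toLp hy).differentiableAt (by simp)).hasFDerivAt
  have h2 : HasFDerivAt (y k) _ x :=
    (EuclideanSpace.proj k : E3 →L[ℝ] ℝ).hasFDerivAt.comp x h
  have h3 := DFunLike.congr_fun h2.fderiv v
  rw [fderiv_eq_sum_pd] at h3
  simp only [ContinuousLinearMap.comp_apply] at h3
  refine h3.symm.trans ?_
  exact Finset.sum_congr rfl fun i _ => mul_comm _ _

/-- As `det G = (det J)² det Gm`, functions that pull a metric back to a nondegenerate one are
automatically independent. -/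
theorem IsPullbackOn.det_jacobian_ne_zero (h : IsPullbackOn B G ξ U Gm αm y)
    (hG : (G x).det ≠ 0) (hx : x ∈ B) : (jacobian y x).det ≠ 0 := by
  intro h0
  apply hG
  rw [h.metric x hx, Matrix.det_mul, h0, mul_zero]

theorem exists_hasFDerivAt_equiv (hy : ∀ k, ContDiffAt ℝ ∞ (y k) x)
    (hJ : (jacobian y x).det ≠ 0) : ∃ L : E3 ≃L[ℝ] E3,
      HasFDerivAt (fun x => (WithLp.toLp 2 fun k => y k x : E3)) (L : E3 →L[ℝ] E3) x := by
  have h := ((contDiffAt_toLp hy).differentiableAt (by simp)).hasFDerivAt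
  set D := fderiv ℝ (fun x => (WithLp.toLp 2 fun k => y k x : E3)) x with hD
  have hinj : Function.Injective (D : E3 →ₗ[ℝ] E3) := by
    rw [injective_iff_map_eq_zero]
    intro v hv
    have h1 : jacobian y x *ᵥ v.ofLp = 0 := by
      rw [← fderiv_toLp hy]
      exact congrArg WithLp.ofLp hv
    have h2 := Matrix.eq_zero_of_mulVec_eq_zero hJ h1
    ext i
    exact congrFun h2 i
  refine ⟨(LinearEquiv.ofInjectiveEndo _ hinj).toContinuousLinearEquiv, ?_⟩
  refine h.congr_fderiv ?_
  ext1 v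
  rfl

/-- Functions with invertible Jacobian matrix are local coordinates. -/
theorem exists_openPartialHomeomorph {x₀ : E3} (hB : IsOpen B) (hx₀ : x₀ ∈ B)
    (hy : ∀ k, ∀ x ∈ B, ContDiffAt ℝ ∞ (y k) x) (hJ : ∀ x ∈ B, (jacobian y x).det ≠ 0) :
    ∃ Φ : OpenPartialHomeomorph E3 E3, x₀ ∈ Φ.source ∧ Φ.source ⊆ B ∧
      (∀ x, Φ x = WithLp.toLp 2 fun k => y k x) ∧
      ∀ z ∈ Φ.target, ContDiffAt ℝ ∞ Φ.symm z := by
  obtain ⟨L, hL⟩ := exists_hasFDerivAt_equiv (fun k => hy k x₀ hx₀) (hJ x₀ hx₀)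
  have hc := contDiffAt_toLp (fun k => hy k x₀ hx₀)
  -- Restriction to `B` keeps the Jacobian invertible on the whole source, so the inverse is smooth
  -- at every point of the target and not only at the image of `x₀`.
  set Φ := (hc.toOpenPartialHomeomorph _ hL (by simp)).restrOpen B hB with hΦ
  have hΦx : ∀ x, Φ x = WithLp.toLp 2 fun k => y k x := fun x => rfl
  have hsub : Φ.source ⊆ B := fun x hx => hx.2
  refine ⟨Φ, ⟨hc.mem_toOpenPartialHomeomorph_source hL _, hx₀⟩, hsub, hΦx, fun z hz => ?_⟩
  have hzB := hsub (Φ.map_target hz)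
  obtain ⟨L', hL'⟩ := exists_hasFDerivAt_equiv (fun k => hy k _ hzB) (hJ _ hzB)
  exact Φ.contDiffAt_symm hz hL' (contDiffAt_toLp fun k => hy k _ hzB)

end ChangeOfCoordinates

/-! ### Transport of the normal form to a chart of the manifold -/

section ChangeOfChart

set_option linter.unusedSectionVars false

variable {M : Type*} [TopologicalSpace M] [ChartedSpace E3 M] [IsManifold 𝓘(ℝ, E3) ∞ M]
  {g : SmoothMetric M} {ξ : ∀ p : M, TangentSpace 𝓘(ℝ, E3) p} {e : OpenPartialHomeomorph M E3}

theorem trans_mem_maximalAtlas {Φ : OpenPartialHomeomorph E3 E3}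
    (he : e ∈ IsManifold.maximalAtlas 𝓘(ℝ, E3) ∞ M)
    (hΦ : ∀ x ∈ Φ.source, ContDiffAt ℝ ∞ Φ x) (hΦ' : ∀ z ∈ Φ.target, ContDiffAt ℝ ∞ Φ.symm z) :
    e ≫ₕ Φ ∈ IsManifold.maximalAtlas 𝓘(ℝ, E3) ∞ M := by
  refine OpenPartialHomeomorph.mem_maximalAtlas_of_contMDiffOn _ ?_ ?_
  · have h1 : ContMDiffOn 𝓘(ℝ, E3) 𝓘(ℝ, E3) ∞ Φ Φ.source := fun x hx =>
      (hΦ x hx).contMDiffAt.contMDiffWithinAt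
    rw [OpenPartialHomeomorph.trans_source]
    exact h1.comp ((contMDiffOn_of_mem_maximalAtlas he).mono inter_subset_left)
      fun q hq => hq.2
  · have h1 : ContMDiffOn 𝓘(ℝ, E3) 𝓘(ℝ, E3) ∞ Φ.symm Φ.target := fun x hx =>
      (hΦ' x hx).contMDiffAt.contMDiffWithinAt
    rw [OpenPartialHomeomorph.trans_target]
    exact (contMDiffOn_symm_of_mem_maximalAtlas he).comp (h1.mono inter_subset_left)
      fun q hq => hq.2

theorem coordVec_trans {Φ : OpenPartialHomeomorph E3 E3} {z : E3}
    (he : e ∈ IsManifold.maximalAtlas 𝓘(ℝ, E3) ∞ M) (hΦ' : ContDiffAt ℝ ∞ Φ.symm z)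
    (hz : z ∈ (e ≫ₕ Φ).target) (i : Fin 3) :
    coordVec (e ≫ₕ Φ) z i
      = ∑ j, (fderiv ℝ Φ.symm z (basisVec i)).ofLp j • coordVec e (Φ.symm z) j := by
  rw [OpenPartialHomeomorph.trans_target] at hz
  have h1 : MDifferentiableAt 𝓘(ℝ, E3) 𝓘(ℝ, E3) Φ.symm z :=
    (hΦ'.differentiableAt (by simp)).mdifferentiableAt
  have h2 := (mdifferentiable_of_mem_maximalAtlas he).mdifferentiableAt_symm hz.2
  have h3 := mfderiv_comp z h2 h1
  rw [mfderiv_eq_fderiv] at h3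
  rw [← mfderiv_symm_eq_sum]
  exact DFunLike.congr_fun h3 (basisVec i)

/-- Compose `e` with the local diffeomorphism given by `y`. Its inverse has Jacobian matrix `K` with
`J K = 1`, which undoes both pullback identities. -/
theorem exists_chart_of_isPullbackOn {p : M} {r : ℝ} {U : Set E3}
    {Gm : E3 → Matrix (Fin 3) (Fin 3) ℝ} {αm : E3 → Fin 3 → ℝ} {y : Fin 3 → E3 → ℝ}
    (he : e ∈ IsManifold.maximalAtlas 𝓘(ℝ, E3) ∞ M) (hp : p ∈ e.source) (hr : 0 < r)
    (hB : ball (e p) r ⊆ e.target)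
    (h : IsPullbackOn (ball (e p) r) (metricIn g e) (fieldIn ξ e) U Gm αm y) :
    ∃ e' ∈ IsManifold.maximalAtlas 𝓘(ℝ, E3) ∞ M, p ∈ e'.source ∧ e'.target ⊆ U ∧
      ∀ z ∈ e'.target, metricIn g e' z = Gm z ∧ contactIn g ξ e' z = αm z := by
  have hJ : ∀ x ∈ ball (e p) r, (jacobian y x).det ≠ 0 := fun x hx =>
    h.det_jacobian_ne_zero ((isRiemannianOn_metricIn g he).det_ne_zero (hB hx)) hx
  obtain ⟨Φ, hx₀, hsub, hΦ, hsymm⟩ :=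
    exists_openPartialHomeomorph isOpen_ball (mem_ball_self hr) h.smooth hJ
  have hΦeq : (Φ : E3 → E3) = fun x => WithLp.toLp 2 fun k => y k x := funext hΦ
  have hΦs : ∀ x ∈ Φ.source, ContDiffAt ℝ ∞ Φ x := fun x hx => by
    rw [hΦeq]
    exact contDiffAt_toLp fun k => h.smooth k x (hsub hx)
  have htar : ∀ z ∈ (e ≫ₕ Φ).target, z ∈ Φ.target := fun z hz => by
    rw [OpenPartialHomeomorph.trans_target] at hz
    exact hz.1
  refine ⟨e ≫ₕ Φ, trans_mem_maximalAtlas he hΦs hsymm, ?_, fun z hz => ?_, fun z hz => ?_⟩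
  · rw [OpenPartialHomeomorph.trans_source]
    exact ⟨hp, hx₀⟩
  · have := h.mapsTo _ (hsub (Φ.map_target (htar z hz)))
    rwa [← hΦ, Φ.right_inv (htar z hz)] at this
  have hzt := htar z hz
  have hxB := hsub (Φ.map_target hzt)
  set x := Φ.symm z with hx
  set K : Matrix (Fin 3) (Fin 3) ℝ :=
    Matrix.of fun j i => (fderiv ℝ Φ.symm z (basisVec i)).ofLp j with hK
  have hFx : (WithLp.toLp 2 fun k => y k x : E3) = z := by rw [← hΦ, Φ.right_inv hzt]
  have hJK : jacobian y x * K = 1 := by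
    have h1 : fderiv ℝ (Φ ∘ Φ.symm) z = (fderiv ℝ Φ x).comp (fderiv ℝ Φ.symm z) :=
      fderiv_comp z ((hΦs x (Φ.map_target hzt)).differentiableAt (by simp))
        ((hsymm z hzt).differentiableAt (by simp))
    have h2 : fderiv ℝ (Φ ∘ Φ.symm) z = ContinuousLinearMap.id ℝ E3 := by
      rw [← fderiv_id (x := z)]
      refine Filter.EventuallyEq.fderiv_eq ?_
      filter_upwards [Φ.open_target.mem_nhds hzt] with w hw
      exact Φ.right_inv hw
    ext k i
    have h3 := congrArg (fun v : E3 => v k) (DFunLike.congr_fun (h1.symm.trans h2) (basisVec i))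
    simp only [ContinuousLinearMap.comp_apply, ContinuousLinearMap.id_apply, basisVec_apply] at h3
    rw [hΦeq] at h3
    rw [Matrix.one_apply]
    refine Eq.trans ?_ h3
    exact (congrFun (fderiv_toLp (fun k => h.smooth k x hxB)
      (fderiv ℝ Φ.symm z (basisVec i))) k).symm
  have hcv := coordVec_trans he (hsymm z hzt) hz
  constructor
  · have h1 : metricIn g (e ≫ₕ Φ) z = Kᵀ * metricIn g e x * K := by
      ext i j
      have : metricIn g (e ≫ₕ Φ) z i j = (fun k => K k i) ⬝ᵥ metricIn g e x *ᵥ fun k => K k j := by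
        rw [dotProduct_metricIn_mulVec]
        simp only [metricIn, Matrix.of_apply, hcv]
        rfl
      rw [this, Matrix.mul_assoc]
      rfl
    rw [h1, h.metric x hxB, hFx]
    calc Kᵀ * ((jacobian y x)ᵀ * Gm z * jacobian y x) * K
        = (jacobian y x * K)ᵀ * Gm z * (jacobian y x * K) := by
          rw [Matrix.transpose_mul]
          simp only [Matrix.mul_assoc]
      _ = Gm z := by rw [hJK]; simp
  · have h1 : contactIn g ξ (e ≫ₕ Φ) z = Kᵀ *ᵥ contactIn g ξ e x := by
      ext i
      have : contactIn g ξ (e ≫ₕ Φ) z i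
          = g.inner (e.symm x) (ξ (e.symm x)) (∑ j, K j i • coordVec e x j) := by
        simp only [contactIn, hcv]
        rfl
      rw [this]
      simp only [map_sum, map_smul, smul_eq_mul]
      rfl
    rw [h1, contactIn_eq he (hB hxB), h.contact x hxB, hFx, Matrix.mulVec_mulVec,
      ← Matrix.transpose_mul, hJK, Matrix.transpose_one, Matrix.one_mulVec]

end ChangeOfChart

end Sasaki
end

/-! ### Constant curvature, `η`-Einstein and Einstein conditions -/

noncomputable section
namespace Sasaki
open Filter Topology Set Metric

/-- A rank one matrix of size three has determinant zero, so `α³ det G = 0`; evaluation on `v` then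
kills `β`. This makes the constants of an `η`-Einstein structure unique. -/
theorem eq_zero_of_smul_add_smul_vecMulVec {G : Matrix (Fin 3) (Fin 3) ℝ} {v : Fin 3 → ℝ}
    {α β : ℝ} (hG : G.det ≠ 0) (hv : v ⬝ᵥ G *ᵥ v = 1)
    (h : α • G + β • Matrix.vecMulVec (G *ᵥ v) (G *ᵥ v) = 0) : α = 0 ∧ β = 0 := by
  have hα : α = 0 := by
    have h1 : α • G = -(β • Matrix.vecMulVec (G *ᵥ v) (G *ᵥ v)) := eq_neg_of_add_eq_zero_left h
    have h2 := congrArg Matrix.det h1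
    rw [Matrix.det_smul, ← neg_smul, Matrix.det_smul] at h2
    have h3 : (Matrix.vecMulVec (G *ᵥ v) (G *ᵥ v)).det = 0 := by
      rw [Matrix.det_fin_three]
      simp only [Matrix.vecMulVec_apply]
      ring
    rw [h3, mul_zero, mul_eq_zero] at h2
    exact eq_zero_of_pow_eq_zero (h2.resolve_right hG)
  refine ⟨hα, ?_⟩
  rw [hα, zero_smul, zero_add] at h
  have h4 := congrArg (fun A => v ⬝ᵥ A *ᵥ v) h
  simp only [Matrix.smul_mulVec, Matrix.vecMulVec_mulVec, Matrix.zero_mulVec,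
    dotProduct_zero, dotProduct_smul] at h4
  simpa [dotProduct_comm (G *ᵥ v), hv] using h4

section SasakianManifold

variable {M : Type*} [TopologicalSpace M] [ChartedSpace E3 M] [IsManifold 𝓘(ℝ, E3) ∞ M]
  {g : SmoothMetric M} {ξ : ∀ p : M, TangentSpace 𝓘(ℝ, E3) p} {e : OpenPartialHomeomorph M E3}
  {x : E3} {W a b : ℝ}

/-- The Ricci tensor of a Sasakian 3-manifold. -/
theorem IsSasakian.ricci_eq (h : IsSasakian g ξ) (he : e ∈ atlas E3 M) (hx : x ∈ e.target) :
    ricci (metricIn g e) x = (2 * tanakaWebster (metricIn g e) x - 2) • metricIn g e x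
      + (4 - 2 * tanakaWebster (metricIn g e) x) •
        Matrix.vecMulVec (contactIn g ξ e x) (contactIn g ξ e x) := by
  have hm := IsManifold.subset_maximalAtlas (I := 𝓘(ℝ, E3)) (n := ∞) he
  rw [contactIn_eq hm hx]
  exact ricci_eq_of_isSasakianOn e.open_target (isRiemannianOn_metricIn g hm)
    (fun k y hy => contDiffAt_fieldIn g hm hy h.smooth k) (h.sasakian e he) hx

/-- Compare the hypothesis with the Ricci formula valid for every Sasakian structure, using the
independence of `g` and `η ⊗ η`. -/
theorem IsSasakian.tanakaWebster_eq (h : IsSasakian g ξ) (hab : IsEtaEinsteinWith g ξ a b)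
    (he : e ∈ atlas E3 M) (hx : x ∈ e.target) :
    a = 2 * tanakaWebster (metricIn g e) x - 2 ∧ b = 4 - 2 * tanakaWebster (metricIn g e) x := by
  have hm := IsManifold.subset_maximalAtlas (I := 𝓘(ℝ, E3)) (n := ∞) he
  have h1 := hab e he x hx
  rw [h.ricci_eq he hx, contactIn_eq hm hx] at h1
  have h2 := eq_zero_of_smul_add_smul_vecMulVec
    (α := a - (2 * tanakaWebster (metricIn g e) x - 2))
    (β := b - (4 - 2 * tanakaWebster (metricIn g e) x))
    ((isRiemannianOn_metricIn g hm).det_ne_zero hx) ((h.sasakian e he).unit x hx) (by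
      rw [sub_smul a, sub_smul b, sub_add_sub_comm, sub_eq_zero]
      exact h1.symm)
  exact ⟨sub_eq_zero.1 h2.1, sub_eq_zero.1 h2.2⟩

theorem HasTanakaWebster.of_hasScalarCurvature {R : ℝ} (h : HasScalarCurvature g R) :
    HasTanakaWebster g ((R + 2) / 4) := fun e he x hx => by rw [tanakaWebster, h e he x hx]

theorem IsSasakian.isEtaEinsteinWith (h : IsSasakian g ξ) (hW : HasTanakaWebster g W) :
    IsEtaEinsteinWith g ξ (2 * W - 2) (4 - 2 * W) := fun e he x hx => by
  rw [h.ricci_eq he hx, hW e he x hx]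

theorem IsSasakian.hasTanakaWebster (h : IsSasakian g ξ) (hab : IsEtaEinsteinWith g ξ a b) :
    HasTanakaWebster g ((a + 2) / 2) := fun e he x hx => by
  have := (h.tanakaWebster_eq hab he hx).1
  linarith

theorem HasTanakaWebster.hasScalarCurvature (h : HasTanakaWebster g W) :
    HasScalarCurvature g (4 * W - 2) := fun e he x hx => by
  have := h e he x hx
  rw [tanakaWebster] at this
  linarith

theorem IsSasakian.add_eq_two [Nonempty M] (h : IsSasakian g ξ)
    (hab : IsEtaEinsteinWith g ξ a b) : a + b = 2 := by
  obtain ⟨p⟩ := ‹Nonempty M›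
  have := h.tanakaWebster_eq hab (chart_mem_atlas E3 p) (mem_chart_target E3 p)
  linarith [this.1, this.2]

/-- Einstein means `η`-Einstein with `b = 0`, and `b = 4 - 2W`. One point of `M` suffices to read
off `W`. -/
theorem IsSasakian.isEinstein_iff [Nonempty M] (h : IsSasakian g ξ) (hW : HasTanakaWebster g W) :
    IsEinstein g ↔ W = 2 := by
  constructor
  · rintro ⟨c, hc⟩
    have hc' : IsEtaEinsteinWith g ξ c 0 := fun e he x hx => by
      rw [hc e he x hx, zero_smul, add_zero]
    obtain ⟨p⟩ := ‹Nonempty M›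
    have h2 := (h.tanakaWebster_eq hc' (chart_mem_atlas E3 p) (mem_chart_target E3 p)).2
    rw [hW _ (chart_mem_atlas E3 p) _ (mem_chart_target E3 p)] at h2
    linarith
  · rintro rfl
    refine ⟨2, fun e he x hx => ?_⟩
    rw [h.isEtaEinsteinWith hW e he x hx]
    norm_num

/-- The passage from coordinates to the manifold, common to the three signs of `W`; the hypothesis
`H` is the integration of the structure equations. -/
theorem IsSasakian.isLocallyOfForm (h : IsSasakian g ξ) (hW : HasTanakaWebster g W) {U : Set E3}
    {Gm : E3 → Matrix (Fin 3) (Fin 3) ℝ} {αm : E3 → Fin 3 → ℝ}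
    (H : ∀ (x₀ : E3) (r : ℝ) (G : E3 → Matrix (Fin 3) (Fin 3) ℝ) (ζ : E3 → Fin 3 → ℝ) (s : ℝ)
      (a b c p : Fin 3 → E3 → ℝ), 0 < r → IsAdaptedCoframe (ball x₀ r) G ζ W s a b c p →
      ∃ r' > 0, r' ≤ r ∧ ∃ y, IsPullbackOn (ball x₀ r') G ζ U Gm αm y) :
    IsLocallyOfForm g ξ U Gm αm := by
  intro p
  have he := chart_mem_atlas E3 p
  have hm := IsManifold.subset_maximalAtlas (I := 𝓘(ℝ, E3)) (n := ∞) he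
  obtain ⟨r, hr, hB, s, a, b, c, q, hA⟩ := exists_adaptedCoframe (chartAt E3 p).open_target
    (isRiemannianOn_metricIn g hm) (fun k y hy => contDiffAt_fieldIn g hm hy h.smooth k)
    (h.sasakian _ he) (mem_chart_target E3 p) (hW _ he)
  obtain ⟨r', hr', hrr, y, hy⟩ := H _ _ _ _ _ _ _ _ _ hr hA
  exact exists_chart_of_isPullbackOn hm (mem_chart_source E3 p) hr'
    ((ball_subset_ball hrr).trans hB) hy

end SasakianManifold

end Sasaki
end

noncomputable section
namespace Sasaki
open Filter Topology Set Metric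

/-! ### Curvature of metrics depending on one coordinate -/

section OneCoordinate

variable {c : Fin 3} {I : Set ℝ} {g h g' : ℝ → Matrix (Fin 3) (Fin 3) ℝ}
  {Γ Γ' : Fin 3 → ℝ → Matrix (Fin 3) (Fin 3) ℝ} {x : E3}

theorem pd_coord (m c : Fin 3) (x : E3) : pd m (fun y => y c) x = if m = c then 1 else 0 := by
  have h : HasFDerivAt (fun y : E3 => y c) (EuclideanSpace.proj c : E3 →L[ℝ] ℝ) x :=
    (EuclideanSpace.proj c : E3 →L[ℝ] ℝ).hasFDerivAt
  rw [pd_apply_eq h]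
  simp [eq_comm]

theorem contDiff_coord (c : Fin 3) : ContDiff ℝ ∞ fun y : E3 => y c :=
  (EuclideanSpace.proj c : E3 →L[ℝ] ℝ).contDiff

/-- The partial derivatives of a function of one coordinate. -/
theorem pd_comp_coord {φ : ℝ → ℝ} {d : ℝ} (m : Fin 3) (hφ : HasDerivAt φ d (x c)) :
    pd m (fun y => φ (y c)) x = if m = c then d else 0 := by
  rw [pd_comp (f := fun y : E3 => y c) m hφ (contDiff_coord c).contDiffAt.diff, pd_coord]
  simp

/-- The Christoffel symbols of a metric that depends on one coordinate. -/
theorem connMatrix_comp_coord (hh : ∀ t ∈ I, g t * h t = 1)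
    (hg : ∀ t ∈ I, ∀ i j, HasDerivAt (fun t => g t i j) (g' t i j) t)
    (hΓ : ∀ t ∈ I, ∀ k i j, (1 / 2) * ∑ l, h t k l * ((if i = c then g' t j l else 0)
      + (if j = c then g' t i l else 0) - (if l = c then g' t i j else 0)) = Γ i t k j)
    (hx : x c ∈ I) (i : Fin 3) : connMatrix (fun y => g (y c)) i x = Γ i (x c) := by
  ext k j
  rw [← hΓ _ hx, connMatrix, Matrix.of_apply, christoffel, Matrix.inv_eq_right_inv (hh _ hx)]
  congr 1
  refine Finset.sum_congr rfl fun l _ => ?_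
  rw [pd_comp_coord (φ := fun t => g t j l) i (hg _ hx j l),
    pd_comp_coord (φ := fun t => g t i l) j (hg _ hx i l),
    pd_comp_coord (φ := fun t => g t i j) l (hg _ hx i j)]

/-- The curvature of a metric that depends on one coordinate. -/
theorem curvMatrix_comp_coord (hI : IsOpen I) (hh : ∀ t ∈ I, g t * h t = 1)
    (hg : ∀ t ∈ I, ∀ i j, HasDerivAt (fun t => g t i j) (g' t i j) t)
    (hΓ : ∀ t ∈ I, ∀ k i j, (1 / 2) * ∑ l, h t k l * ((if i = c then g' t j l else 0)
      + (if j = c then g' t i l else 0) - (if l = c then g' t i j else 0)) = Γ i t k j)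
    (hΓ' : ∀ t ∈ I, ∀ i k j, HasDerivAt (fun t => Γ i t k j) (Γ' i t k j) t)
    (hx : x c ∈ I) (i j : Fin 3) : curvMatrix (fun y => g (y c)) i j x =
      (if i = c then Γ' j (x c) else 0) - (if j = c then Γ' i (x c) else 0)
        + (Γ i (x c) * Γ j (x c) - Γ j (x c) * Γ i (x c)) := by
  have hnear : ∀ᶠ y in 𝓝 x, y c ∈ I :=
    (contDiff_coord c).continuous.continuousAt.eventually (hI.mem_nhds hx)
  have hm : ∀ i j, mpd i (connMatrix (fun y => g (y c)) j) x
      = if i = c then Γ' j (x c) else 0 := by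
    intro i j
    rw [mpd_congr (A' := fun y => Γ j (y c)) i
      (hnear.mono fun y hy => connMatrix_comp_coord hh hg hΓ hy j)]
    ext k l
    rw [mpd, Matrix.of_apply, pd_comp_coord (φ := fun t => Γ j t k l) i (hΓ' _ hx j k l)]
    split_ifs <;> rfl
  rw [curvMatrix_eq, hm, hm, connMatrix_comp_coord hh hg hΓ hx i,
    connMatrix_comp_coord hh hg hΓ hx j]

end OneCoordinate

theorem curvature_apply (G : E3 → Matrix (Fin 3) (Fin 3) ℝ) (x : E3) (X Y Z : Fin 3 → ℝ) :
    curvature G x X Y Z = ∑ i, ∑ j, (X i * Y j) • (curvMatrix G i j x *ᵥ Z) := by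
  ext l
  simp only [curvature, Finset.sum_apply, Pi.smul_apply, Matrix.mulVec, dotProduct, smul_eq_mul,
    Finset.mul_sum, curvMatrix, Matrix.of_apply]
  exact Finset.sum_congr rfl fun i _ => Finset.sum_congr rfl fun j _ =>
    Finset.sum_congr rfl fun k _ => by ring

theorem ricci_apply (G : E3 → Matrix (Fin 3) (Fin 3) ℝ) (x : E3) (j k : Fin 3) :
    ricci G x j k = ∑ i, curvMatrix G i j x i k := rfl

/-- A constant field without component along the only coordinate on which the metric depends: every
term vanishes separately. -/
theorem killing_of_comp_coord {g g' : ℝ → Matrix (Fin 3) (Fin 3) ℝ} {c : Fin 3} {x : E3}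
    (hg : ∀ i j, HasDerivAt (fun t => g t i j) (g' (x c) i j) (x c)) {ζ : Fin 3 → ℝ}
    (hζ : ζ c = 0) (i j : Fin 3) :
    ∑ k, (ζ k * pd k (fun y => g (y c) i j) x + g (x c) k j * pd i (fun _ => ζ k) x
      + g (x c) i k * pd j (fun _ => ζ k) x) = 0 := by
  refine Finset.sum_eq_zero fun k _ => ?_
  rw [pd_const, pd_const, pd_comp_coord (φ := fun t => g t i j) k (hg i j)]
  split_ifs with hk
  · simp [hk, hζ]
  · simp

/-! ### The models with `W ≠ 0` -/

section Profile

/-- The metric `A (dθ² + S² dφ²) + W⁻² (dρ + C dφ)²`, where `2 W A S² = 1 - C²`. -/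
def profileMatrix (A W C : ℝ) : Matrix (Fin 3) (Fin 3) ℝ :=
  !![1 / W ^ 2, 0, C / W ^ 2; 0, A, 0;
    C / W ^ 2, 0, (1 - C ^ 2) / (2 * W) + C ^ 2 / W ^ 2]

/-- Throughout, `(S, C)` stands for `(sin θ, cos θ)` or `(sinh θ, cosh θ)`. The derivatives below
use only `S' = C` and `C' = -(1 - C²) / S`. The middle entry is `1 / A`, with `A` eliminated by `2 W
A S² = 1 - C²`. -/
def profileInv (W S C : ℝ) : Matrix (Fin 3) (Fin 3) ℝ :=
  !![W ^ 2 + 2 * W * C ^ 2 / (1 - C ^ 2), 0, -(2 * W * C / (1 - C ^ 2));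
    0, 2 * W * S ^ 2 / (1 - C ^ 2), 0;
    -(2 * W * C / (1 - C ^ 2)), 0, 2 * W / (1 - C ^ 2)]

def profileDeriv (W S C : ℝ) : Matrix (Fin 3) (Fin 3) ℝ :=
  !![0, 0, -(1 - C ^ 2) / (S * W ^ 2); 0, 0, 0;
    -(1 - C ^ 2) / (S * W ^ 2), 0, C * (1 - C ^ 2) * (W - 2) / (S * W ^ 2)]

def profileConn (W S C : ℝ) : Fin 3 → Matrix (Fin 3) (Fin 3) ℝ :=
  ![!![0, C / (W * S), 0; 0, 0, S / W; 0, -1 / (W * S), 0],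
    !![C / (W * S), 0, ((2 - W) * C ^ 2 - W) / (2 * W * S); 0, 0, 0;
      -1 / (W * S), 0, (W - 1) * C / (W * S)],
    !![0, ((2 - W) * C ^ 2 - W) / (2 * W * S), 0; S / W, 0, (2 - W) * S * C / W;
      0, (W - 1) * C / (W * S), 0]]

def profileConnDeriv (W S C : ℝ) : Fin 3 → Matrix (Fin 3) (Fin 3) ℝ :=
  ![!![0, -1 / (W * S ^ 2), 0; 0, 0, C / W; 0, C / (W * S ^ 2), 0],
    !![-1 / (W * S ^ 2), 0, C * (3 * W - 4 + (2 - W) * C ^ 2) / (2 * W * S ^ 2); 0, 0, 0;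
      C / (W * S ^ 2), 0, -(W - 1) / (W * S ^ 2)],
    !![0, C * (3 * W - 4 + (2 - W) * C ^ 2) / (2 * W * S ^ 2), 0;
      C / W, 0, (2 - W) * (2 * C ^ 2 - 1) / W;
      0, -(W - 1) / (W * S ^ 2), 0]]

variable {A W : ℝ}

theorem profileMatrix_mul_inv {S C : ℝ} (hW : W ≠ 0) (hS : S ≠ 0) (hC : 1 - C ^ 2 ≠ 0)
    (hA : A = (1 - C ^ 2) / (2 * W * S ^ 2)) : profileMatrix A W C * profileInv W S C = 1 := by
  subst hA
  ext i j
  fin_cases i <;> fin_cases j <;>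
    simp [profileMatrix, profileInv, Matrix.mul_apply, Fin.sum_univ_three] <;>
    field_simp <;> ring

theorem profileConn_eq {S C : ℝ} (hW : W ≠ 0) (hS : S ≠ 0) (hC : 1 - C ^ 2 ≠ 0)
    (k i j : Fin 3) : (1 / 2) * ∑ l, profileInv W S C k l *
      ((if i = 1 then profileDeriv W S C j l else 0)
      + (if j = 1 then profileDeriv W S C i l else 0)
      - (if l = 1 then profileDeriv W S C i j else 0)) = profileConn W S C i k j := by
  fin_cases i <;> fin_cases j <;> fin_cases k <;>
    simp [profileInv, profileDeriv, profileConn, Fin.sum_univ_three] <;>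
    field_simp <;> ring

variable {I : Set ℝ} {S C : ℝ → ℝ} {t : ℝ}

theorem hasDerivAt_profileMatrix (hW : W ≠ 0)
    (hC : HasDerivAt C (-(1 - C t ^ 2) / S t) t) (hS0 : S t ≠ 0) (i j : Fin 3) :
    HasDerivAt (fun u => profileMatrix A W (C u) i j) (profileDeriv W (S t) (C t) i j) t := by
  have h02 : HasDerivAt (fun u => C u / W ^ 2) (-(1 - C t ^ 2) / (S t * W ^ 2)) t :=
    (hC.div_const _).congr_deriv (by field_simp)
  have h22 : HasDerivAt (fun u => (1 - C u ^ 2) / (2 * W) + C u ^ 2 / W ^ 2)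
      (C t * (1 - C t ^ 2) * (W - 2) / (S t * W ^ 2)) t :=
    ((((hC.fun_pow 2).const_sub 1).div_const (2 * W)).fun_add
      ((hC.fun_pow 2).div_const (W ^ 2))).congr_deriv (by field_simp; ring)
  fin_cases i <;> fin_cases j <;>
    first
      | exact h02
      | exact h22
      | (simp only [profileMatrix, profileDeriv]; exact hasDerivAt_const t _)

theorem hasDerivAt_profileConn (hW : W ≠ 0) (hS : HasDerivAt S (C t) t)
    (hC : HasDerivAt C (-(1 - C t ^ 2) / S t) t) (hS0 : S t ≠ 0) (i k j : Fin 3) :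
    HasDerivAt (fun u => profileConn W (S u) (C u) i k j)
      (profileConnDeriv W (S t) (C t) i k j) t := by
  have hWS := hS.const_mul W
  have hWS0 : W * S t ≠ 0 := mul_ne_zero hW hS0
  have hWS' : HasDerivAt (fun u => 2 * W * S u) (2 * W * C t) t := hS.const_mul (2 * W)
  have hC2 := hC.fun_pow 2
  have h1 : HasDerivAt (fun u => C u / (W * S u)) (-1 / (W * S t ^ 2)) t :=
    (hC.fun_div hWS hWS0).congr_deriv (by field_simp; ring)
  have h2 : HasDerivAt (fun u => -1 / (W * S u)) (C t / (W * S t ^ 2)) t :=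
    ((hasDerivAt_const t (-1 : ℝ)).fun_div hWS hWS0).congr_deriv (by field_simp; ring)
  have h3 : HasDerivAt (fun u => S u / W) (C t / W) t := hS.div_const W
  have h4 : HasDerivAt (fun u => ((2 - W) * C u ^ 2 - W) / (2 * W * S u))
      (C t * (3 * W - 4 + (2 - W) * C t ^ 2) / (2 * W * S t ^ 2)) t :=
    (((hC2.const_mul (2 - W)).sub_const W).fun_div hWS'
      (mul_ne_zero (mul_ne_zero two_ne_zero hW) hS0)).congr_deriv (by field_simp; ring)
  have h5 : HasDerivAt (fun u => (W - 1) * C u / (W * S u)) (-(W - 1) / (W * S t ^ 2)) t :=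
    ((hC.const_mul (W - 1)).fun_div hWS hWS0).congr_deriv (by field_simp; ring)
  have h6 : HasDerivAt (fun u => (2 - W) * S u * C u / W)
      ((2 - W) * (2 * C t ^ 2 - 1) / W) t :=
    (((hS.const_mul (2 - W)).fun_mul hC).div_const W).congr_deriv (by field_simp; ring)
  fin_cases i <;> fin_cases j <;> fin_cases k <;>
    first
      | exact h1
      | exact h2
      | exact h3
      | exact h4
      | exact h5
      | exact h6
      | (simp only [profileConn, profileConnDeriv]; exact hasDerivAt_const t _)

/-- The curvature matrices `R(∂ᵢ, ∂ⱼ)` of the profile metrics. -/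
def profileCurv (W S C : ℝ) (i j : Fin 3) : Matrix (Fin 3) (Fin 3) ℝ :=
  (if i = 1 then profileConnDeriv W S C j else 0) - (if j = 1 then profileConnDeriv W S C i else 0)
    + (profileConn W S C i * profileConn W S C j - profileConn W S C j * profileConn W S C i)

theorem curvMatrix_profile (hI : IsOpen I) (hW : W ≠ 0)
    (hS : ∀ t ∈ I, HasDerivAt S (C t) t)
    (hC : ∀ t ∈ I, HasDerivAt C (-(1 - C t ^ 2) / S t) t) (hS0 : ∀ t ∈ I, S t ≠ 0)
    (hC0 : ∀ t ∈ I, 1 - C t ^ 2 ≠ 0)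
    (hA : ∀ t ∈ I, A = (1 - C t ^ 2) / (2 * W * S t ^ 2)) {x : E3} (hx : x 1 ∈ I) (i j : Fin 3) :
    curvMatrix (fun y => profileMatrix A W (C (y 1))) i j x
      = profileCurv W (S (x 1)) (C (x 1)) i j :=
  curvMatrix_comp_coord (g := fun t => profileMatrix A W (C t))
    (h := fun t => profileInv W (S t) (C t)) (g' := fun t => profileDeriv W (S t) (C t))
    (Γ := fun i t => profileConn W (S t) (C t) i)
    (Γ' := fun i t => profileConnDeriv W (S t) (C t) i) hI
    (fun t ht => profileMatrix_mul_inv hW (hS0 t ht) (hC0 t ht) (hA t ht))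
    (fun t ht => hasDerivAt_profileMatrix hW (hC t ht) (hS0 t ht))
    (fun t ht => profileConn_eq hW (hS0 t ht) (hC0 t ht))
    (fun t ht => hasDerivAt_profileConn hW (hS t ht) (hC t ht) (hS0 t ht)) hx i j

/-- The Sasakian curvature condition for `ξ = W ∂_ρ`, divided by `W`. -/
theorem profileCurv_mulVec {S C : ℝ} (hW : W ≠ 0) (hS : S ≠ 0)
    (hA : A = (1 - C ^ 2) / (2 * W * S ^ 2)) (X Y : Fin 3 → ℝ) :
    ∑ i, X i • (profileCurv W S C i 0 *ᵥ Y) =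
      ((1 / W ^ 2) * (Y 0 + C * Y 2)) • X - (X ⬝ᵥ profileMatrix A W C *ᵥ Y) • dx 0 := by
  subst hA
  ext l
  fin_cases l <;>
    simp [profileCurv, profileConn, profileConnDeriv, profileMatrix, dx, Matrix.mulVec,
      dotProduct, Fin.sum_univ_three, Matrix.mul_apply] <;>
    field_simp <;> ring

/-- The value `R = 4W - 2` is what makes the parameter `W` the Tanaka-Webster curvature. -/
theorem profile_ricci {S C : ℝ} (hW : W ≠ 0) (hS : S ≠ 0) (hC : 1 - C ^ 2 ≠ 0) :
    ∑ j, ∑ k, profileInv W S C j k * ∑ i, profileCurv W S C i j i k = 4 * W - 2 := by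
  simp [profileCurv, profileConn, profileConnDeriv, profileInv,
      Fin.sum_univ_three, Matrix.mul_apply]
  field_simp
  ring

theorem profileMatrix_eq (A W C : ℝ) : profileMatrix A W C =
    A • sq (dx 1) + ((1 - C ^ 2) / (2 * W)) • sq (dx 2)
      + (1 / W ^ 2) • sq (dx 0 + C • dx 2) := by
  ext i j
  fin_cases i <;> fin_cases j <;> simp [profileMatrix, sq_apply, dx] <;> ring

/-- A sum of squares of three independent covectors, with positive coefficients because `1 - C²` has
the sign of `W`. -/
theorem profileMatrix_posDef {S C : ℝ} (hW : W ≠ 0) (hS : S ≠ 0) (hC : 0 < (1 - C ^ 2) / W)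
    (hA : A = (1 - C ^ 2) / (2 * W * S ^ 2)) : (profileMatrix A W C).PosDef := by
  refine Matrix.PosDef.of_dotProduct_mulVec_pos ?_ fun v hv => ?_
  · ext i j
    fin_cases i <;> fin_cases j <;> simp [profileMatrix]
  · have h : star v ⬝ᵥ profileMatrix A W C *ᵥ v = (1 - C ^ 2) / W / (2 * S ^ 2) * v 1 ^ 2
        + (1 - C ^ 2) / W / 2 * v 2 ^ 2 + (1 / W ^ 2) * (v 0 + C * v 2) ^ 2 := by
      rw [hA]
      simp [profileMatrix, Matrix.mulVec, dotProduct, Fin.sum_univ_three]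
      field_simp
      ring
    rw [h]
    by_contra hle
    have h1 : 0 ≤ (1 - C ^ 2) / W / (2 * S ^ 2) * v 1 ^ 2 := by positivity
    have h2 : 0 ≤ (1 - C ^ 2) / W / 2 * v 2 ^ 2 := by positivity
    have h3 : 0 ≤ (1 / W ^ 2) * (v 0 + C * v 2) ^ 2 := by positivity
    have e1 : (1 - C ^ 2) / W / (2 * S ^ 2) * v 1 ^ 2 = 0 := by linarith
    have e2 : (1 - C ^ 2) / W / 2 * v 2 ^ 2 = 0 := by linarith
    have e3 : (1 / W ^ 2) * (v 0 + C * v 2) ^ 2 = 0 := by linarith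
    have f1 : v 1 = 0 := eq_zero_of_pow_eq_zero ((mul_eq_zero.1 e1).resolve_left (by positivity))
    have f2 : v 2 = 0 := eq_zero_of_pow_eq_zero ((mul_eq_zero.1 e2).resolve_left (by positivity))
    have f3 : v 0 + C * v 2 = 0 :=
      eq_zero_of_pow_eq_zero ((mul_eq_zero.1 e3).resolve_left (by positivity))
    rw [f2, mul_zero, add_zero] at f3
    apply hv
    ext i
    fin_cases i <;> assumption

/-- Metrics with profile functions `S` and `C` are Sasakian of constant curvature. -/
theorem isSasakianModel_profile (hI : IsOpen I) (hW : W ≠ 0)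
    (hS : ∀ t ∈ I, HasDerivAt S (C t) t)
    (hC : ∀ t ∈ I, HasDerivAt C (-(1 - C t ^ 2) / S t) t) (hS0 : ∀ t ∈ I, S t ≠ 0)
    (hC0 : ∀ t ∈ I, 0 < (1 - C t ^ 2) / W)
    (hA : ∀ t ∈ I, A = (1 - C t ^ 2) / (2 * W * S t ^ 2))
    (hCs : ContDiff ℝ ∞ C) :
    IsSasakianModel {x | x 1 ∈ I} (fun x => profileMatrix A W (C (x 1)))
      (fun _ => W • dx 0) (fun x => (1 / W) • (dx 0 + C (x 1) • dx 2)) W := by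
  have hC1 : ∀ t ∈ I, 1 - C t ^ 2 ≠ 0 := fun t ht h0 => by simpa [h0] using hC0 t ht
  have hmul : ∀ x : E3, profileMatrix A W (C (x 1)) *ᵥ (W • dx 0)
      = (1 / W) • (dx 0 + C (x 1) • dx 2) := by
    intro x
    ext i
    fin_cases i <;> simp [profileMatrix, dx, Matrix.mulVec, dotProduct, Fin.sum_univ_three] <;>
      field_simp
  constructor
  · refine ⟨fun i j => ?_, fun x hx => profileMatrix_posDef hW (hS0 _ hx) (hC0 _ hx) (hA _ hx)⟩
    have h1 : ContDiff ℝ ∞ fun x : E3 => C (x 1) := hCs.comp (contDiff_coord 1)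
    fin_cases i <;> fin_cases j <;>
      first
        | exact (h1.div_const _).contDiffOn
        | exact (((contDiff_const.sub (h1.pow 2)).div_const _).add
            ((h1.pow 2).div_const _)).contDiffOn
        | (simp only [profileMatrix]; exact contDiffOn_const)
  · exact fun i => contDiffOn_const
  · refine ⟨fun x hx => ?_, fun x hx i j => ?_, fun x hx X Y => ?_⟩
    · rw [hmul]
      simp [dx]
      field_simp
    · exact killing_of_comp_coord (g := fun t => profileMatrix A W (C t))
        (g' := fun t => profileDeriv W (S t) (C t)) (c := 1) (ζ := W • dx 0)
        (hasDerivAt_profileMatrix hW (hC _ hx) (hS0 _ hx)) (by simp [dx]) i j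
    · have h1 : ∀ i, ∑ j, (X i * (W • dx 0) j) •
          (curvMatrix (fun x => profileMatrix A W (C (x 1))) i j x *ᵥ Y)
          = W • X i • (profileCurv W (S (x 1)) (C (x 1)) i 0 *ᵥ Y) := by
        intro i
        rw [Finset.sum_eq_single 0]
        · rw [curvMatrix_profile hI hW hS hC hS0 hC1 hA hx, smul_smul]
          simp [dx, mul_comm]
        · intro j _ hj
          simp [dx, hj]
        · simp
      have h2 : (W • dx 0) ⬝ᵥ profileMatrix A W (C (x 1)) *ᵥ Y
          = W * ((1 / W ^ 2) * (Y 0 + C (x 1) * Y 2)) := by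
        rw [smul_dotProduct, smul_eq_mul]
        congr 1
        simp [profileMatrix, dx, Matrix.mulVec, dotProduct, Fin.sum_univ_three]
        ring
      rw [curvature_apply, Finset.sum_congr rfl fun i _ => h1 i, ← Finset.smul_sum,
        profileCurv_mulVec hW (hS0 _ hx) (hA _ hx), h2, smul_sub, smul_smul, smul_comm W]
  · intro x hx
    rw [hmul]
  · intro x hx
    have h := profile_ricci hW (hS0 _ hx) (hC1 _ hx)
    rw [tanakaWebster, scalarCurvature]
    simp only [ricci_apply, curvMatrix_profile hI hW hS hC hS0 hC1 hA hx,
      Matrix.inv_eq_right_inv (profileMatrix_mul_inv hW (hS0 _ hx) (hC1 _ hx) (hA _ hx)), h]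
    ring

end Profile

end Sasaki
end

noncomputable section
namespace Sasaki
open Filter Topology Set Metric

/-! ### The three families are Sasakian -/

section Models

theorem posMetric_eq {W : ℝ} (hW : W ≠ 0) :
    posMetric W = fun x => profileMatrix (1 / (2 * W)) W (Real.cos (x 1)) := by
  funext x
  have h : 1 / (2 * W) * (2 / W) = 1 / W ^ 2 := by field_simp
  rw [posMetric, profileMatrix_eq, Real.sin_sq, smul_add, smul_add, smul_smul, smul_smul, h,
    one_div_mul_eq_div]

theorem negMetric_eq {W : ℝ} (hW : W ≠ 0) :
    negMetric W = fun x => profileMatrix (-(1 / (2 * W))) W (Real.cosh (x 1)) := by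
  funext x
  rw [negMetric, profileMatrix_eq, Real.sinh_sq, smul_sub, smul_add, smul_smul, smul_smul,
    sub_eq_add_neg, ← neg_smul]
  congr 3 <;> field_simp
  ring

theorem isSasakianModel_pos {W : ℝ} (hW : 0 < W) :
    IsSasakianModel posDomain (posMetric W) (fun _ => W • dx 0) (posForm W) W := by
  have hs : ∀ t ∈ Ioo 0 Real.pi, Real.sin t ≠ 0 := fun t ht => (Real.sin_pos_of_mem_Ioo ht).ne'
  have hsq : ∀ t, 1 - Real.cos t ^ 2 = Real.sin t ^ 2 := fun t => (Real.sin_sq t).symm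
  rw [posMetric_eq hW.ne']
  refine isSasakianModel_profile (S := Real.sin) (C := Real.cos) isOpen_Ioo hW.ne'
    (fun t _ => Real.hasDerivAt_sin t) (fun t ht => ?_) hs (fun t ht => ?_) (fun t ht => ?_)
    Real.contDiff_cos
  · refine (Real.hasDerivAt_cos t).congr_deriv ?_
    have := hs t ht
    rw [hsq]
    field_simp
  · have := hs t ht
    rw [hsq]
    positivity
  · have := hs t ht
    rw [hsq]
    field_simp

theorem isSasakianModel_neg {W : ℝ} (hW : W < 0) :
    IsSasakianModel negDomain (negMetric W) (fun _ => W • dx 0) (negForm W) W := by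
  have hs : ∀ t ∈ Ioi (0 : ℝ), Real.sinh t ≠ 0 := fun t ht => (Real.sinh_pos_iff.2 ht).ne'
  have hsq : ∀ t, 1 - Real.cosh t ^ 2 = -Real.sinh t ^ 2 := fun t => by
    rw [Real.sinh_sq]
    ring
  rw [negMetric_eq hW.ne]
  refine isSasakianModel_profile (S := Real.sinh) (C := Real.cosh) isOpen_Ioi hW.ne
    (fun t _ => Real.hasDerivAt_sinh t) (fun t ht => ?_) hs (fun t ht => ?_) (fun t ht => ?_)
    Real.contDiff_cosh
  · refine (Real.hasDerivAt_cosh t).congr_deriv ?_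
    have := hs t ht
    rw [hsq]
    field_simp
  · have := hs t ht
    rw [hsq]
    exact div_pos_of_neg_of_neg (neg_lt_zero.2 (by positivity)) hW
  · have := hs t ht
    have := hW.ne
    rw [hsq]
    field_simp

def nilMatrix (t : ℝ) : Matrix (Fin 3) (Fin 3) ℝ :=
  !![1, 2 * t, 0; 2 * t, 1 + 4 * t ^ 2, 0; 0, 0, 1]

def nilInv (t : ℝ) : Matrix (Fin 3) (Fin 3) ℝ :=
  !![1 + 4 * t ^ 2, -2 * t, 0; -2 * t, 1, 0; 0, 0, 1]

def nilDeriv (t : ℝ) : Matrix (Fin 3) (Fin 3) ℝ := !![0, 2, 0; 2, 8 * t, 0; 0, 0, 0]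

def nilConn (t : ℝ) : Fin 3 → Matrix (Fin 3) (Fin 3) ℝ :=
  ![!![0, 0, -2 * t; 0, 0, 1; 0, -1, 0],
    !![0, 0, 1 - 4 * t ^ 2; 0, 0, 2 * t; -1, -4 * t, 0],
    !![-2 * t, 1 - 4 * t ^ 2, 0; 1, 2 * t, 0; 0, 0, 0]]

def nilConnDeriv (t : ℝ) : Fin 3 → Matrix (Fin 3) (Fin 3) ℝ :=
  ![!![0, 0, -2; 0, 0, 0; 0, 0, 0],
    !![0, 0, -8 * t; 0, 0, 2; 0, -4, 0],
    !![-2, -8 * t, 0; 0, 2, 0; 0, 0, 0]]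

theorem nilMetric_eq : nilMetric = fun x => nilMatrix (x 2) := by
  ext x i j
  fin_cases i <;> fin_cases j <;> simp [nilMetric, nilMatrix, sq_apply, dx]
  ring

theorem nilMatrix_mul_inv (t : ℝ) : nilMatrix t * nilInv t = 1 := by
  ext i j
  fin_cases i <;> fin_cases j <;>
    simp [nilMatrix, nilInv, Matrix.mul_apply, Fin.sum_univ_three] <;> ring

theorem hasDerivAt_const_mul_id (c t : ℝ) : HasDerivAt (fun u => c * u) c t := by
  simpa using (hasDerivAt_id t).const_mul c

theorem hasDerivAt_nilMatrix (t : ℝ) (i j : Fin 3) :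
    HasDerivAt (fun u => nilMatrix u i j) (nilDeriv t i j) t := by
  have h1 := hasDerivAt_const_mul_id 2 t
  have h2 : HasDerivAt (fun u : ℝ => 1 + 4 * u ^ 2) (8 * t) t :=
    (((hasDerivAt_pow 2 t).const_mul 4).const_add 1).congr_deriv (by norm_num; ring)
  fin_cases i <;> fin_cases j <;>
    first
      | exact h1
      | exact h2
      | (simp only [nilMatrix, nilDeriv]; exact hasDerivAt_const t _)

theorem hasDerivAt_nilConn (t : ℝ) (i k j : Fin 3) :
    HasDerivAt (fun u => nilConn u i k j) (nilConnDeriv t i k j) t := by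
  have h1 := hasDerivAt_const_mul_id 2 t
  have h2 := hasDerivAt_const_mul_id (-2) t
  have h3 := hasDerivAt_const_mul_id (-4) t
  have h4 : HasDerivAt (fun u : ℝ => 1 - 4 * u ^ 2) (-8 * t) t :=
    (((hasDerivAt_pow 2 t).const_mul 4).const_sub 1).congr_deriv (by norm_num; ring)
  fin_cases i <;> fin_cases j <;> fin_cases k <;>
    first
      | exact h1
      | exact h2
      | exact h3
      | exact h4
      | (simp only [nilConn, nilConnDeriv]; exact hasDerivAt_const t _)

theorem nilConn_eq (t : ℝ) (k i j : Fin 3) : (1 / 2) * ∑ l, nilInv t k l *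
      ((if i = 2 then nilDeriv t j l else 0) + (if j = 2 then nilDeriv t i l else 0)
      - (if l = 2 then nilDeriv t i j else 0)) = nilConn t i k j := by
  fin_cases i <;> fin_cases j <;> fin_cases k <;>
    simp [nilInv, nilDeriv, nilConn, Fin.sum_univ_three] <;> ring

/-- The curvature matrices of the metric of `Nil`. -/
def nilCurv (t : ℝ) (i j : Fin 3) : Matrix (Fin 3) (Fin 3) ℝ :=
  (if i = 2 then nilConnDeriv t j else 0) - (if j = 2 then nilConnDeriv t i else 0)
    + (nilConn t i * nilConn t j - nilConn t j * nilConn t i)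

theorem curvMatrix_nil (x : E3) (i j : Fin 3) :
    curvMatrix (fun y => nilMatrix (y 2)) i j x = nilCurv (x 2) i j :=
  curvMatrix_comp_coord (g := nilMatrix) (h := nilInv) (g' := nilDeriv) (I := univ)
    (Γ := fun i t => nilConn t i) (Γ' := fun i t => nilConnDeriv t i) isOpen_univ
    (fun t _ => nilMatrix_mul_inv t) (fun t _ => hasDerivAt_nilMatrix t)
    (fun t _ => nilConn_eq t) (fun t _ => hasDerivAt_nilConn t) (mem_univ _) i j

theorem nilCurv_mulVec (t : ℝ) (X Y : Fin 3 → ℝ) :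
    ∑ i, X i • (nilCurv t i 0 *ᵥ Y) = (Y 0 + 2 * t * Y 1) • X - (X ⬝ᵥ nilMatrix t *ᵥ Y) • dx 0 := by
  ext l
  fin_cases l <;>
    simp [nilCurv, nilConn, nilConnDeriv, nilMatrix, dx, Matrix.mulVec,
      dotProduct, Fin.sum_univ_three, Matrix.mul_apply] <;> ring

/-- Scalar curvature `-2` corresponds to `W = 0`. -/
theorem nil_ricci (t : ℝ) : ∑ j, ∑ k, nilInv t j k * ∑ i, nilCurv t i j i k = -2 := by
  simp [nilCurv, nilConn, nilConnDeriv, nilInv, Fin.sum_univ_three, Matrix.mul_apply]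
  ring

theorem isSasakianModel_nil : IsSasakianModel univ nilMetric (fun _ => dx 0) nilForm 0 := by
  have hmul : ∀ t, nilMatrix t *ᵥ dx 0 = dx 0 + (2 * t) • dx 1 := by
    intro t
    ext i
    fin_cases i <;> simp [nilMatrix, dx, Matrix.mulVec, dotProduct, Fin.sum_univ_three]
  rw [nilMetric_eq]
  constructor
  · refine ⟨fun i j => ?_, fun x _ => ?_⟩
    · have h1 : ContDiff ℝ ∞ fun x : E3 => 2 * x 2 := contDiff_const.mul (contDiff_coord 2)
      have h2 : ContDiff ℝ ∞ fun x : E3 => 1 + 4 * x 2 ^ 2 :=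
        contDiff_const.add (contDiff_const.mul ((contDiff_coord 2).pow 2))
      fin_cases i <;> fin_cases j <;>
        first
          | exact h1.contDiffOn
          | exact h2.contDiffOn
          | (simp only [nilMatrix]; exact contDiffOn_const)
    · refine Matrix.PosDef.of_dotProduct_mulVec_pos ?_ fun v hv => ?_
      · ext i j
        fin_cases i <;> fin_cases j <;> simp [nilMatrix]
      · have h : star v ⬝ᵥ nilMatrix (x 2) *ᵥ v
            = (v 0 + 2 * x 2 * v 1) ^ 2 + v 1 ^ 2 + v 2 ^ 2 := by
          simp [nilMatrix, Matrix.mulVec, dotProduct, Fin.sum_univ_three]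
          ring
        rw [h]
        by_contra hle
        have f1 : v 1 = 0 := by nlinarith [sq_nonneg (v 0 + 2 * x 2 * v 1), sq_nonneg (v 2)]
        have f2 : v 2 = 0 := by nlinarith [sq_nonneg (v 0 + 2 * x 2 * v 1), sq_nonneg (v 1)]
        have f3 : v 0 = 0 := by
          rw [f1, f2] at hle
          nlinarith
        apply hv
        ext i
        fin_cases i <;> assumption
  · exact fun i => contDiffOn_const
  · refine ⟨fun x _ => ?_, fun x _ i j => ?_, fun x _ X Y => ?_⟩
    · rw [hmul]
      simp [dx]
    · exact killing_of_comp_coord (g := nilMatrix) (g' := nilDeriv) (c := 2) (ζ := dx 0)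
        (hasDerivAt_nilMatrix (x 2)) (by simp [dx]) i j
    · have h1 : ∀ i, ∑ j, (X i * dx 0 j) • (curvMatrix (fun x => nilMatrix (x 2)) i j x *ᵥ Y)
          = X i • (nilCurv (x 2) i 0 *ᵥ Y) := by
        intro i
        rw [Finset.sum_eq_single 0]
        · rw [curvMatrix_nil]
          simp [dx]
        · intro j _ hj
          simp [dx, hj]
        · simp
      have h2 : dx 0 ⬝ᵥ nilMatrix (x 2) *ᵥ Y = Y 0 + 2 * x 2 * Y 1 := by
        simp [nilMatrix, dx, Matrix.mulVec, dotProduct, Fin.sum_univ_three]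
      rw [curvature_apply, Finset.sum_congr rfl fun i _ => h1 i, nilCurv_mulVec, h2]
  · intro x _
    rw [hmul]
    rfl
  · intro x _
    rw [tanakaWebster, scalarCurvature]
    simp only [ricci_apply, curvMatrix_nil, Matrix.inv_eq_right_inv (nilMatrix_mul_inv _),
      nil_ricci]
    norm_num

end Models

end Sasaki
end

noncomputable section
namespace Sasaki
open Filter Topology Set Metric

/-! ### Identification with `Nil` -/

section Nil

theorem fderiv_const_mul_coord (c : ℝ) (k : Fin 3) (x v : E3) :
    fderiv ℝ (fun y : E3 => c * y k) x v = c * v k := by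
  have h : HasFDerivAt (fun y : E3 => c * y k) (c • (EuclideanSpace.proj k : E3 →L[ℝ] ℝ)) x :=
    (EuclideanSpace.proj k : E3 →L[ℝ] ℝ).hasFDerivAt.const_mul c
  rw [h.fderiv]
  simp

/-- The parametrization of `Nil` by `x = -2v`, `y = 2u`, `z = 2r`. -/
def nilParam (x : E3) : Matrix (Fin 3) (Fin 3) ℝ :=
  !![1, -2 * x 2, 2 * x 0; 0, 1, 2 * x 1; 0, 0, 1]

/-- The entries above the diagonal are `dx`, `dy` and `dz - x dy`. For `x = -2v`, `y = 2u`, `z = 2r`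
the last one is `2 (dr + 2v du)`, which explains the factors `1/4` and `1/2` of the identification.
-/
theorem maurerCartan_nilParam (x v : E3) : maurerCartan nilParam x v =
    !![0, -2 * v 2, 2 * (v 0 + 2 * x 2 * v 1); 0, 0, 2 * v 1; 0, 0, 0] := by
  have hinv : (nilParam x)⁻¹ = !![1, 2 * x 2, -2 * x 0 - 4 * x 2 * x 1; 0, 1, -2 * x 1; 0, 0, 1] := by
    refine Matrix.inv_eq_right_inv ?_
    ext i j
    fin_cases i <;> fin_cases j <;>
      simp [nilParam, Matrix.mul_apply, Fin.sum_univ_three]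
    ring
  have hd : (Matrix.of fun i j => fderiv ℝ (fun y => nilParam y i j) x v)
      = !![0, -2 * v 2, 2 * v 0; 0, 0, 2 * v 1; 0, 0, 0] := by
    have h1 := fderiv_const_mul_coord (-2) 2 x v
    have h2 := fderiv_const_mul_coord 2 0 x v
    have h3 := fderiv_const_mul_coord 2 1 x v
    ext i j
    fin_cases i <;> fin_cases j <;>
      first
        | exact h1
        | exact h2
        | exact h3
        | simp [nilParam]
  rw [maurerCartan, hinv, hd]
  ext i j
  fin_cases i <;> fin_cases j <;> simp [Matrix.mul_apply, Fin.sum_univ_three]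
  ring

theorem isNilMap_nilParam : IsNilMap nilMetric nilForm nilParam where
  smooth i j := by
    have h1 : ∀ c k, ContDiff ℝ ∞ fun x : E3 => c * x k := fun c k =>
      contDiff_const.mul (contDiff_coord k)
    fin_cases i <;> fin_cases j <;>
      first
        | exact h1 (-2) 2
        | exact h1 2 0
        | exact h1 2 1
        | (simp only [nilParam]; exact contDiff_const)
  bijOn := by
    refine ⟨fun x _ => ⟨fun i => ?_, fun i j hij => ?_⟩, fun x _ y _ hxy => ?_, fun A hA => ?_⟩
    · fin_cases i <;> simp [nilParam]
    · fin_cases i <;> fin_cases j <;> simp [nilParam] at hij ⊢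
    · have h0 := congrFun (congrFun hxy 0) 2
      have h1 := congrFun (congrFun hxy 1) 2
      have h2 := congrFun (congrFun hxy 0) 1
      simp [nilParam] at h0 h1 h2
      ext i
      fin_cases i <;> assumption
    · refine ⟨!₂[A 0 2 / 2, A 1 2 / 2, -(A 0 1) / 2], mem_univ _, ?_⟩
      have h10 := hA.2 1 0 (by decide)
      have h20 := hA.2 2 0 (by decide)
      have h21 := hA.2 2 1 (by decide)
      ext i j
      fin_cases i <;> fin_cases j <;> simp [nilParam, hA.1, h10, h20, h21] <;> ring
  metric x v w := by
    rw [maurerCartan_nilParam, maurerCartan_nilParam, nilMetric_eq]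
    simp [nilMatrix, Matrix.mulVec, dotProduct, Fin.sum_univ_three]
    ring
  contact x v := by
    rw [maurerCartan_nilParam]
    simp [nilForm, dx, dotProduct, Fin.sum_univ_three]

end Nil

/-! ### Identification with Berger spheres -/

section Hopf

/-- The derivative of a function in polar form. -/
theorem hasFDerivAt_polar {ρ τ : E3 → ℝ} {ρ' τ' : E3 →L[ℝ] ℝ} {x : E3} (hρ : HasFDerivAt ρ ρ' x)
    (hτ : HasFDerivAt τ τ' x) (v : E3) :
    DifferentiableAt ℝ (fun y => (ρ y : ℂ) * Complex.exp (τ y * Complex.I)) x ∧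
    fderiv ℝ (fun y => (ρ y : ℂ) * Complex.exp (τ y * Complex.I)) x v
      = (ρ' v + ρ x * τ' v * Complex.I) * Complex.exp (τ x * Complex.I) := by
  have h1 : HasFDerivAt (fun y => (ρ y : ℂ)) (Complex.ofRealCLM.comp ρ') x :=
    Complex.ofRealCLM.hasFDerivAt.comp x hρ
  have h2 : HasFDerivAt (fun y => (τ y : ℂ)) (Complex.ofRealCLM.comp τ') x :=
    Complex.ofRealCLM.hasFDerivAt.comp x hτ
  have h3 := h1.fun_mul (h2.mul_const Complex.I).cexp
  refine ⟨h3.differentiableAt, ?_⟩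
  rw [h3.fderiv]
  simp
  ring

theorem inner_C2 (v w : C2) :
    inner ℝ v w = ((starRingEnd ℂ (v 0)) * w 0 + (starRingEnd ℂ (v 1)) * w 1).re := by
  simp [PiLp.inner_apply, Fin.sum_univ_two]
  ring

/-- A common phase drops out of the Hermitian product, so inner products in polar form need only the
real and imaginary parts of the amplitudes. -/
theorem re_conj_mul_exp (a b : ℂ) (t : ℝ) :
    (starRingEnd ℂ (a * Complex.exp (t * Complex.I)) * (b * Complex.exp (t * Complex.I))).re
      = a.re * b.re + a.im * b.im := by
  have h : starRingEnd ℂ (Complex.exp (t * Complex.I)) * Complex.exp (t * Complex.I) = 1 := by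
    rw [← Complex.exp_conj, ← Complex.exp_add]
    simp
  rw [map_mul, mul_mul_mul_comm, h, mul_one]
  simp

/-- Polar coordinates of the Hopf fibration. -/
def hopfParam (x : E3) : C2 :=
  !₂[(Real.cos (x 1 / 2) : ℂ) * Complex.exp (((x 0 + x 2) / 2 : ℝ) * Complex.I),
    (Real.sin (x 1 / 2) : ℂ) * Complex.exp (((x 0 - x 2) / 2 : ℝ) * Complex.I)]

theorem contDiff_hopfParam : ContDiff ℝ ∞ hopfParam := by
  have h0 := contDiff_coord 0
  have h1 := contDiff_coord 1
  have h2 := contDiff_coord 2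
  have hc : ContDiff ℝ ∞ fun x : E3 => (Real.cos (x 1 / 2) : ℂ) :=
    Complex.ofRealCLM.contDiff.comp (Real.contDiff_cos.comp (h1.div_const 2))
  have hs : ContDiff ℝ ∞ fun x : E3 => (Real.sin (x 1 / 2) : ℂ) :=
    Complex.ofRealCLM.contDiff.comp (Real.contDiff_sin.comp (h1.div_const 2))
  have ha : ContDiff ℝ ∞ fun x : E3 => (((x 0 + x 2) / 2 : ℝ) : ℂ) :=
    Complex.ofRealCLM.contDiff.comp ((h0.add h2).div_const 2)
  have hb : ContDiff ℝ ∞ fun x : E3 => (((x 0 - x 2) / 2 : ℝ) : ℂ) :=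
    Complex.ofRealCLM.contDiff.comp ((h0.sub h2).div_const 2)
  refine contDiff_piLp _ |>.2 fun i => ?_
  fin_cases i
  · exact hc.mul (ha.mul contDiff_const).cexp
  · exact hs.mul (hb.mul contDiff_const).cexp

theorem fderiv_hopfParam (x v : E3) : fderiv ℝ hopfParam x v =
    !₂[((-Real.sin (x 1 / 2) * v 1 / 2 : ℝ) +
        (Real.cos (x 1 / 2) * (v 0 + v 2) / 2 : ℝ) * Complex.I)
          * Complex.exp (((x 0 + x 2) / 2 : ℝ) * Complex.I),
      ((Real.cos (x 1 / 2) * v 1 / 2 : ℝ) + (Real.sin (x 1 / 2) * (v 0 - v 2) / 2 : ℝ) * Complex.I)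
          * Complex.exp (((x 0 - x 2) / 2 : ℝ) * Complex.I)] := by
  have hk : ∀ k, HasFDerivAt (fun y : E3 => y k) (EuclideanSpace.proj k : E3 →L[ℝ] ℝ) x := fun k =>
    (EuclideanSpace.proj k : E3 →L[ℝ] ℝ).hasFDerivAt
  have h1 := (hk 1).mul_const (1 / 2)
  have hc := hasFDerivAt_polar (h1.cos) (((hk 0).fun_add (hk 2)).mul_const (1 / 2)) v
  have hs := hasFDerivAt_polar (h1.sin) (((hk 0).fun_sub (hk 2)).mul_const (1 / 2)) v
  have hd := (contDiff_hopfParam.differentiable (by simp) x).hasFDerivAt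
  have hcomp : ∀ k, fderiv ℝ (fun y => hopfParam y k) x v = (fderiv ℝ hopfParam x v) k := by
    intro k
    have : HasFDerivAt (fun y => hopfParam y k) _ x :=
      (PiLp.proj 2 (fun _ : Fin 2 => ℂ) k : C2 →L[ℝ] ℂ).hasFDerivAt.comp x hd
    rw [this.fderiv]
    rfl
  ext k
  rw [← hcomp]
  fin_cases k
  · have := hc.2
    simp only [hopfParam]
    simp [div_eq_mul_inv] at this ⊢
    rw [this]
    ring
  · have := hs.2
    simp only [hopfParam]
    simp [div_eq_mul_inv] at this ⊢
    rw [this]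
    ring

theorem inner_polar (a a' b b' : ℂ) (s t : ℝ) :
    inner ℝ (!₂[a * Complex.exp (s * Complex.I), a' * Complex.exp (t * Complex.I)] : C2)
      !₂[b * Complex.exp (s * Complex.I), b' * Complex.exp (t * Complex.I)]
      = a.re * b.re + a.im * b.im + (a'.re * b'.re + a'.im * b'.im) := by
  rw [inner_C2, Complex.add_re, ← re_conj_mul_exp a b s, ← re_conj_mul_exp a' b' t]
  rfl

theorem cos_eq_sq_sub_sq_half (t : ℝ) :
    Real.cos t = Real.cos (t / 2) ^ 2 - Real.sin (t / 2) ^ 2 := by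
  rw [← Real.cos_two_mul', mul_div_cancel₀ t two_ne_zero]

/-- The round metric in Euler angles, `(1/4) [dθ² + sin²θ dφ² + (dρ + cos θ dφ)²]`, with the squares
expanded. -/
theorem inner_fderiv_hopfParam (x v w : E3) :
    inner ℝ (fderiv ℝ hopfParam x v) (fderiv ℝ hopfParam x w)
      = (v 1 * w 1 + v 0 * w 0 + v 2 * w 2 + Real.cos (x 1) * (v 0 * w 2 + v 2 * w 0)) / 4 := by
  rw [fderiv_hopfParam, fderiv_hopfParam, inner_polar, cos_eq_sq_sub_sq_half (x 1)]
  have h := Real.sin_sq_add_cos_sq (x 1 / 2)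
  simp only [Complex.add_re, Complex.add_im, Complex.mul_re, Complex.mul_im, Complex.ofReal_re,
    Complex.ofReal_im, Complex.I_re, Complex.I_im]
  linear_combination (v 1 * w 1 + v 0 * w 0 + v 2 * w 2) / 4 * h

theorem hopfForm_hopfParam (x v : E3) :
    hopfForm (hopfParam x) (fderiv ℝ hopfParam x v) = (v 0 + Real.cos (x 1) * v 2) / 2 := by
  have h1 : Complex.I • hopfParam x =
      !₂[(Complex.I * Real.cos (x 1 / 2)) * Complex.exp (((x 0 + x 2) / 2 : ℝ) * Complex.I),
        (Complex.I * Real.sin (x 1 / 2)) * Complex.exp (((x 0 - x 2) / 2 : ℝ) * Complex.I)] := by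
    ext k
    fin_cases k
    · exact (mul_assoc _ _ _).symm
    · exact (mul_assoc _ _ _).symm
  have h := Real.sin_sq_add_cos_sq (x 1 / 2)
  rw [hopfForm, h1, fderiv_hopfParam, inner_polar, cos_eq_sq_sub_sq_half (x 1)]
  simp only [Complex.add_re, Complex.add_im, Complex.mul_re, Complex.mul_im, Complex.ofReal_re,
    Complex.ofReal_im, Complex.I_re, Complex.I_im]
  linear_combination v 0 / 2 * h

/-- Since `η₀` pulls back to `(dρ + cos θ dφ) / 2`, adding `(2/W - 1) η₀²` multiplies the fibre part
of the round metric by `2/W`; the overall factor `2/W` then gives `1/(2W)` on the base and `1/W²` on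
the fibre. -/
theorem isBergerMap_hopfParam {W : ℝ} (hW : 0 < W) :
    IsBergerMap posDomain (posMetric W) (posForm W) W hopfParam where
  smooth := contDiff_hopfParam.contDiffOn
  mem_sphere x _ := by
    have h : inner ℝ (hopfParam x) (hopfParam x) = (1 : ℝ) := by
      rw [hopfParam, inner_polar]
      have h := Real.sin_sq_add_cos_sq (x 1 / 2)
      simp only [Complex.ofReal_re, Complex.ofReal_im]
      linear_combination h
    rw [real_inner_self_eq_norm_sq] at h
    exact (pow_eq_one_iff_of_nonneg (norm_nonneg _) two_ne_zero).1 h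
  metric x _ v w := by
    rw [inner_fderiv_hopfParam, hopfForm_hopfParam, hopfForm_hopfParam, posMetric_eq hW.ne']
    simp [profileMatrix, Matrix.mulVec, dotProduct, Fin.sum_univ_three]
    field_simp
    ring
  contact x _ v := by
    rw [hopfForm_hopfParam]
    simp [posForm, dx, dotProduct, Fin.sum_univ_three]
    field_simp

end Hopf

end Sasaki
end

noncomputable section
namespace Sasaki
open Filter Topology Set Metric

/-! ### Identification with `SL(2,ℝ)` -/

section SpecialLinear

/-- The matrix `exp (b J)`, a rotation. -/
def slRot (b : ℝ) : Matrix (Fin 2) (Fin 2) ℝ :=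
  !![Real.cos b, Real.sin b; -Real.sin b, Real.cos b]

/-- The matrix `exp (s H)`. -/
def slDiag (s : ℝ) : Matrix (Fin 2) (Fin 2) ℝ := !![Real.exp s, 0; 0, Real.exp (-s)]

/-- Cartan coordinates on `SL(2,ℝ)`. -/
def slParam (x : E3) : Matrix (Fin 2) (Fin 2) ℝ :=
  slRot (x 2 / 2) * slDiag (x 1 / 2) * slRot (x 0 / 2)

theorem slRot_mul_neg (b : ℝ) : slRot b * slRot (-b) = 1 := by
  have h := Real.sin_sq_add_cos_sq b
  ext i j
  fin_cases i <;> fin_cases j <;> simp [slRot, Matrix.mul_apply, Fin.sum_univ_two] <;>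
    first
      | ring1
      | linear_combination h

theorem det_slRot (b : ℝ) : (slRot b).det = 1 := by
  rw [slRot, Matrix.det_fin_two_of]
  linear_combination Real.sin_sq_add_cos_sq b

theorem det_slDiag (s : ℝ) : (slDiag s).det = 1 := by
  rw [slDiag, Matrix.det_fin_two_of, ← Real.exp_add]
  simp

theorem det_slParam (x : E3) : (slParam x).det = 1 := by
  rw [slParam, Matrix.det_mul, Matrix.det_mul, det_slRot, det_slRot, det_slDiag]
  norm_num

/-- The value of the Maurer-Cartan form in Cartan coordinates. -/
def slForm (x v : E3) : Matrix (Fin 2) (Fin 2) ℝ :=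
  slRot (-(x 0 / 2)) * !![v 1 / 2, Real.exp (-(x 1 / 2)) ^ 2 * (v 2 / 2);
    -(Real.exp (x 1 / 2) ^ 2 * (v 2 / 2)), -(v 1 / 2)] * slRot (x 0 / 2)
    + (v 0 / 2) • !![0, 1; -1, 0]

theorem hasFDerivAt_half_coord (k : Fin 3) (x : E3) : HasFDerivAt (fun y : E3 => y k / 2)
    ((1 / 2 : ℝ) • (EuclideanSpace.proj k : E3 →L[ℝ] ℝ)) x := by
  have h := (EuclideanSpace.proj k : E3 →L[ℝ] ℝ).hasFDerivAt (x := x) |>.const_mul (1 / 2 : ℝ)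
  refine h.congr_of_eventuallyEq (Eventually.of_forall fun y => ?_)
  simp
  ring

theorem slParam_apply (x : E3) (i j : Fin 2) : slParam x i j =
    slRot (x 2 / 2) i 0 * (Real.exp (x 1 / 2) * slRot (x 0 / 2) 0 j)
      + slRot (x 2 / 2) i 1 * (Real.exp (-(x 1 / 2)) * slRot (x 0 / 2) 1 j) := by
  simp [slParam, slDiag, Matrix.mul_apply, Fin.sum_univ_two]
  ring

/-- The derivative of a rotation. -/
theorem hasDerivAt_slRot (b : ℝ) (i j : Fin 2) :
    HasDerivAt (fun t => slRot t i j) ((slRot b * !![0, 1; -1, 0] : Matrix _ _ ℝ) i j) b := by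
  have h1 := Real.hasDerivAt_cos b
  have h2 := Real.hasDerivAt_sin b
  have h3 := h2.fun_neg
  fin_cases i <;> fin_cases j <;> simp [slRot, Matrix.mul_apply, Fin.sum_univ_two]
  · exact h1
  · exact h2
  · exact h3
  · exact h1

theorem hasFDerivAt_slRot (k : Fin 3) (x : E3) (i j : Fin 2) :
    HasFDerivAt (fun y : E3 => slRot (y k / 2) i j)
      ((slRot (x k / 2) * !![0, 1; -1, 0] : Matrix _ _ ℝ) i j •
        ((1 / 2 : ℝ) • (EuclideanSpace.proj k : E3 →L[ℝ] ℝ))) x :=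
  HasDerivAt.comp_hasFDerivAt (h₂ := fun t => slRot t i j) x (hasDerivAt_slRot (x k / 2) i j)
    (hasFDerivAt_half_coord k x)

theorem contDiff_slParam (i j : Fin 2) : ContDiff ℝ ∞ fun x => slParam x i j := by
  have h : ∀ k : Fin 3, ContDiff ℝ ∞ fun x : E3 => x k / 2 := fun k =>
    (contDiff_coord k).div_const 2
  have hR : ∀ (k : Fin 3) (i j : Fin 2), ContDiff ℝ ∞ fun x : E3 => slRot (x k / 2) i j := by
    intro k i j
    fin_cases i <;> fin_cases j <;>
      first
        | exact Real.contDiff_cos.comp (h k)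
        | exact Real.contDiff_sin.comp (h k)
        | exact (Real.contDiff_sin.comp (h k)).neg
  simp only [slParam_apply]
  exact ((hR 2 i 0).mul ((h 1).exp.mul (hR 0 0 j))).add
    ((hR 2 i 1).mul ((h 1).neg.exp.mul (hR 0 1 j)))

/-- With `Ψ = R(φ/2) D(θ/2) R(ρ/2)`, `R' = R J` and `D' = D H`, the product rule gives `Ψ⁻¹ dΨ = R⁻¹
(½ dθ H + ½ dφ D⁻¹ J D) R + ½ dρ J`, where `D` and `R` on the right are the last two factors of `Ψ`.
-/
theorem fderiv_slParam (x v : E3) (i j : Fin 2) : fderiv ℝ (fun y => slParam y i j) x v =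
    (slParam x * slForm x v) i j := by
  have h1 := hasFDerivAt_half_coord 1 x
  have h := ((hasFDerivAt_slRot 2 x i 0).fun_mul (h1.exp.fun_mul (hasFDerivAt_slRot 0 x 0 j))).fun_add
    ((hasFDerivAt_slRot 2 x i 1).fun_mul (h1.fun_neg.exp.fun_mul (hasFDerivAt_slRot 0 x 1 j)))
  have hM : slParam x * slForm x v = slRot (x 2 / 2) * (slDiag (x 1 / 2) *
      !![v 1 / 2, Real.exp (-(x 1 / 2)) ^ 2 * (v 2 / 2);
        -(Real.exp (x 1 / 2) ^ 2 * (v 2 / 2)), -(v 1 / 2)] * slRot (x 0 / 2)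
      + (v 0 / 2) • (slDiag (x 1 / 2) * (slRot (x 0 / 2) * !![0, 1; -1, 0]))) := by
    rw [slForm, slParam, mul_add, mul_add]
    congr 1
    · simp only [← Matrix.mul_assoc]
      rw [Matrix.mul_assoc (slRot (x 2 / 2) * slDiag (x 1 / 2)) (slRot (x 0 / 2)), slRot_mul_neg,
        Matrix.mul_one]
    · simp only [Matrix.mul_smul, Matrix.mul_assoc]
  simp only [slParam_apply]
  rw [h.fderiv, hM]
  -- This and the next identity are the entries of `D (D⁻¹ J D) = J D`.
  have h5 : Real.exp (x 1 / 2) * Real.exp (-(x 1 / 2)) ^ 2 = Real.exp (-(x 1 / 2)) := by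
    rw [pow_two, ← Real.exp_add, ← Real.exp_add]
    congr 1
    ring
  have h6 : Real.exp (-(x 1 / 2)) * Real.exp (x 1 / 2) ^ 2 = Real.exp (x 1 / 2) := by
    rw [pow_two, ← Real.exp_add, ← Real.exp_add]
    congr 1
    ring
  fin_cases i <;> fin_cases j <;>
    simp [slRot, slDiag, Matrix.mul_apply, Fin.sum_univ_two]
  · linear_combination Real.cos (x 2 / 2) * Real.sin (x 0 / 2) * (v 2 / 2) * h5
      + Real.sin (x 2 / 2) * Real.cos (x 0 / 2) * (v 2 / 2) * h6
  · linear_combination -Real.cos (x 2 / 2) * Real.cos (x 0 / 2) * (v 2 / 2) * h5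
      + Real.sin (x 2 / 2) * Real.sin (x 0 / 2) * (v 2 / 2) * h6
  · linear_combination -Real.sin (x 2 / 2) * Real.sin (x 0 / 2) * (v 2 / 2) * h5
      + Real.cos (x 2 / 2) * Real.cos (x 0 / 2) * (v 2 / 2) * h6
  · linear_combination Real.sin (x 2 / 2) * Real.cos (x 0 / 2) * (v 2 / 2) * h5
      + Real.cos (x 2 / 2) * Real.sin (x 0 / 2) * (v 2 / 2) * h6

theorem maurerCartan_slParam (x v : E3) : maurerCartan slParam x v = slForm x v := by
  have h : (Matrix.of fun i j => fderiv ℝ (fun y => slParam y i j) x v)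
      = slParam x * slForm x v := by
    ext i j
    exact fderiv_slParam x v i j
  rw [maurerCartan, h, ← Matrix.mul_assoc, Matrix.nonsing_inv_mul _ (by simp [det_slParam]),
    Matrix.one_mul]

theorem exp_half_sq (t : ℝ) : Real.exp (t / 2) ^ 2 = Real.cosh t + Real.sinh t := by
  rw [Real.cosh_add_sinh, ← Real.exp_nat_mul]
  congr 1
  push_cast
  ring

theorem exp_neg_half_sq (t : ℝ) : Real.exp (-(t / 2)) ^ 2 = Real.cosh t - Real.sinh t := by
  rw [Real.cosh_sub_sinh, ← Real.exp_nat_mul]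
  congr 1
  push_cast
  ring

/-- Here `D⁻¹ J D = cosh θ J - sinh θ S`. Conjugation by the rotation of angle `ρ/2` fixes `J` and
turns the plane of `H` and `S` by `ρ`; this gives all three components. -/
theorem slH_slForm (x v : E3) : slH (slForm x v) =
    (Real.cos (x 0) * v 1 + Real.sin (x 0) * Real.sinh (x 1) * v 2) / 2 := by
  have h0 : x 0 = 2 * (x 0 / 2) := by ring
  rw [slH, slForm, exp_half_sq, exp_neg_half_sq, h0, Real.cos_two_mul', Real.sin_two_mul, ← h0]
  simp [slRot, -Real.cosh_add_sinh, -Real.cosh_sub_sinh]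
  ring

theorem slS_slForm (x v : E3) : slS (slForm x v) =
    (Real.sin (x 0) * v 1 - Real.cos (x 0) * Real.sinh (x 1) * v 2) / 2 := by
  have h0 : x 0 = 2 * (x 0 / 2) := by ring
  rw [slS, slForm, exp_half_sq, exp_neg_half_sq, h0, Real.cos_two_mul', Real.sin_two_mul, ← h0]
  simp [slRot, -Real.cosh_add_sinh, -Real.cosh_sub_sinh]
  ring

theorem slJ_slForm (x v : E3) : slJ (slForm x v) = (v 0 + Real.cosh (x 1) * v 2) / 2 := by
  have h := Real.sin_sq_add_cos_sq (x 0 / 2)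
  rw [slJ, slForm, exp_half_sq, exp_neg_half_sq]
  simp [slRot, -Real.cosh_add_sinh, -Real.cosh_sub_sinh]
  linear_combination Real.cosh (x 1) * v 2 * h

/-- The rotation by `ρ` disappears from `ω_H² + ω_S² = (dθ² + sinh²θ dφ²) / 4`, and `ω_J = (dρ +
cosh θ dφ) / 2`, so the factors `-2/W` and `4/W²` produce `-1/(2W)` and `1/W²`. -/
theorem isSLMap_slParam {W : ℝ} (hW : W < 0) :
    IsSLMap negDomain (negMetric W) (negForm W) W slParam where
  smooth i j := (contDiff_slParam i j).contDiffOn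
  det_eq x _ := det_slParam x
  metric x _ v w := by
    rw [maurerCartan_slParam, maurerCartan_slParam, slH_slForm, slH_slForm, slS_slForm,
      slS_slForm, slJ_slForm, slJ_slForm, negMetric_eq hW.ne]
    have hW' := hW.ne
    have h1 := Real.sin_sq_add_cos_sq (x 0)
    have h2 := Real.cosh_sq (x 1)
    have h3 : Real.cos (x 0) ^ 2 = 1 - Real.sin (x 0) ^ 2 := by linear_combination h1
    simp [profileMatrix, Matrix.mulVec, dotProduct, Fin.sum_univ_three]
    field_simp
    ring_nf
    rw [h3, h2]
    ring
  contact x _ v := by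
    rw [maurerCartan_slParam, slJ_slForm]
    simp [negForm, dx, dotProduct, Fin.sum_univ_three]
    ring

end SpecialLinear

end Sasaki
end

/-! ### The theorem -/

open Sasaki
theorem mainTheorem5 :
    (∀ (M : Type*) [TopologicalSpace M] [ChartedSpace E3 M] [IsManifold 𝓘(ℝ, E3) ∞ M] [Nonempty M]
        (g : SmoothMetric M) (ξ : ∀ p : M, TangentSpace 𝓘(ℝ, E3) p), IsSasakian g ξ →
      ((∃ R, HasScalarCurvature g R) ↔ ∃ a b, IsEtaEinsteinWith g ξ a b) ∧
      (∀ a b, IsEtaEinsteinWith g ξ a b →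
        a + b = 2 ∧ HasScalarCurvature g (3 * a + b) ∧ HasScalarCurvature g (2 * (a + 1)) ∧
        HasTanakaWebster g ((a + 2) / 2)) ∧
      (∀ R, HasScalarCurvature g R → HasTanakaWebster g ((R + 2) / 4)) ∧
      (∀ W, HasTanakaWebster g W →
        (0 < W → IsLocallyOfForm g ξ posDomain (posMetric W) (posForm W)) ∧
        (W = 0 → IsLocallyOfForm g ξ Set.univ nilMetric nilForm) ∧
        (W < 0 → IsLocallyOfForm g ξ negDomain (negMetric W) (negForm W)) ∧
        (IsEinstein g ↔ W = 2))) ∧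
    (∀ W : ℝ, 0 < W →
      IsSasakianModel posDomain (posMetric W) (fun _ => W • dx 0) (posForm W) W ∧
      ∃ Ψ, IsBergerMap posDomain (posMetric W) (posForm W) W Ψ) ∧
    (IsSasakianModel Set.univ nilMetric (fun _ => dx 0) nilForm 0 ∧
      ∃ Ψ, IsNilMap nilMetric nilForm Ψ) ∧
    (∀ W : ℝ, W < 0 →
      IsSasakianModel negDomain (negMetric W) (fun _ => W • dx 0) (negForm W) W ∧
      ∃ Ψ, IsSLMap negDomain (negMetric W) (negForm W) W Ψ) := by
  refine ⟨fun M _ _ _ _ g ξ h => ⟨⟨?_, ?_⟩, fun a b hab => ⟨h.add_eq_two hab, ?_, ?_,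
    h.hasTanakaWebster hab⟩, fun R hR => .of_hasScalarCurvature hR, fun W hW => ⟨fun h0 => ?_,
    fun h0 => ?_, fun h0 => ?_, h.isEinstein_iff hW⟩⟩, fun W hW => ⟨isSasakianModel_pos hW,
    hopfParam, isBergerMap_hopfParam hW⟩, ⟨isSasakianModel_nil, nilParam, isNilMap_nilParam⟩,
    fun W hW => ⟨isSasakianModel_neg hW, slParam, isSLMap_slParam hW⟩⟩
  · rintro ⟨R, hR⟩
    exact ⟨_, _, h.isEtaEinsteinWith (.of_hasScalarCurvature hR)⟩
  · rintro ⟨a, b, hab⟩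
    exact ⟨_, (h.hasTanakaWebster hab).hasScalarCurvature⟩
  · have hS := (h.hasTanakaWebster hab).hasScalarCurvature
    rwa [show 4 * ((a + 2) / 2) - 2 = 3 * a + b by linarith [h.add_eq_two hab]] at hS
  · have hS := (h.hasTanakaWebster hab).hasScalarCurvature
    rwa [show 4 * ((a + 2) / 2) - 2 = 2 * (a + 1) by ring] at hS
  · exact h.isLocallyOfForm hW fun _ _ _ _ _ _ _ _ _ hr hA => hA.exists_pullback_pos hr h0
  · subst h0
    exact h.isLocallyOfForm hW fun _ _ _ _ _ _ _ _ _ hr hA => hA.exists_pullback_nil hr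
  · exact h.isLocallyOfForm hW fun _ _ _ _ _ _ _ _ _ hr hA => hA.exists_pullback_neg hr h0
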